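/- Let $(b_j)_{j\ge 0}$ be reals with $b_j\ge 0$ for $j\ne 1$ and $0<-b_1=\sum_{j\neq 1}b_j<\infty$. Put $q_{ij}=i\,b_{j-i+1}$ if $i\ge 1$ and $j\ge i-1$, and $q_{ij}=0$ otherwise. Let $\{X(t);t\ge 0\}$ be a regular Markov branching process with rates $(b_j)$ and $X(0)=1$. That is, $X$ is a continuous-time Markov chain on $\mathbb Z_+=\{0,1,2,\dots\}$ whose transition function satisfies $p_{ij}'(t)=\sum_{k}p_{ik}(t)q_{kj}$ for $i\ge 0$, $j\ge 1$, $t\ge 0$, and which does not explode: almost surely, its paths are right-continuous step functions with finitely many jumps in bounded time intervals. Let $\mathbb N\subset\mathbb Z_+$ be a finite set with $1\notin\mathbb N$ and $b_k>0$ for all $k\in\mathbb N$; write $N=|\mathbb N|$ and $\mathbb N^c=\mathbb Z_+\setminus\mathbb N$. Let $\mathbf Y(t)=(Y_k(t))_{k\in\mathbb N}$, where $Y_k(t)$ is the $(k-1)$-range crossing number of $X$ until time $t$, i.e. the number of jumps of $X$ of size $k-1$ in $(0,t]$. Multi-indices $\mathbf k,\mathbf l\in\mathbb Z_+^N$ and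 vectors $\mathbf v$ have coordinates indexed by $\mathbb N$, $\mathbf v^{\mathbf k}=\prod_{i\in\mathbb N}v_i^{k_i}$, and $\mathbf e_i$ is the $i$th unit vector. For $u\in[0,1]$ and $\mathbf v\in[0,1]^N$ put $$B_{\mathbb N}(u,\mathbf v)=\sum_{j\in\mathbb N}b_jv_ju^j,\qquad \bar B_{\mathbb N}(u)=\sum_{j\in\mathbb N^c}b_ju^j .$$ **Theorem 3.1.** (a) For all $u\in[0,1]$ and $\mathbf v\in[0,1]^N$ the equation $$\frac{\partial y}{\partial t}=B_{\mathbb N}(y,\mathbf v)+\bar B_{\mathbb N}(y)\quad(t\ge 0),\qquad y|_{t=0}=u,$$ has a unique solution $y=G(t,u,\mathbf v)$ with values in $[0,1]$, and for all $t\ge 0$ and $\mathbf v\in[0,1]^N$ $$E[\mathbf v^{\mathbf Y(t)}]=G(t,1,\mathbf v).$$ (b) For all $t\ge 0$ and $\mathbf k\in\mathbb Z_+^N$, $P(\mathbf Y(t)=\mathbf k)=g_{\mathbf k}(t)$, where the functions $g_{\mathbf k}$ on $[0,\infty)$ are uniquely determined by the recursion $$g_{\mathbf 0}(t)=G(t,1,\mathbf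 0),\qquad g_{\mathbf k}(t)=\bar B_{\mathbb N}(g_{\mathbf 0}(t))\int_0^t\frac{F_{\mathbf k}(s)}{\bar B_{\mathbb N}(g_{\mathbf 0}(s))}\,ds\quad(\mathbf k\neq\mathbf 0),$$ with $$F_{\mathbf k}(t)=\sum_{i\in\mathbb N}b_i\,g^{*(i)}_{\mathbf k-\mathbf e_i}(t)+\sum_{i\in\mathbb N^c}b_i\sum_{\substack{\mathbf l_1,\dots,\mathbf l_i\neq\mathbf k\\ \mathbf l_1+\cdots+\mathbf l_i=\mathbf k}}g_{\mathbf l_1}(t)\cdots g_{\mathbf l_i}(t).$$ Here $g^{*(i)}_{\mathbf l}=\sum_{\mathbf l_1+\cdots+\mathbf l_i=\mathbf l}g_{\mathbf l_1}\cdots g_{\mathbf l_i}$ is the $i$th convolution ($g^{*(0)}_{\mathbf 0}=1$, $g^{*(0)}_{\mathbf l}=0$ for $\mathbf l\ne\mathbf 0$), and $g^{*(i)}_{\mathbf k-\mathbf e_i}=0$ if $\mathbf k-\mathbf e_i\notin\mathbb Z_+^N$. For $\mathbf k\ne\mathbf 0$ the denominator $\bar B_{\mathbb N}(g_{\mathbf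 0}(s))$ never vanishes, the series in $F_{\mathbf k}$ converges and the integrand is integrable on $[0,t]$. -/

import Mathlib

open MeasureTheory Set Filter Topology

noncomputable section

namespace BranchingCrossing

/-- The rates of a Markov branching process: `b j ≥ 0` for `j ≠ 1` and
`0 < -b 1 = ∑_{j ≠ 1} b j < ∞`. -/
structure IsBranchingRates (b : ℕ → ℝ) : Prop where
  nonneg : ∀ j, j ≠ 1 → 0 ≤ b j
  pos : 0 < -b 1
  hasSum : HasSum (fun j => if j = 1 then 0 else b j) (-b 1)

/-- The branching `Q`-matrix: `q i j = i * b (j - i + 1)` if `i ≥ 1` and `j ≥ i - 1`,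
and `0` otherwise. -/
def branchingQ (b : ℕ → ℝ) (i j : ℕ) : ℝ :=
  if 1 ≤ i ∧ i ≤ j + 1 then (i : ℝ) * b (j + 1 - i) else 0

/-- An (honest) transition function on `ℕ`; only times `t ≥ 0` matter. -/
structure IsTransitionFunction (p : ℝ → ℕ → ℕ → ℝ) : Prop where
  nonneg : ∀ t, 0 ≤ t → ∀ i j, 0 ≤ p t i j
  hasSum_one : ∀ t, 0 ≤ t → ∀ i, HasSum (fun j => p t i j) 1
  zero : ∀ i j, p 0 i j = if i = j then 1 else 0
  chapman_kolmogorov : ∀ s t, 0 ≤ s → 0 ≤ t → ∀ i j,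
    HasSum (fun k => p s i k * p t k j) (p (s + t) i j)

/-- The forward equations `p'_{ij}(t) = ∑_k p_{ik}(t) q_{kj}`, `i ≥ 0`, `j ≥ 1`, `t ≥ 0`
(one-sided derivative at `t = 0`). For fixed `j` only the terms `k ≤ j + 1` can be nonzero. -/
def SatisfiesForwardEquation (b : ℕ → ℝ) (p : ℝ → ℕ → ℕ → ℝ) : Prop :=
  ∀ i j, 1 ≤ j → ∀ t, 0 ≤ t →
    HasDerivWithinAt (fun r => p r i j) (∑' k, p t i k * branchingQ b k j) (Ici 0) t

/-- A path (on times `t ≥ 0`) which does not explode: it is right continuous and has left limits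
in the discrete space `ℕ`, hence is a step function with finitely many jumps in bounded time. -/
def IsRegularPath (x : ℝ → ℕ) : Prop :=
  (∀ t, 0 ≤ t → ∀ᶠ r in 𝓝[>] t, x r = x t) ∧
    ∀ t, 0 < t → ∃ i, ∀ᶠ r in 𝓝[<] t, x r = i

/-- `X` is a regular Markov branching process with rates `b` and `X 0 = i₀`: a continuous-time
Markov chain (given by its finite-dimensional distributions) whose transition function satisfies
the forward equations of the branching `Q`-matrix, and whose paths almost surely do not explode. -/
structure IsRegularMBP {Ω : Type*} [MeasurableSpace Ω] (P : Measure Ω)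
    (b : ℕ → ℝ) (i₀ : ℕ) (X : ℝ → Ω → ℕ) : Prop where
  measurable : ∀ t, 0 ≤ t → Measurable (X t)
  markov : ∃ p : ℝ → ℕ → ℕ → ℝ, IsTransitionFunction p ∧ SatisfiesForwardEquation b p ∧
    ∀ (n : ℕ) (t : ℕ → ℝ) (j : ℕ → ℕ), t 0 = 0 → Monotone t →
      P.real {ω | ∀ m ≤ n, X (t m) ω = j m} =
        (if j 0 = i₀ then 1 else 0) *
          ∏ m ∈ Finset.range n, p (t (m + 1) - t m) (j m) (j (m + 1))
  regular : ∀ᵐ ω ∂P, IsRegularPath fun t => X t ω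

/-- The `(k - 1)`-range crossing number of the path `x` until time `t`: the number of times
`s ∈ (0, t]` at which `x` jumps from its left limit `i` to `i - 1 + k`. -/
def crossingNumber (x : ℝ → ℕ) (k : ℕ) (t : ℝ) : ℕ :=
  Set.ncard {s : ℝ | 0 < s ∧ s ≤ t ∧
    ∃ i : ℕ, (∀ᶠ r in 𝓝[<] s, x r = i) ∧ x s + 1 = i + k}

/-- The vector `Y(t) = (Y_k(t))_{k ∈ N}` of crossing numbers. -/
def crossingVector {Ω : Type*} (N : Finset ℕ) (X : ℝ → Ω → ℕ) (t : ℝ) (ω : Ω) : N → ℕ :=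
  fun k => crossingNumber (fun s => X s ω) k t

/-- `B_N(u, v) = ∑_{j ∈ N} b_j v_j u^j`. -/
def BN (b : ℕ → ℝ) (N : Finset ℕ) (u : ℝ) (v : N → ℝ) : ℝ :=
  ∑ j : N, b j * v j * u ^ (j : ℕ)

/-- `\bar B_N(u) = ∑_{j ∉ N} b_j u^j`. -/
def BbarN (b : ℕ → ℝ) (N : Finset ℕ) (u : ℝ) : ℝ :=
  ∑' j : ℕ, if j ∈ N then 0 else b j * u ^ j

/-- `y : [0, ∞) → [0, 1]` solves `y' = B_N(y, v) + \bar B_N(y)`, `y(0) = u`. -/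
structure IsSolution (b : ℕ → ℝ) (N : Finset ℕ) (u : ℝ) (v : N → ℝ) (y : ℝ → ℝ) : Prop where
  mem_Icc : ∀ t, 0 ≤ t → y t ∈ Icc (0 : ℝ) 1
  initial : y 0 = u
  hasDeriv : ∀ t, 0 ≤ t →
    HasDerivWithinAt y (BN b N (y t) v + BbarN b N (y t)) (Ici 0) t

/-- The `j`-tuples of multi-indices with sum `l`. -/
def decompositions {ι : Type*} [Fintype ι] [DecidableEq ι] (j : ℕ) (l : ι → ℕ) :
    Finset (Fin j → ι → ℕ) :=
  (Fintype.piFinset fun _ : Fin j => Finset.Iic l).filter fun κ => ∑ m, κ m = l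

theorem mem_decompositions {ι : Type*} [Fintype ι] [DecidableEq ι] (j : ℕ) (l : ι → ℕ)
    (κ : Fin j → ι → ℕ) : κ ∈ decompositions j l ↔ ∑ m, κ m = l := by
  simp only [decompositions, Finset.mem_filter, Fintype.mem_piFinset, Finset.mem_Iic,
    and_iff_right_iff_imp]
  rintro rfl m
  exact Finset.single_le_sum (fun i _ => zero_le) (Finset.mem_univ m)

/-- The `j`-th convolution `f^{*(j)}_l = ∑_{k₁ + ⋯ + k_j = l} f_{k₁} ⋯ f_{k_j}`. -/
def convPow {ι : Type*} [Fintype ι] [DecidableEq ι] (f : (ι → ℕ) → ℝ) (j : ℕ) (l : ι → ℕ) : ℝ :=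
  ∑ κ ∈ decompositions j l, ∏ m, f (κ m)

/-- The part of the `j`-th convolution at `l` in which no index equals `l` itself. -/
def convPowNe {ι : Type*} [Fintype ι] [DecidableEq ι] (f : (ι → ℕ) → ℝ) (j : ℕ) (l : ι → ℕ) :
    ℝ :=
  ∑ κ ∈ (decompositions j l).filter (fun κ => ∀ m, κ m ≠ l), ∏ m, f (κ m)

/-- `F_k` at a fixed time, built from the values `f l = g_l(t)`; the term with `k - e_i` is `0`
if `k - e_i` has a negative entry. -/
def recF (b : ℕ → ℝ) (N : Finset ℕ) (f : (N → ℕ) → ℝ) (k : N → ℕ) : ℝ :=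
  (∑ i : N, b i * if 1 ≤ k i then convPow f i (k - Pi.single i 1) else 0) +
    ∑' i : ℕ, if i ∈ N then 0 else b i * convPowNe f i k

/-- The recursion for `(g_k(t))`, with `g₀` in the place of `G(t, 1, 0)`. -/
def SatisfiesRecursion (b : ℕ → ℝ) (N : Finset ℕ) (g₀ : ℝ → ℝ) (g : (N → ℕ) → ℝ → ℝ) : Prop :=
  (∀ t, 0 ≤ t → g 0 t = g₀ t) ∧
    ∀ k, k ≠ 0 → ∀ t, 0 ≤ t →
      g k t = BbarN b N (g 0 t) *
        ∫ s in (0 : ℝ)..t, recF b N (fun l => g l s) k / BbarN b N (g 0 s)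

end BranchingCrossing

end

/-!
The theorem reduces to one infinite system of linear differential equations. Write
`φ_j(t) = E[v ^ Y(t); X(t) = j]` (`weightedRow`). In a short time `h` the chain either stays where
it is or, up to probability `o(h)`, makes a single jump, and the Markov property turns this into the
forward equation of the branching `Q`-matrix with the rates `b_j v_j` (`j ∈ N`) and `b_j` (`j ∉ N`)
(`IsChain.hasDerivWithinAt_weightedRow`). Since only the finite-dimensional distributions are given,
crossings are counted along partitions whose mesh tends to `0`.

The forward equation at `j = 0` is not among the hypotheses. Without it, mass could reach `0` from
infinity; it holds because the transition function is honest (`flux_le`) and because almost every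
path is bounded on bounded intervals (`IsChain.le_flux`).

*The generating function.* For the bounded solution `φ` of the forward equation,
`∑ⱼ φ_j(t) uʲ = E[u ^ X(t) v ^ Y(t)]` is constant along the characteristics of a first-order linear
partial differential equation, and these are the solutions of `y' = B_N(y, v) + \bar B_N(y)`
(`tsum_transport`). As `X(0) = 1`, every solution starting at `u < 1` equals `E[u ^ X(t) v ^ Y(t)]`
(`IsRegularChain.solution_eq_jointPgf`). The vector field is locally Lipschitz on `[0, 1)`, but
possibly not at `1`. There, existence follows from `u → 1` in the integral equation, and uniqueness
by restarting a solution just after it has left `1`; that `X` is honest, i.e. `E[1 ^ X(t)] = 1`,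
excludes that a solution leaves `1` when all weights are `1`
(`IsRegularChain.eq_jointPgf_of_isSolution`). At `u = 1` the generating function is `E[v ^ Y(t)]`.

*The recursion.* Comparing coefficients of `v ^ k` in the integral equation for `E[v ^ Y(t)]` gives
a differential equation for `g_k(t) = P(Y(t) = k)` (`IsRegularChain.hasDerivWithinAt_crossingLaw`).
Its right-hand side is `\bar B_N'(g_0) g_k + F_k`, where `F_k` involves only indices below `k`
(`flowCoeff_eq_add_recF`, `recursion_congr`). Since `g_0' = \bar B_N(g_0)`, the function
`\bar B_N(g_0)` solves the homogeneous equation, and it has no zeros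
(`IsRegularChain.field_jointPgf_one_neg`); variation of constants yields the recursion
(`IsRegularChain.crossingLaw_recursion`).
-/

namespace BranchingCrossing

/-! ### Power series and transport along characteristics -/

/-- Rates of a branching mechanism with killing: nonnegative off `j = 1`, with `c 1 = -β` and
total mass at most `0`. Multiplying the rates `b j`, `j ∈ N`, by weights in `[0, 1]` produces such
a family. -/
structure IsSubRates (β : ℝ) (c : ℕ → ℝ) : Prop where
  nonneg : ∀ j, j ≠ 1 → 0 ≤ c j
  one : c 1 = -β
  summable : Summable c
  tsum_le : ∑' j, c j ≤ 0

/-- The power series `∑ⱼ cⱼ uʲ`. With `c` a family of rates it is the vector field of the ordinary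
differential equation; with `c` a row of probabilities it is a generating function. -/
noncomputable def field (c : ℕ → ℝ) (u : ℝ) : ℝ := ∑' j, c j * u ^ j

/-- The `j`-th component of the forward equation for the rates `c`: the sum over the states
`i + 1 ≤ j + 1` of `a (i + 1)` times the rate `(i + 1) c (j - i)` of a jump from `i + 1` to
`j`. -/
def forwardRHS (c a : ℕ → ℝ) (j : ℕ) : ℝ :=
  ∑ i ∈ Finset.range (j + 1), ((i : ℝ) + 1) * a (i + 1) * c (j - i)

theorem summable_mul_pow {c : ℕ → ℝ} (hc : Summable c) {u : ℝ} (hu : u ∈ Icc (0 : ℝ) 1) :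
    Summable fun j => c j * u ^ j := by
  refine Summable.of_norm_bounded hc.norm fun j => ?_
  rw [norm_mul, norm_pow, Real.norm_of_nonneg hu.1]
  exact mul_le_of_le_one_right (norm_nonneg _) (pow_le_one₀ hu.1 hu.2)

/-- Tail bound for the vector field on `[0, ρ]`. -/
theorem abs_field_sub_sum_le {c : ℕ → ℝ} (hc : Summable c) {z ρ : ℝ} (hz : 0 ≤ z) (hzρ : z ≤ ρ)
    (hρ : ρ ≤ 1) (m : ℕ) :
    |∑ l ∈ Finset.range m, c l * z ^ l - field c z| ≤ ρ ^ m * ∑' l, |c l| := by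
  have hs := summable_mul_pow hc (u := z) ⟨hz, hzρ.trans hρ⟩
  have hρ0 := hz.trans hzρ
  have h1 : ∑ l ∈ Finset.range m, c l * z ^ l - field c z = -∑' l, c (l + m) * z ^ (l + m) := by
    rw [field, ← hs.sum_add_tsum_nat_add m]; ring
  have habs : Summable fun l => |c (l + m)| := (summable_nat_add_iff m).2 hc.abs
  rw [h1, abs_neg]
  calc |∑' l, c (l + m) * z ^ (l + m)| ≤ ∑' l, ρ ^ m * |c (l + m)| := by
        refine tsum_of_norm_bounded (f := fun l => c (l + m) * z ^ (l + m))
          (habs.mul_left _).hasSum fun l => ?_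
        rw [norm_mul, norm_pow, Real.norm_of_nonneg hz, Real.norm_eq_abs, mul_comm]
        gcongr
        calc z ^ (l + m) ≤ ρ ^ (l + m) := by gcongr
          _ ≤ ρ ^ m := pow_le_pow_of_le_one hρ0 hρ (by omega)
    _ = ρ ^ m * ∑' l, |c (l + m)| := tsum_mul_left
    _ ≤ ρ ^ m * ∑' l, |c l| := by
        refine mul_le_mul_of_nonneg_left ?_ (by positivity)
        rw [← hc.abs.sum_add_tsum_nat_add m]
        exact le_add_of_nonneg_left (Finset.sum_nonneg fun _ _ => abs_nonneg _)

/-- The forward equation says formally that `K = ∑ⱼ aⱼ zʲ` satisfies `∂ₜ K = field c z * ∂_z K`.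
For the partial sums this holds up to an error of order `n² ρⁿ` when `0 ≤ z ≤ ρ`. -/
theorem abs_transport_error_le {c : ℕ → ℝ} (hc : Summable c) {a : ℕ → ℝ} {C : ℝ}
    (ha : ∀ j, |a j| ≤ C) {z ρ : ℝ} (hz : 0 ≤ z) (hzρ : z ≤ ρ) (hρ : ρ ≤ 1) (n : ℕ) :
    |∑ j ∈ Finset.range (n + 1), (forwardRHS c a j * z ^ j
        - a j * (j * z ^ (j - 1) * field c z))| ≤
      C * (∑' l, |c l|) * (((n : ℝ) + 1) ^ 2 * ρ ^ n) := by
  have hρ0 := hz.trans hzρ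
  have hC : 0 ≤ C := (abs_nonneg _).trans (ha 0)
  set S := ∑' l, |c l| with hS
  have hS0 : 0 ≤ S := tsum_nonneg fun _ => abs_nonneg _
  have h1 : ∑ j ∈ Finset.range (n + 1), forwardRHS c a j * z ^ j =
      ∑ i ∈ Finset.range (n + 1), ((i : ℝ) + 1) * a (i + 1) * z ^ i *
        ∑ l ∈ Finset.range (n + 1 - i), c l * z ^ l := by
    have := Finset.sum_range_diag_flip (n + 1)
      (fun i l => ((i : ℝ) + 1) * a (i + 1) * z ^ i * (c l * z ^ l))
    simp only [Finset.mul_sum]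
    rw [← this]
    refine Finset.sum_congr rfl fun j _ => ?_
    rw [forwardRHS, Finset.sum_mul]
    refine Finset.sum_congr rfl fun i hi => ?_
    have : j = i + (j - i) := by have := Finset.mem_range.1 hi; omega
    conv_lhs => rw [this, pow_add]
    rw [show i + (j - i) - i = j - i by omega]; ring
  have h2 : ∑ j ∈ Finset.range (n + 1), a j * (j * z ^ (j - 1) * field c z) =
      ∑ i ∈ Finset.range n, ((i : ℝ) + 1) * a (i + 1) * z ^ i * field c z := by
    rw [Finset.sum_range_succ']
    simp only [Nat.cast_zero, zero_mul, mul_zero, add_zero, Nat.add_sub_cancel, Nat.cast_add,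
      Nat.cast_one]
    exact Finset.sum_congr rfl fun i _ => by ring
  have h3 : ∑ j ∈ Finset.range (n + 1), (forwardRHS c a j * z ^ j
        - a j * (j * z ^ (j - 1) * field c z)) =
      ∑ i ∈ Finset.range n, ((i : ℝ) + 1) * a (i + 1) * (z ^ i *
        (∑ l ∈ Finset.range (n + 1 - i), c l * z ^ l - field c z)) +
      ((n : ℝ) + 1) * a (n + 1) * (z ^ n * c 0) := by
    rw [Finset.sum_sub_distrib, h1, h2, Finset.sum_range_succ, add_sub_right_comm,
      ← Finset.sum_sub_distrib]
    congr 1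
    · exact Finset.sum_congr rfl fun i _ => by ring
    · rw [show n + 1 - n = 1 by omega]; simp; ring
  have key : ∀ i ≤ n, ∀ r : ℝ, |r| ≤ ρ ^ n * S →
      |((i : ℝ) + 1) * a (i + 1) * r| ≤ ((n : ℝ) + 1) * (C * (ρ ^ n * S)) := by
    intro i hi r hr
    rw [abs_mul, abs_mul, abs_of_nonneg (by positivity : (0 : ℝ) ≤ (i : ℝ) + 1), mul_assoc]
    gcongr
    exact ha _
  rw [h3]
  refine (abs_add_le _ _).trans ?_
  refine (add_le_add (Finset.abs_sum_le_sum_abs _ _) le_rfl).trans ?_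
  have hA : ∀ i ∈ Finset.range n, |((i : ℝ) + 1) * a (i + 1) * (z ^ i *
        (∑ l ∈ Finset.range (n + 1 - i), c l * z ^ l - field c z))| ≤
      ((n : ℝ) + 1) * (C * (ρ ^ n * S)) := by
    intro i hi
    have hi' := Finset.mem_range.1 hi
    refine key i hi'.le _ ?_
    rw [abs_mul, abs_of_nonneg (by positivity)]
    calc z ^ i * |∑ l ∈ Finset.range (n + 1 - i), c l * z ^ l - field c z|
        ≤ ρ ^ i * (ρ ^ (n + 1 - i) * S) := by
          gcongr
          exact abs_field_sub_sum_le hc hz hzρ hρ _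
      _ = ρ ^ (n + 1) * S := by rw [← mul_assoc, ← pow_add]; congr 2; omega
      _ ≤ ρ ^ n * S := by
          gcongr 1
          exact pow_le_pow_of_le_one hρ0 hρ (by omega)
  have hB : |((n : ℝ) + 1) * a (n + 1) * (z ^ n * c 0)| ≤ ((n : ℝ) + 1) * (C * (ρ ^ n * S)) := by
    refine key n le_rfl _ ?_
    rw [abs_mul, abs_of_nonneg (by positivity)]
    gcongr
    exact hc.abs.le_tsum 0 fun _ _ => abs_nonneg _
  refine (add_le_add (Finset.sum_le_sum hA) hB).trans (le_of_eq ?_)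
  rw [Finset.sum_const, Finset.card_range, nsmul_eq_mul]; ring

/-- Method of characteristics: if `a` is a bounded solution of the forward equation and `y` solves
`y' = field c y` away from `1`, then the generating function of `a` is constant along
`s ↦ (s, y (t - s))`. -/
theorem tsum_transport {c : ℕ → ℝ} (hc : Summable c) {a : ℕ → ℝ → ℝ} {C t ρ : ℝ} (ht : 0 ≤ t)
    (ha : ∀ j, ∀ s ∈ Icc 0 t, |a j s| ≤ C) (hac : ∀ j, ContinuousOn (a j) (Icc 0 t))
    (had : ∀ j, ∀ s ∈ Ico 0 t, HasDerivWithinAt (a j) (forwardRHS c (fun i => a i s) j) (Ici s) s)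
    {y : ℝ → ℝ} (hρ : ρ < 1) (hy : ∀ s ∈ Icc 0 t, y s ∈ Icc 0 ρ)
    (hyd : ∀ s ∈ Icc 0 t, HasDerivWithinAt y (field c (y s)) (Icc 0 t) s) :
    ∑' j, a j t * y 0 ^ j = ∑' j, a j 0 * y t ^ j := by
  have hρ0 : 0 ≤ ρ := (hy 0 ⟨le_rfl, ht⟩).1.trans (hy 0 ⟨le_rfl, ht⟩).2
  have hC : 0 ≤ C := (abs_nonneg _).trans (ha 0 0 ⟨le_rfl, ht⟩)
  have hmaps : MapsTo (fun s => t - s) (Icc 0 t) (Icc 0 t) := fun s hs =>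
    ⟨by linarith [hs.2], by linarith [hs.1]⟩
  set S := ∑' l, |c l|
  let K : ℕ → ℝ → ℝ := fun n s => ∑ j ∈ Finset.range (n + 1), a j s * y (t - s) ^ j
  have hyc : ContinuousOn (fun s => y (t - s)) (Icc 0 t) :=
    ContinuousOn.comp (fun s hs => (hyd s hs).continuousWithinAt) (by fun_prop) hmaps
  have hK : ∀ n, |K n t - K n 0| ≤ C * S * (((n : ℝ) + 1) ^ 2 * ρ ^ n) * t := by
    intro n
    have := norm_image_sub_le_of_norm_deriv_right_le_segment (f := K n) (a := 0) (b := t)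
      (f' := fun s => ∑ j ∈ Finset.range (n + 1), (forwardRHS c (fun i => a i s) j * y (t - s) ^ j
        - a j s * (j * y (t - s) ^ (j - 1) * field c (y (t - s)))))
      (C := C * S * (((n : ℝ) + 1) ^ 2 * ρ ^ n))
      (continuousOn_finsetSum _ fun j _ => (hac j).mul (hyc.pow j)) ?_ ?_ t ⟨ht, le_rfl⟩
    · simpa using this
    · intro s hs
      have hs' := Ico_subset_Icc_self hs
      have hz : HasDerivWithinAt (fun s => y (t - s)) (-field c (y (t - s))) (Ici s) s := by
        have h1 : HasDerivWithinAt (fun s => t - s) (-1) (Icc 0 t) s :=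
          (hasDerivWithinAt_id s _).const_sub t
        have h2 := (hyd (t - s) (hmaps hs')).comp s h1 hmaps
        have h3 := h2.mono_of_mem_nhdsWithin (Icc_mem_nhdsGE_of_mem hs)
        simpa [Function.comp_def] using h3
      convert! HasDerivWithinAt.fun_sum fun j _ => (had j s hs).mul (hz.fun_pow j) using 1
      exact Finset.sum_congr rfl fun j _ => by ring
    · intro s hs
      have hs' := Ico_subset_Icc_self hs
      exact abs_transport_error_le hc (fun j => ha j s hs') (hy _ (hmaps hs')).1
        (hy _ (hmaps hs')).2 hρ.le n
  have hlim0 : Tendsto (fun n : ℕ => C * S * (((n : ℝ) + 1) ^ 2 * ρ ^ n) * t) atTop (𝓝 0) := by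
    have h1 : Tendsto (fun n : ℕ => (n : ℝ) ^ 2 * ρ ^ n) atTop (𝓝 0) :=
      tendsto_pow_const_mul_const_pow_of_lt_one 2 hρ0 hρ
    have h2 : Tendsto (fun n : ℕ => (n : ℝ) ^ 1 * ρ ^ n) atTop (𝓝 0) :=
      tendsto_pow_const_mul_const_pow_of_lt_one 1 hρ0 hρ
    have h3 : Tendsto (fun n : ℕ => ρ ^ n) atTop (𝓝 0) :=
      tendsto_pow_atTop_nhds_zero_of_lt_one hρ0 hρ
    have := (((h1.add (h2.const_mul 2)).add h3).const_mul (C * S)).mul_const t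
    simp only [mul_zero, add_zero, zero_mul] at this
    refine this.congr fun n => ?_
    ring
  have hlimK : ∀ s ∈ Icc 0 t, Tendsto (fun n => K n s) atTop (𝓝 (∑' j, a j s * y (t - s) ^ j)) := by
    intro s hs
    have hz := hy _ (hmaps hs)
    have hsum : Summable fun j => a j s * y (t - s) ^ j := by
      refine Summable.of_norm_bounded ((summable_geometric_of_lt_one hρ0 hρ).mul_left C) fun j => ?_
      rw [norm_mul, norm_pow, Real.norm_of_nonneg hz.1]
      exact mul_le_mul (ha j s hs) (pow_le_pow_left₀ hz.1 hz.2 j) (by have := hz.1; positivity) hC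
    exact (tendsto_add_atTop_iff_nat 1).2 hsum.hasSum.tendsto_sum_nat
  have h1 := (hlimK t ⟨ht, le_rfl⟩).sub (hlimK 0 ⟨le_rfl, ht⟩)
  have h2 := squeeze_zero_norm (fun n => (Real.norm_eq_abs _).trans_le (hK n)) hlim0
  have := tendsto_nhds_unique h1 h2
  simp only [sub_self, sub_zero] at this
  linarith

/-! ### The differential equation below `1` -/

theorem abs_pow_sub_pow_le_div {x y ρ : ℝ} (hx : x ∈ Icc 0 ρ) (hy : y ∈ Icc 0 ρ) (hρ : ρ < 1)
    (j : ℕ) : |x ^ j - y ^ j| ≤ |x - y| / (1 - ρ) := by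
  have h1 : 0 < 1 - ρ := sub_pos.2 hρ
  induction j with
  | zero => simp; positivity
  | succ j ih =>
    have h2 : x ^ (j + 1) - y ^ (j + 1) = x * (x ^ j - y ^ j) + y ^ j * (x - y) := by ring
    have h3 : |x| ≤ ρ := abs_le.2 ⟨by linarith [hx.1, hx.2], hx.2⟩
    have h4 : |y ^ j| ≤ 1 := by
      rw [abs_of_nonneg (pow_nonneg hy.1 j)]
      exact pow_le_one₀ hy.1 (hy.2.trans hρ.le)
    calc |x ^ (j + 1) - y ^ (j + 1)| ≤ |x| * |x ^ j - y ^ j| + |y ^ j| * |x - y| := by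
          rw [h2, ← abs_mul, ← abs_mul]; exact abs_add_le _ _
      _ ≤ ρ * (|x - y| / (1 - ρ)) + 1 * |x - y| := by
          have := (abs_nonneg x).trans h3
          gcongr
      _ = |x - y| / (1 - ρ) := by field_simp; ring

/-- The rates without the linear term. -/
def offOne (c : ℕ → ℝ) (j : ℕ) : ℝ := if j = 1 then 0 else c j

namespace IsSubRates

variable {β : ℝ} {c : ℕ → ℝ}

theorem offOne_nonneg (hc : IsSubRates β c) (j : ℕ) : 0 ≤ offOne c j := by
  unfold offOne; split_ifs with h
  · exact le_rfl
  · exact hc.nonneg j h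

theorem eq_offOne_add (hc : IsSubRates β c) (j : ℕ) :
    c j = offOne c j + (if j = 1 then -β else 0) := by
  unfold offOne; split_ifs with h <;> simp [h, hc.one]

theorem summable_offOne (hc : IsSubRates β c) : Summable (offOne c) := by
  have h : offOne c = fun j => c j - (if j = 1 then -β else 0) := by
    ext j; rw [hc.eq_offOne_add j]; ring
  rw [h]
  exact hc.summable.sub (hasSum_ite_eq 1 (-β)).summable

theorem tsum_offOne_le (hc : IsSubRates β c) : ∑' j, offOne c j ≤ β := by
  have h := hc.tsum_le
  rw [tsum_congr hc.eq_offOne_add, hc.summable_offOne.tsum_add (hasSum_ite_eq 1 (-β)).summable,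
    tsum_ite_eq] at h
  linarith

theorem beta_nonneg (hc : IsSubRates β c) : 0 ≤ β :=
  (tsum_nonneg hc.offOne_nonneg).trans hc.tsum_offOne_le

theorem field_eq (hc : IsSubRates β c) {u : ℝ} (hu : u ∈ Icc (0 : ℝ) 1) :
    field c u = field (offOne c) u - β * u := by
  have h : ∀ j, c j * u ^ j = offOne c j * u ^ j + (if j = 1 then -β * u else 0) := fun j => by
    conv_lhs => rw [hc.eq_offOne_add j]
    split_ifs with h <;> simp [h]; ring
  rw [field, tsum_congr h, (summable_mul_pow hc.summable_offOne hu).tsum_add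
    (hasSum_ite_eq 1 (-β * u)).summable, tsum_ite_eq, field]
  ring

theorem field_offOne_mem (hc : IsSubRates β c) {u : ℝ} (hu : u ∈ Icc (0 : ℝ) 1) :
    field (offOne c) u ∈ Icc 0 β := by
  refine ⟨tsum_nonneg fun j => mul_nonneg (hc.offOne_nonneg j) (pow_nonneg hu.1 j), ?_⟩
  refine le_trans ?_ hc.tsum_offOne_le
  exact (summable_mul_pow hc.summable_offOne hu).tsum_le_tsum (fun j =>
    mul_le_of_le_one_right (hc.offOne_nonneg j) (pow_le_one₀ hu.1 hu.2)) hc.summable_offOne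

theorem field_mem (hc : IsSubRates β c) {u : ℝ} (hu : u ∈ Icc (0 : ℝ) 1) :
    field c u ∈ Icc (-(β * u)) (β * (1 - u)) := by
  have := hc.field_offOne_mem hu
  rw [hc.field_eq hu]
  exact ⟨by linarith [this.1], by linarith [this.2]⟩

theorem abs_field_le (hc : IsSubRates β c) {u : ℝ} (hu : u ∈ Icc (0 : ℝ) 1) :
    |field c u| ≤ β := by
  have h := hc.field_mem hu
  have hβ := hc.beta_nonneg
  exact abs_le.2 ⟨by nlinarith [h.1, hu.2], by nlinarith [h.2, hu.1]⟩

theorem abs_field_offOne_sub_le (hc : IsSubRates β c) {x y ρ : ℝ} (hx : x ∈ Icc 0 ρ)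
    (hy : y ∈ Icc 0 ρ) (hρ : ρ < 1) :
    |field (offOne c) x - field (offOne c) y| ≤ β / (1 - ρ) * |x - y| := by
  have h1 : 0 < 1 - ρ := sub_pos.2 hρ
  have hs := hc.summable_offOne
  rw [field, field, ← (summable_mul_pow hs ⟨hx.1, hx.2.trans hρ.le⟩).tsum_sub
    (summable_mul_pow hs ⟨hy.1, hy.2.trans hρ.le⟩)]
  have h2 : |∑' j, (offOne c j * x ^ j - offOne c j * y ^ j)| ≤
      ∑' j, offOne c j * (|x - y| / (1 - ρ)) := by
    refine tsum_of_norm_bounded (f := fun j => offOne c j * x ^ j - offOne c j * y ^ j)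
      (hs.mul_right _).hasSum fun j => ?_
    rw [← mul_sub, norm_mul, Real.norm_of_nonneg (hc.offOne_nonneg j), Real.norm_eq_abs]
    exact mul_le_mul_of_nonneg_left (abs_pow_sub_pow_le_div hx hy hρ j) (hc.offOne_nonneg j)
  rw [tsum_mul_right] at h2
  refine h2.trans ?_
  rw [div_mul_eq_mul_div, mul_div_assoc]
  exact mul_le_mul_of_nonneg_right hc.tsum_offOne_le (by positivity)

end IsSubRates

theorem continuousOn_field {c : ℕ → ℝ} (hc : Summable c) :
    ContinuousOn (field c) (Icc 0 1) := by
  refine continuousOn_tsum (u := fun j => ‖c j‖) (fun j => by fun_prop) hc.norm fun j u hu => ?_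
  rw [norm_mul, norm_pow, Real.norm_of_nonneg hu.1]
  exact mul_le_of_le_one_right (norm_nonneg _) (pow_le_one₀ hu.1 hu.2)

/-- Grönwall lower bound: `z' ≥ -β z` implies `z s ≥ z 0 * exp (-β s)`. -/
theorem mul_exp_le_of_neg_mul_le_deriv {z z' : ℝ → ℝ} {T β : ℝ}
    (hz : ∀ s ∈ Icc 0 T, HasDerivWithinAt z (z' s) (Icc 0 T) s)
    (hb : ∀ s ∈ Ioo 0 T, -(β * z s) ≤ z' s) :
    ∀ s ∈ Icc 0 T, z 0 * Real.exp (-(β * s)) ≤ z s := by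
  intro s hs
  have hd : ∀ r ∈ Icc 0 T, HasDerivWithinAt (fun r => z r * Real.exp (β * r))
      (z' r * Real.exp (β * r) + z r * (Real.exp (β * r) * β)) (Icc 0 T) r := fun r hr => by
    have h1 : HasDerivAt (fun r => Real.exp (β * r)) (Real.exp (β * r) * β) r := by
      simpa using ((hasDerivAt_id r).const_mul β).exp
    exact (hz r hr).mul h1.hasDerivWithinAt
  have hm : MonotoneOn (fun r => z r * Real.exp (β * r)) (Icc 0 T) := by
    refine monotoneOn_of_hasDerivWithinAt_nonneg (convex_Icc 0 T)
      (fun r hr => (hd r hr).continuousWithinAt)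
      (fun r hr => (hd r (interior_subset hr)).mono interior_subset) fun r hr => ?_
    rw [interior_Icc] at hr
    have := hb r hr
    have h2 := Real.exp_pos (β * r)
    nlinarith
  have h := hm ⟨le_rfl, hs.1.trans hs.2⟩ hs hs.1
  simp only [mul_zero, Real.exp_zero, mul_one] at h
  rw [Real.exp_neg, ← div_eq_mul_inv]
  exact (div_le_iff₀ (Real.exp_pos _)).2 h

/-- A solution that starts below `1` stays below `1`, with an explicit gap. -/
theorem IsSubRates.solution_le {β : ℝ} {c : ℕ → ℝ} (hc : IsSubRates β c) {T : ℝ} {y : ℝ → ℝ}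
    (hy : ∀ s ∈ Icc 0 T, y s ∈ Icc (0 : ℝ) 1)
    (hyd : ∀ s ∈ Icc 0 T, HasDerivWithinAt y (field c (y s)) (Icc 0 T) s) :
    ∀ s ∈ Icc 0 T, y s ≤ 1 - (1 - y 0) * Real.exp (-(β * s)) := by
  intro s hs
  have := mul_exp_le_of_neg_mul_le_deriv (z := fun s => 1 - y s) (z' := fun s => -field c (y s))
    (fun s hs => (hyd s hs).const_sub 1)
    (fun s hs => neg_le_neg (hc.field_mem (hy s (Ioo_subset_Icc_self hs))).2) s hs
  linarith

/-- Existence of a solution on `[0, T]` that starts below `1`. The field is Lipschitz only away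
from `1`, and `ρ = 1 - (1 - u) exp (-β T)` is the a priori bound of `IsSubRates.solution_le`. -/
theorem IsSubRates.exists_solution {β : ℝ} {c : ℕ → ℝ} (hc : IsSubRates β c) {u T : ℝ}
    (hu : 0 ≤ u) (hu1 : u < 1) (hT : 0 ≤ T) :
    ∃ y : ℝ → ℝ, y 0 = u ∧
      (∀ s ∈ Icc 0 T, y s ∈ Icc 0 (1 - (1 - u) * Real.exp (-(β * T)))) ∧
      ∀ s ∈ Icc 0 T, HasDerivWithinAt y (field c (y s)) (Icc 0 T) s := by
  set ρ := 1 - (1 - u) * Real.exp (-(β * T)) with hρdef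
  have hβ := hc.beta_nonneg
  have hexp : ∀ s, 0 ≤ s → Real.exp (-(β * s)) ≤ 1 := fun s hs =>
    Real.exp_le_one_iff.2 (neg_nonpos.2 (mul_nonneg hβ hs))
  have hρ1 : ρ < 1 := by
    have := mul_pos (sub_pos.2 hu1) (Real.exp_pos (-(β * T))); linarith
  have hρ0 : 0 ≤ ρ := by nlinarith [hexp T hT]
  -- Picard-Lindelöf is applied to `w s = exp (β s) * y s`, which removes the linear term `-β y`,
  -- with `y` truncated to `[0, ρ]`; the bounds on the solution remove the truncation afterwards.
  let cl : ℝ → ℝ := fun z => max (min z ρ) 0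
  have hcl : ∀ z, cl z ∈ Icc 0 ρ := fun z => ⟨le_max_right _ _, max_le (min_le_right _ _) hρ0⟩
  have hcl1 : ∀ z, cl z ∈ Icc (0 : ℝ) 1 := fun z => ⟨(hcl z).1, (hcl z).2.trans hρ1.le⟩
  have hclL : ∀ x y, |cl x - cl y| ≤ |x - y| := fun x y =>
    (abs_max_sub_max_le_abs _ _ _).trans (abs_min_sub_min_le_max x ρ y ρ |>.trans (by simp))
  let K : NNReal := ⟨β / (1 - ρ), div_nonneg hβ (sub_nonneg.2 hρ1.le)⟩
  let L : NNReal := ⟨β * Real.exp (β * T), by positivity⟩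
  let V : ℝ → ℝ → ℝ := fun s w =>
    Real.exp (β * s) * field (offOne c) (cl (Real.exp (-(β * s)) * w))
  have hclc : Continuous cl := by fun_prop
  have hfc : Continuous fun z => field (offOne c) (cl z) :=
    (continuousOn_field hc.summable_offOne).comp_continuous hclc hcl1
  have hPL : IsPicardLindelof V (tmin := 0) (tmax := T) ⟨0, le_rfl, hT⟩ u
      (L * ⟨T, hT⟩) 0 L K := by
    refine ⟨fun s _ => LipschitzWith.lipschitzOnWith ?_, fun x _ => ?_, fun s hs x _ => ?_, ?_⟩
    · refine LipschitzWith.of_dist_le_mul fun x y => ?_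
      rw [Real.dist_eq, Real.dist_eq, ← mul_sub, abs_mul, abs_of_pos (Real.exp_pos _)]
      calc Real.exp (β * s) * |_| ≤ Real.exp (β * s) * (β / (1 - ρ) *
            |cl (Real.exp (-(β * s)) * x) - cl (Real.exp (-(β * s)) * y)|) := by
            gcongr
            exact hc.abs_field_offOne_sub_le (hcl _) (hcl _) hρ1
        _ ≤ Real.exp (β * s) * (β / (1 - ρ) *
            |Real.exp (-(β * s)) * x - Real.exp (-(β * s)) * y|) := by
            have h := K.2
            exact mul_le_mul_of_nonneg_left (mul_le_mul_of_nonneg_left (hclL _ _) h)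
              (Real.exp_pos _).le
        _ = (K : ℝ) * |x - y| := by
            rw [← mul_sub, abs_mul, abs_of_pos (Real.exp_pos _), mul_left_comm, ← mul_assoc
              (Real.exp _), ← Real.exp_add]
            rw [add_neg_cancel, Real.exp_zero, one_mul]; rfl
    · exact (Continuous.mul (by fun_prop) (hfc.comp (by fun_prop))).continuousOn
    · have h := hc.field_offOne_mem (hcl1 (Real.exp (-(β * s)) * x))
      have h' := hs.2
      rw [norm_mul, Real.norm_of_nonneg (Real.exp_pos _).le, Real.norm_of_nonneg h.1, mul_comm]
      change _ ≤ β * Real.exp (β * T)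
      gcongr
      exact h.2
    · simp [hT]
      exact le_rfl
  obtain ⟨α, hα0, hα⟩ := hPL.exists_eq_forall_mem_Icc_hasDerivWithinAt₀
  have hα0 : α 0 = u := hα0
  let y : ℝ → ℝ := fun s => Real.exp (-(β * s)) * α s
  have hy0 : y 0 = u := by simp [y, hα0]
  have hyd : ∀ s ∈ Icc 0 T,
      HasDerivWithinAt y (field (offOne c) (cl (y s)) - β * y s) (Icc 0 T) s := by
    intro s hs
    have h1 : HasDerivAt (fun s => Real.exp (-(β * s))) (Real.exp (-(β * s)) * -β) s := by
      simpa using ((hasDerivAt_id s).const_mul β).neg.exp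
    convert! h1.hasDerivWithinAt.mul (hα s hs) using 1
    simp only [V, y]
    rw [← mul_assoc (Real.exp _) (Real.exp _), ← Real.exp_add]
    simp; ring
  have hlow : ∀ s ∈ Icc 0 T, 0 ≤ y s := fun s hs =>
    (mul_nonneg (hu.trans_eq hy0.symm) (Real.exp_pos _).le).trans <|
      mul_exp_le_of_neg_mul_le_deriv (β := β) hyd
        (fun s _ => by linarith [(hc.field_offOne_mem (hcl1 (y s))).1]) s hs
  have hupp : ∀ s ∈ Icc 0 T, y s ≤ ρ := fun s hs => by
    have := mul_exp_le_of_neg_mul_le_deriv (z := fun s => 1 - y s) (β := β)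
      (fun s hs => (hyd s hs).const_sub 1)
      (fun s _ => by linarith [(hc.field_offOne_mem (hcl1 (y s))).2]) s hs
    have h2 : Real.exp (-(β * T)) ≤ Real.exp (-(β * s)) :=
      Real.exp_le_exp.2 (neg_le_neg (mul_le_mul_of_nonneg_left hs.2 hβ))
    rw [hy0] at this
    nlinarith
  refine ⟨y, hy0, fun s hs => ⟨hlow s hs, hupp s hs⟩, fun s hs => ?_⟩
  have hcy : cl (y s) = y s := by
    simp only [cl]; rw [min_eq_left (hupp s hs), max_eq_left (hlow s hs)]
  have := hyd s hs
  rwa [hcy, ← hc.field_eq ⟨hlow s hs, (hupp s hs).trans hρ1.le⟩] at this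

/-! ### The fundamental theorem of calculus on `[0, ∞)` -/

theorem hasDerivWithinAt_integral_Ici {f : ℝ → ℝ} (hf : ContinuousOn f (Ici 0)) {t : ℝ}
    (ht : 0 ≤ t) : HasDerivWithinAt (fun s => ∫ r in (0 : ℝ)..s, f r) (f t) (Ici 0) t := by
  have hint : IntervalIntegrable f volume 0 t :=
    (hf.mono (by rw [uIcc_of_le ht]; exact Icc_subset_Ici_self)).intervalIntegrable
  have hmeas : StronglyMeasurableAtFilter f (𝓝[Ici 0] t) volume :=
    ⟨Ici 0, self_mem_nhdsWithin, hf.aestronglyMeasurable measurableSet_Ici⟩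
  rcases ht.eq_or_lt with rfl | hpos
  · exact intervalIntegral.integral_hasDerivWithinAt_right hint
      (hmeas.filter_mono (nhdsWithin_mono _ Ioi_subset_Ici_self))
      (hf 0 ht |>.mono Ioi_subset_Ici_self)
  · rw [nhdsWithin_eq_nhds.2 (Ici_mem_nhds hpos)] at hmeas
    exact (intervalIntegral.integral_hasDerivAt_right hint hmeas
      ((hf t ht).continuousAt (Ici_mem_nhds hpos))).hasDerivWithinAt

theorem integral_eq_sub_of_hasDerivWithinAt_Ici {F f : ℝ → ℝ} (hf : ContinuousOn f (Ici 0))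
    (hF : ∀ t, 0 ≤ t → HasDerivWithinAt F (f t) (Ici 0) t) {t : ℝ} (ht : 0 ≤ t) :
    ∫ s in (0 : ℝ)..t, f s = F t - F 0 := by
  refine intervalIntegral.integral_eq_sub_of_hasDerivAt_of_le ht
    (fun s hs => ((hF s hs.1).mono Icc_subset_Ici_self).continuousWithinAt)
    (fun s hs => (hF s hs.1.le).hasDerivAt (Ici_mem_nhds hs.1))
    (hf.mono (by rw [uIcc_of_le ht]; exact Icc_subset_Ici_self)).intervalIntegrable

end BranchingCrossing

namespace BranchingCrossing

/-! ### Crossing numbers of a regular path -/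

/-- The times in `(a, b]` at which the path `x` jumps from its left limit `i` to `i - 1 + k`. -/
def crossingSet (x : ℝ → ℕ) (k : ℕ) (a b : ℝ) : Set ℝ :=
  {s : ℝ | a < s ∧ s ≤ b ∧ ∃ i : ℕ, (∀ᶠ r in 𝓝[<] s, x r = i) ∧ x s + 1 = i + k}

theorem crossingNumber_eq (x : ℝ → ℕ) (k : ℕ) (t : ℝ) :
    crossingNumber x k t = (crossingSet x k 0 t).ncard := rfl

theorem crossingSet_union (x : ℝ → ℕ) (k : ℕ) {a b c : ℝ} (hab : a ≤ b) (hbc : b ≤ c) :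
    crossingSet x k a c = crossingSet x k a b ∪ crossingSet x k b c := by
  ext s
  simp only [crossingSet, mem_ofPred_eq, mem_union]
  constructor
  · rintro ⟨h1, h2, h3⟩
    rcases le_or_gt s b with h | h
    · exact Or.inl ⟨h1, h, h3⟩
    · exact Or.inr ⟨h, h2, h3⟩
  · rintro (⟨h1, h2, h3⟩ | ⟨h1, h2, h3⟩)
    · exact ⟨h1, h2.trans hbc, h3⟩
    · exact ⟨hab.trans_lt h1, h2, h3⟩

theorem crossingSet_disjoint (x : ℝ → ℕ) (k : ℕ) (a b c : ℝ) :
    Disjoint (crossingSet x k a b) (crossingSet x k b c) :=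
  Set.disjoint_left.2 fun _ h1 h2 => h1.2.1.not_gt h2.1

/-- A regular path has at most one jump in a short interval. -/
theorem IsRegularPath.exists_mesh {x : ℝ → ℕ} (hx : IsRegularPath x) (T : ℝ) :
    ∃ δ > 0, ∀ a b, 0 ≤ a → a < b → b ≤ T → b - a < δ →
      ∃ c ∈ Ioc a b, (∀ r ∈ Ico a c, x r = x a) ∧ ∀ r ∈ Icc c b, x r = x b := by
  have hloc : ∀ s : Icc 0 T, ∃ ε > 0, (∀ r ∈ Ioo (s : ℝ) (s + ε), x r = x s) ∧
      ∃ i, ∀ r ∈ Ioo ((s : ℝ) - ε) s, 0 ≤ r → x r = i := by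
    rintro ⟨s, hs⟩
    obtain ⟨u, hu, h1⟩ := mem_nhdsGT_iff_exists_Ioo_subset.1 (hx.1 s hs.1)
    rcases hs.1.eq_or_lt with rfl | hpos
    · exact ⟨u, hu, fun r hr => h1 (by simpa using hr), 0, fun r hr h0 => absurd hr.2 h0.not_gt⟩
    · obtain ⟨i, hi⟩ := hx.2 s hpos
      obtain ⟨l, hl, h2⟩ := mem_nhdsLT_iff_exists_Ioo_subset.1 hi
      have hl' : l < s := hl
      have hu' : s < u := hu
      refine ⟨min (u - s) (s - l), lt_min (by linarith) (by linarith), fun r hr => h1 ⟨hr.1, ?_⟩,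
        i, fun r hr _ => h2 ⟨?_, hr.2⟩⟩
      · have := hr.2; have := min_le_left (u - s) (s - l); simp only at *; linarith
      · have := hr.1; have := min_le_right (u - s) (s - l); simp only at *; linarith
  choose ε hε hright i hleft using hloc
  obtain ⟨δ, hδ, h⟩ := lebesgue_number_lemma_of_metric (s := Icc 0 T)
    (c := fun s : Icc 0 T => Metric.ball (s : ℝ) (ε s)) isCompact_Icc
    (fun _ => Metric.isOpen_ball)
    (fun s hs => mem_iUnion.2 ⟨⟨s, hs⟩, Metric.mem_ball_self (hε _)⟩)
  refine ⟨δ, hδ, fun a b ha hab hb hd => ?_⟩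
  obtain ⟨s, hs⟩ := h a ⟨ha, hab.le.trans hb⟩
  have hA : a ∈ Metric.ball (s : ℝ) (ε s) := hs (Metric.mem_ball_self hδ)
  have hB : b ∈ Metric.ball (s : ℝ) (ε s) := hs (by
    rw [Metric.mem_ball, Real.dist_eq, abs_of_pos (sub_pos.2 hab)]; exact hd)
  rw [Real.ball_eq_Ioo] at hA hB
  have hR : ∀ r, (s : ℝ) ≤ r → r ≤ b → x r = x s := fun r h1 h2 => by
    rcases h1.eq_or_lt with h1 | h1
    · rw [h1]
    · exact hright s r ⟨h1, h2.trans_lt hB.2⟩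
  have hL : ∀ r, a ≤ r → r < s → x r = i s := fun r h1 h2 =>
    hleft s r ⟨hA.1.trans_le h1, h2⟩ (ha.trans h1)
  rcases le_or_gt (s : ℝ) a with hsa | hsa
  · exact ⟨b, ⟨hab, le_rfl⟩, fun r hr => by
      rw [hR r (hsa.trans hr.1) hr.2.le, hR a hsa hab.le], fun r hr => by
      rw [le_antisymm hr.2 hr.1]⟩
  rcases le_or_gt (s : ℝ) b with hsb | hsb
  · exact ⟨s, ⟨hsa, hsb⟩, fun r hr => by rw [hL r hr.1 hr.2, hL a le_rfl hsa], fun r hr => by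
      rw [hR r hr.1 hr.2, hR b hsb le_rfl]⟩
  · exact ⟨b, ⟨hab, le_rfl⟩, fun r hr => by
      rw [hL r hr.1 (hr.2.trans hsb), hL a le_rfl hsa], fun r hr => by
      rw [le_antisymm hr.2 hr.1]⟩

theorem crossingSet_of_one_jump {x : ℝ → ℕ} {a b c : ℝ} (hc : c ∈ Ioc a b)
    (h1 : ∀ r ∈ Ico a c, x r = x a) (h2 : ∀ r ∈ Icc c b, x r = x b) {k : ℕ} (hk : k ≠ 1) :
    crossingSet x k a b = if x b + 1 = x a + k then {c} else ∅ := by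
  have hlim : ∀ s, a < s → s ≤ b → ∀ i, (∀ᶠ r in 𝓝[<] s, x r = i) →
      i = if s ≤ c then x a else x b := by
    intro s has hsb i hi
    split_ifs with hsc
    · have : ∀ᶠ r in 𝓝[<] s, x r = x a := by
        filter_upwards [Ioo_mem_nhdsLT has] with r hr
        exact h1 r ⟨hr.1.le, hr.2.trans_le hsc⟩
      obtain ⟨r, hr1, hr2⟩ := (hi.and this).exists
      rw [← hr1, hr2]
    · push Not at hsc
      have : ∀ᶠ r in 𝓝[<] s, x r = x b := by
        filter_upwards [Ioo_mem_nhdsLT hsc] with r hr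
        exact h2 r ⟨hr.1.le, hr.2.le.trans hsb⟩
      obtain ⟨r, hr1, hr2⟩ := (hi.and this).exists
      rw [← hr1, hr2]
  have hmem : ∀ s ∈ crossingSet x k a b, s = c ∧ x b + 1 = x a + k := by
    rintro s ⟨has, hsb, i, hi, hik⟩
    have hi' := hlim s has hsb i hi
    rcases lt_trichotomy s c with h | h | h
    · rw [if_pos h.le] at hi'
      rw [h1 s ⟨has.le, h⟩] at hik
      omega
    · subst h
      rw [if_pos le_rfl] at hi'
      rw [h2 s ⟨le_rfl, hsb⟩] at hik
      exact ⟨rfl, by omega⟩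
    · rw [if_neg h.not_ge] at hi'
      rw [h2 s ⟨h.le, hsb⟩] at hik
      omega
  split_ifs with h
  · refine Subset.antisymm (fun s hs => (hmem s hs).1) ?_
    rintro s rfl
    refine ⟨hc.1, hc.2, x a, ?_, by rw [h2 s ⟨le_rfl, hc.2⟩, h]⟩
    filter_upwards [Ioo_mem_nhdsLT hc.1] with r hr
    exact h1 r ⟨hr.1.le, hr.2⟩
  · exact eq_empty_of_forall_notMem fun s hs => h (hmem s hs).2

theorem crossingSet_self (x : ℝ → ℕ) (k : ℕ) (a : ℝ) : crossingSet x k a a = ∅ :=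
  eq_empty_of_forall_notMem fun _ hs => hs.1.not_ge hs.2.1

theorem IsRegularPath.finite_crossingSet {x : ℝ → ℕ} (hx : IsRegularPath x) {k : ℕ} (hk : k ≠ 1)
    (T : ℝ) : (crossingSet x k 0 T).Finite := by
  obtain ⟨δ, hδ, h⟩ := hx.exists_mesh T
  have key : ∀ n : ℕ, ∀ a, 0 ≤ a → a ≤ T → a ≤ n * (δ / 2) → (crossingSet x k 0 a).Finite := by
    intro n
    induction n with
    | zero =>
      intro a h0 _ h1
      have : a = 0 := le_antisymm (by simpa using h1) h0
      rw [this, crossingSet_self]; exact finite_empty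
    | succ n ih =>
      intro a h0 hT h1
      rcases le_or_gt a (n * (δ / 2)) with h2 | h2
      · exact ih a h0 hT h2
      · have h3 : (0 : ℝ) ≤ n * (δ / 2) := by positivity
        rw [crossingSet_union x k h3 h2.le]
        push_cast at h1
        obtain ⟨c, hc, hc1, hc2⟩ := h _ a h3 h2 hT (by linarith)
        refine (ih _ h3 (h2.le.trans hT) le_rfl).union ?_
        rw [crossingSet_of_one_jump hc hc1 hc2 hk]
        split_ifs
        · exact finite_singleton _
        · exact finite_empty
  rcases le_or_gt 0 T with hT | hT
  · obtain ⟨n, hn⟩ := exists_nat_ge (T / (δ / 2))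
    exact key n T hT le_rfl ((div_le_iff₀ (by positivity)).1 hn)
  · rw [eq_empty_of_forall_notMem fun s (hs : s ∈ crossingSet x k 0 T) =>
      (hs.1.trans_le hs.2.1).not_gt hT]
    exact finite_empty

theorem crossingNumber_zero (x : ℝ → ℕ) (k : ℕ) : crossingNumber x k 0 = 0 := by
  rw [crossingNumber_eq, crossingSet_self, ncard_empty]

theorem IsRegularPath.crossingNumber_mono {x : ℝ → ℕ} (hx : IsRegularPath x) {k : ℕ} (hk : k ≠ 1)
    {s t : ℝ} (hst : s ≤ t) : crossingNumber x k s ≤ crossingNumber x k t :=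
  ncard_le_ncard (fun _ hr => ⟨hr.1, hr.2.1.trans hst, hr.2.2⟩) (hx.finite_crossingSet hk t)

theorem IsRegularPath.exists_crossingNumber_step {x : ℝ → ℕ} (hx : IsRegularPath x) (T : ℝ) :
    ∃ δ > 0, ∀ a b, 0 ≤ a → a ≤ b → b ≤ T → b - a < δ → ∀ k, k ≠ 1 →
      crossingNumber x k b = crossingNumber x k a + if x b + 1 = x a + k then 1 else 0 := by
  obtain ⟨δ, hδ, h⟩ := hx.exists_mesh T
  refine ⟨δ, hδ, fun a b ha hab hb hd k hk => ?_⟩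
  rcases hab.eq_or_lt with rfl | hab'
  · rw [if_neg (by omega), add_zero]
  obtain ⟨c, hc, hc1, hc2⟩ := h a b ha hab' hb hd
  have hS := crossingSet_of_one_jump hc hc1 hc2 hk
  have hfin : (crossingSet x k a b).Finite := by
    rw [hS]; split_ifs
    · exact finite_singleton _
    · exact finite_empty
  rw [crossingNumber_eq, crossingNumber_eq, crossingSet_union x k ha hab,
    ncard_union_eq (crossingSet_disjoint x k 0 a b) (hx.finite_crossingSet hk a) hfin, hS]
  split_ifs <;> simp

theorem IsRegularPath.exists_le {x : ℝ → ℕ} (hx : IsRegularPath x) (T : ℝ) :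
    ∃ M, ∀ r ∈ Icc 0 T, x r ≤ M := by
  have : ∃ M, ∀ r ∈ Icc 0 T, 0 ≤ r → x r ≤ M := by
    refine isCompact_Icc.induction_on (p := fun S => ∃ M, ∀ r ∈ S, 0 ≤ r → x r ≤ M)
      ⟨0, by simp⟩ (fun s t hst ⟨M, hM⟩ => ⟨M, fun r hr => hM r (hst hr)⟩) ?_ ?_
    · rintro s t ⟨M, hM⟩ ⟨M', hM'⟩
      refine ⟨max M M', fun r hr h0 => ?_⟩
      rcases hr with hr | hr
      · exact (hM r hr h0).trans (le_max_left _ _)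
      · exact (hM' r hr h0).trans (le_max_right _ _)
    · intro s hs
      have h1 : ∃ i, ∀ᶠ r in 𝓝[<] s, 0 ≤ r → x r = i := by
        rcases hs.1.eq_or_lt with rfl | hpos
        · exact ⟨0, by filter_upwards [self_mem_nhdsWithin] with r hr h0 using absurd h0 hr.not_ge⟩
        · obtain ⟨i, hi⟩ := hx.2 s hpos
          exact ⟨i, hi.mono fun r h _ => h⟩
      obtain ⟨i, hi⟩ := h1
      refine ⟨{r | 0 ≤ r → x r ≤ max i (x s)}, ?_, max i (x s), fun r hr => hr⟩
      refine nhdsWithin_le_nhds ?_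
      rw [← nhdsLT_sup_nhdsGE, ← Ioi_insert, nhdsWithin_insert]
      refine mem_sup.2 ⟨?_, mem_sup.2 ⟨fun _ => le_max_right _ _, ?_⟩⟩
      · filter_upwards [hi] with r hr h0
        rw [hr h0]; exact le_max_left _ _
      · filter_upwards [hx.1 s hs.1] with r hr _
        rw [hr]; exact le_max_right _ _
  obtain ⟨M, hM⟩ := this
  exact ⟨M, fun r hr => hM r hr hr.1⟩

/-! ### Weights of jumps and paths -/

variable {N : Finset ℕ}

/-- The weight of a jump from `i` to `j`: it is `v k` if the jump has size `k - 1` with `k ∈ N`,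
and `1` otherwise. -/
noncomputable def jumpWeight (v : N → ℝ) (i j : ℕ) : ℝ :=
  ∏ k : N, if j + 1 = i + k then v k else 1

/-- The monomial `v ^ Y(t)` of a path, i.e. the product of the weights of its jumps in
`(0, t]`. -/
noncomputable def pathWeight (v : N → ℝ) (x : ℝ → ℕ) (t : ℝ) : ℝ :=
  ∏ k : N, v k ^ crossingNumber x k t

/-- The rates `b j v j` for `j ∈ N` and `b j` for `j ∉ N`. -/
noncomputable def weightedRate (b : ℕ → ℝ) (v : N → ℝ) (j : ℕ) : ℝ :=
  if h : j ∈ N then b j * v ⟨j, h⟩ else b j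

theorem jumpWeight_mul (b : ℕ → ℝ) (v : N → ℝ) {i j : ℕ} (hij : i ≤ j + 1) :
    jumpWeight v i j * b (j + 1 - i) = weightedRate b v (j + 1 - i) := by
  have h : ∀ k : N, (j + 1 = i + (k : ℕ)) ↔ ((k : ℕ) = j + 1 - i) := fun k => by omega
  unfold jumpWeight weightedRate
  simp only [h]
  split_ifs with hN
  · rw [Finset.prod_eq_single ⟨j + 1 - i, hN⟩]
    · rw [if_pos rfl, mul_comm]
    · intro k _ hk
      rw [if_neg fun h => hk (Subtype.ext h)]
    · simp
  · rw [Finset.prod_eq_one, one_mul]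
    intro k _
    rw [if_neg]
    rintro h
    exact hN (h ▸ k.2)

theorem jumpWeight_mem {v : N → ℝ} (hv : ∀ i, v i ∈ Icc (0 : ℝ) 1) (i j : ℕ) :
    jumpWeight v i j ∈ Icc (0 : ℝ) 1 :=
  ⟨Finset.prod_nonneg fun k _ => by split_ifs; exacts [(hv k).1, zero_le_one],
    Finset.prod_le_one (fun k _ => by split_ifs; exacts [(hv k).1, zero_le_one])
      fun k _ => by split_ifs; exacts [(hv k).2, le_rfl]⟩

theorem jumpWeight_self (hN1 : 1 ∉ N) (v : N → ℝ) (i : ℕ) : jumpWeight v i i = 1 :=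
  Finset.prod_eq_one fun k _ => if_neg fun h => hN1 (by
    have : (k : ℕ) = 1 := by omega
    exact this ▸ k.2)

theorem pathWeight_mem {v : N → ℝ} (hv : ∀ i, v i ∈ Icc (0 : ℝ) 1) (x : ℝ → ℕ) (t : ℝ) :
    pathWeight v x t ∈ Icc (0 : ℝ) 1 :=
  ⟨Finset.prod_nonneg fun k _ => pow_nonneg (hv k).1 _,
    Finset.prod_le_one (fun k _ => pow_nonneg (hv k).1 _) fun k _ => pow_le_one₀ (hv k).1 (hv k).2⟩

theorem pathWeight_zero (v : N → ℝ) (x : ℝ → ℕ) : pathWeight v x 0 = 1 := by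
  simp [pathWeight, crossingNumber_zero]

/-- On a fine enough partition of `[t, t + h]` the crossings are read off from the increments of
the path. -/
theorem IsRegularPath.eventually_crossingNumber {x : ℝ → ℕ} (hx : IsRegularPath x) {t h : ℝ}
    (ht : 0 ≤ t) (hh : 0 ≤ h) : ∀ᶠ n : ℕ in atTop, ∀ k, k ≠ 1 →
      crossingNumber x k (t + h) = crossingNumber x k t + ∑ m ∈ Finset.range n,
        if x (t + (m + 1 : ℕ) * (h / n)) + 1 = x (t + m * (h / n)) + k then 1 else 0 := by
  obtain ⟨δ, hδ, H⟩ := hx.exists_crossingNumber_step (t + h)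
  have h1 : ∀ᶠ n : ℕ in atTop, h / n < δ :=
    (tendsto_const_div_atTop_nhds_zero_nat h).eventually_lt_const hδ
  filter_upwards [h1, eventually_gt_atTop 0] with n hn hn0 k hk
  have hn0' : (0 : ℝ) < n := Nat.cast_pos.2 hn0
  have hstep : 0 ≤ h / n := by positivity
  have key : ∀ m ≤ n, crossingNumber x k (t + m * (h / n)) = crossingNumber x k t +
      ∑ l ∈ Finset.range m,
        if x (t + (l + 1 : ℕ) * (h / n)) + 1 = x (t + l * (h / n)) + k then 1 else 0 := by
    intro m
    induction m with
    | zero => simp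
    | succ m ih =>
      intro hm
      have hm' : ((m + 1 : ℕ) : ℝ) ≤ n := Nat.cast_le.2 hm
      rw [Finset.sum_range_succ, ← add_assoc, ← ih (by omega)]
      refine H _ _ (by positivity) ?_ ?_ ?_ k hk
      · push_cast; nlinarith
      · have : ((m + 1 : ℕ) : ℝ) * (h / n) ≤ n * (h / n) := by gcongr
        rw [mul_div_cancel₀ _ hn0'.ne'] at this
        linarith
      · push_cast; linarith
  have := key n le_rfl
  rwa [mul_div_cancel₀ _ hn0'.ne'] at this

theorem IsRegularPath.eventually_pathWeight {x : ℝ → ℕ} (hx : IsRegularPath x) {t h : ℝ}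
    (ht : 0 ≤ t) (hh : 0 ≤ h) (hN1 : 1 ∉ N) (v : N → ℝ) : ∀ᶠ n : ℕ in atTop,
      pathWeight v x (t + h) = pathWeight v x t * ∏ m ∈ Finset.range n,
        jumpWeight v (x (t + m * (h / n))) (x (t + (m + 1 : ℕ) * (h / n))) := by
  filter_upwards [hx.eventually_crossingNumber ht hh] with n hn
  simp only [pathWeight, jumpWeight]
  rw [Finset.prod_comm, ← Finset.prod_mul_distrib]
  refine Finset.prod_congr rfl fun k _ => ?_
  rw [hn k (fun h => hN1 (h ▸ k.2)), pow_add, ← Finset.prod_pow_eq_pow_sum]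
  congr 1
  refine Finset.prod_congr rfl fun m _ => ?_
  split_ifs <;> simp

end BranchingCrossing

namespace BranchingCrossing

/-! ### Rates and transition functions -/

variable {b : ℕ → ℝ} {p : ℝ → ℕ → ℕ → ℝ}

theorem IsBranchingRates.hasSum_zero (hb : IsBranchingRates b) : HasSum b 0 := by
  have h := hb.hasSum.add (hasSum_ite_eq 1 (b 1))
  rw [neg_add_cancel] at h
  have h2 : b = fun j => (if j = 1 then 0 else b j) + (if j = 1 then b 1 else 0) := by
    ext j; split_ifs with hj <;> simp [hj]
  rwa [h2]

theorem IsBranchingRates.isSubRates_weighted (hb : IsBranchingRates b) {N : Finset ℕ}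
    (hN1 : 1 ∉ N) {v : N → ℝ} (hv : ∀ i, v i ∈ Icc (0 : ℝ) 1) :
    IsSubRates (-b 1) (weightedRate b v) := by
  have hne : ∀ j ∈ N, j ≠ 1 := fun j hj h => hN1 (h ▸ hj)
  have hle : ∀ j, weightedRate b v j ≤ b j := fun j => by
    unfold weightedRate; split_ifs with h
    · exact mul_le_of_le_one_right (hb.nonneg j (hne j h)) (hv _).2
    · exact le_rfl
  have hsum : Summable (weightedRate b v) := by
    refine Summable.of_norm_bounded hb.hasSum_zero.summable.norm fun j => ?_
    unfold weightedRate; split_ifs with h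
    · rw [norm_mul, Real.norm_of_nonneg (hv _).1]
      exact mul_le_of_le_one_right (norm_nonneg _) (hv _).2
    · exact le_rfl
  refine ⟨fun j hj => ?_, ?_, hsum, ?_⟩
  · unfold weightedRate; split_ifs with h
    · exact mul_nonneg (hb.nonneg j hj) (hv _).1
    · exact hb.nonneg j hj
  · simp [weightedRate, hN1]
  · rw [← hb.hasSum_zero.tsum_eq]
    exact hsum.tsum_le_tsum hle hb.hasSum_zero.summable

theorem IsBranchingRates.isSubRates (hb : IsBranchingRates b) : IsSubRates (-b 1) b :=
  ⟨hb.nonneg, (neg_neg _).symm, hb.hasSum_zero.summable, hb.hasSum_zero.tsum_eq.le⟩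

theorem tsum_mul_branchingQ (b a : ℕ → ℝ) (j : ℕ) :
    ∑' k, a k * branchingQ b k j = forwardRHS b a j := by
  rw [tsum_eq_sum (s := Finset.range (j + 2)), Finset.sum_range_succ']
  · simp only [branchingQ, forwardRHS]
    rw [if_neg (by omega), mul_zero, add_zero]
    refine Finset.sum_congr rfl fun i hi => ?_
    have := Finset.mem_range.1 hi
    rw [if_pos (by omega), show j + 1 - (i + 1) = j - i by omega]
    push_cast; ring
  · intro k hk
    rw [branchingQ, if_neg, mul_zero]
    rw [Finset.mem_range] at hk; omega

theorem forwardRHS_pi_single (b : ℕ → ℝ) (i j : ℕ) :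
    forwardRHS b (fun k => if i = k then 1 else 0) j = branchingQ b i j := by
  rw [← tsum_mul_branchingQ, tsum_eq_single i]
  · simp
  · intro k hk; simp [hk.symm]

/-- The only negative term of the forward equation is the one of the diagonal. -/
theorem IsBranchingRates.neg_mul_le_forwardRHS (hb : IsBranchingRates b) {a : ℕ → ℝ}
    (ha : ∀ j, 0 ≤ a j) (j : ℕ) : -(j * -b 1 * a j) ≤ forwardRHS b a j := by
  rcases j with _ | j
  · simp only [forwardRHS]
    have := hb.nonneg 0 (by norm_num)
    have := ha 1
    simp; positivity
  · rw [forwardRHS, ← Finset.add_sum_erase _ _ (Finset.mem_range.2 (by omega : j < j + 1 + 1))]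
    rw [show j + 1 - j = 1 by omega]
    have : 0 ≤ ∑ i ∈ (Finset.range (j + 1 + 1)).erase j, ((i : ℝ) + 1) * a (i + 1)
        * b (j + 1 - i) := by
      refine Finset.sum_nonneg fun i hi => ?_
      rw [Finset.mem_erase, Finset.mem_range] at hi
      have := hb.nonneg (j + 1 - i) (by omega)
      have := ha (i + 1)
      positivity
    push_cast
    linarith

theorem IsBranchingRates.hasSum_branchingQ (hb : IsBranchingRates b) {i : ℕ} (hi : 1 ≤ i) :
    HasSum (fun j => branchingQ b i j) 0 := by
  have h1 : HasSum (fun l => (i : ℝ) * b l) ((i : ℝ) * 0) := hb.hasSum_zero.mul_left _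
  rw [mul_zero] at h1
  have hinj : Function.Injective fun l => l + (i - 1) := add_left_injective _
  refine (hinj.hasSum_iff ?_).1 ?_
  · intro j hj
    rw [branchingQ, if_neg]
    rintro ⟨h, h'⟩
    exact hj ⟨j - (i - 1), by simp only; omega⟩
  · convert! h1 using 2 with l
    simp only [Function.comp, branchingQ]
    rw [if_pos (by omega), show l + (i - 1) + 1 - i = l by omega]

namespace IsTransitionFunction

theorem le_one (hp : IsTransitionFunction p) {t : ℝ} (ht : 0 ≤ t) (i j : ℕ) : p t i j ≤ 1 :=
  (le_hasSum (hp.hasSum_one t ht i) j fun k _ => hp.nonneg t ht i k)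

theorem hasDerivWithinAt (hf : SatisfiesForwardEquation b p) (i : ℕ) {j : ℕ} (hj : 1 ≤ j) {t : ℝ}
    (ht : 0 ≤ t) : HasDerivWithinAt (fun r => p r i j) (forwardRHS b (p t i) j) (Ici 0) t := by
  rw [← tsum_mul_branchingQ]; exact hf i j hj t ht

theorem hasDerivWithinAt_zero (hp : IsTransitionFunction p) (hf : SatisfiesForwardEquation b p)
    (i : ℕ) {j : ℕ} (hj : 1 ≤ j) :
    HasDerivWithinAt (fun r => p r i j) (branchingQ b i j) (Ici 0) 0 := by
  convert! hasDerivWithinAt hf i hj le_rfl using 1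
  rw [← forwardRHS_pi_single]
  congr 1; ext k; rw [hp.zero]

theorem continuousOn (hf : SatisfiesForwardEquation b p) (i : ℕ) {j : ℕ} (hj : 1 ≤ j) :
    ContinuousOn (fun r => p r i j) (Ici 0) :=
  fun _ ht => (hasDerivWithinAt hf i hj ht).continuousWithinAt

/-- A lower bound for `p t j j`: the probability of staying in `j` for an exponential holding time
of rate `j * -b 1`. -/
theorem exp_le_diag_of_one_le (hb : IsBranchingRates b) (hp : IsTransitionFunction p)
    (hf : SatisfiesForwardEquation b p) {j : ℕ} (hj : 1 ≤ j) {t : ℝ} (ht : 0 ≤ t) :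
    Real.exp (-(j * -b 1 * t)) ≤ p t j j := by
  have := mul_exp_le_of_neg_mul_le_deriv (z := fun r => p r j j) (T := t)
    (z' := fun s => forwardRHS b (p s j) j) (β := j * -b 1)
    (fun s hs => (hasDerivWithinAt hf j hj hs.1).mono Icc_subset_Ici_self)
    (fun s hs => hb.neg_mul_le_forwardRHS (hp.nonneg s hs.1.le j) j) t ⟨ht, le_rfl⟩
  simpa [hp.zero] using this

/-- The `i`-th row of `p`, with the entry `p s i 0` replaced by the probability flux from `1` to
`0` accumulated until time `s`. The forward equation at `j = 0` is not assumed; for this modified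
row it holds by construction, and for `i = 1` the two rows agree by `flux_le` and
`IsChain.le_flux`. -/
noncomputable def rowWithFlux (b : ℕ → ℝ) (p : ℝ → ℕ → ℕ → ℝ) (i j : ℕ) (s : ℝ) : ℝ :=
  if j = 0 then b 0 * ∫ r in (0 : ℝ)..s, p r i 1 else p s i j

theorem integral_nonneg (hp : IsTransitionFunction p) (i j : ℕ) {t : ℝ} (ht : 0 ≤ t) :
    0 ≤ ∫ r in (0 : ℝ)..t, p r i j :=
  intervalIntegral.integral_nonneg ht fun s hs => hp.nonneg s hs.1 i j

theorem rowWithFlux_nonneg (hb : IsBranchingRates b) (hp : IsTransitionFunction p) (i j : ℕ)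
    {t : ℝ} (ht : 0 ≤ t) : 0 ≤ rowWithFlux b p i j t := by
  unfold rowWithFlux; split_ifs
  · exact mul_nonneg (hb.nonneg 0 (by norm_num)) (hp.integral_nonneg i 1 ht)
  · exact hp.nonneg t ht i j

theorem hasDerivWithinAt_flux (hf : SatisfiesForwardEquation b p) (i : ℕ) {t : ℝ} (ht : 0 ≤ t) :
    HasDerivWithinAt (fun s => b 0 * ∫ r in (0 : ℝ)..s, p r i 1) (forwardRHS b (p t i) 0)
      (Ici 0) t := by
  have hval : forwardRHS b (p t i) 0 = b 0 * p t i 1 := by simp [forwardRHS, mul_comm]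
  rw [hval]
  exact (hasDerivWithinAt_integral_Ici (continuousOn hf i le_rfl) ht).const_mul _

/-- The generating function of the modified row has the form `z ^ i` of a branching process, for
`i ≥ 1`, where `z` is the solution of the differential equation with initial value `u`, and it
vanishes for `i = 0`. -/
theorem tsum_rowWithFlux (hb : IsBranchingRates b) (hp : IsTransitionFunction p)
    (hf : SatisfiesForwardEquation b p) (i : ℕ) {t u : ℝ} (ht : 0 ≤ t) (hu : 0 ≤ u) (hu1 : u < 1) :
    ∃ z ∈ Icc (0 : ℝ) 1,
      ∑' j, rowWithFlux b p i j t * u ^ j = if i = 0 then 0 else z ^ i := by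
  obtain ⟨y, hy0, hy, hyd⟩ := hb.isSubRates.exists_solution hu hu1 ht
  have hρ : 1 - (1 - u) * Real.exp (-(-b 1 * t)) < 1 := by
    have := mul_pos (sub_pos.2 hu1) (Real.exp_pos (-(-b 1 * t))); linarith
  have hyt := hy t ⟨ht, le_rfl⟩
  refine ⟨y t, ⟨hyt.1, hyt.2.trans hρ.le⟩, ?_⟩
  have hb0 : 0 ≤ b 0 := hb.nonneg 0 (by norm_num)
  have hd : ∀ j, ∀ s ∈ Icc 0 t, HasDerivWithinAt (rowWithFlux b p i j)
      (forwardRHS b (fun k => rowWithFlux b p i k s) j) (Ici 0) s := by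
    intro j s hs
    have h1 : forwardRHS b (fun k => rowWithFlux b p i k s) j = forwardRHS b (p s i) j := by
      simp [forwardRHS, rowWithFlux]
    rw [h1]
    rcases j with _ | j
    · exact hasDerivWithinAt_flux hf i hs.1
    · exact hasDerivWithinAt hf i (by omega) hs.1
  have key := tsum_transport hb.isSubRates.summable (a := rowWithFlux b p i) (C := 1 + b 0 * t) ht
    (fun j s hs => ?_) (fun j s hs => ((hd j s hs).mono Icc_subset_Ici_self).continuousWithinAt)
    (fun j s hs => (hd j s (Ico_subset_Icc_self hs)).mono (Ici_subset_Ici.2 hs.1)) hρ hy hyd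
  · rw [hy0] at key
    rw [key]
    split_ifs with hi
    · refine (tsum_congr fun j => ?_).trans tsum_zero
      unfold rowWithFlux
      split_ifs with hj
      · simp
      · rw [hp.zero, if_neg (by omega), zero_mul]
    · rw [tsum_eq_single i]
      · simp [rowWithFlux, hi, hp.zero]
      · intro j hj
        unfold rowWithFlux
        split_ifs with hj
        · simp
        · rw [hp.zero, if_neg (by omega), zero_mul]
  · rw [abs_of_nonneg (rowWithFlux_nonneg hb hp i j hs.1)]
    unfold rowWithFlux; split_ifs
    · have h1 : ∫ r in (0 : ℝ)..s, p r i 1 ≤ s := by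
        have := intervalIntegral.integral_mono_on (μ := volume) (a := 0) (b := s)
          (f := fun r => p r i 1) (g := fun _ => (1 : ℝ)) hs.1
          (((continuousOn hf i le_rfl).mono
            (by rw [uIcc_of_le hs.1]; exact Icc_subset_Ici_self)).intervalIntegrable)
          intervalIntegrable_const (fun r hr => hp.le_one hr.1 i 1)
        simpa using this
      have := hs.2
      nlinarith
    · have := hp.le_one hs.1 i j
      have : 0 ≤ b 0 * t := mul_nonneg hb0 ht
      linarith

theorem summable_rowWithFlux (hp : IsTransitionFunction p) (i : ℕ) {t : ℝ} (ht : 0 ≤ t) :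
    Summable fun j => rowWithFlux b p i j t := by
  refine (summable_nat_add_iff 1).1 ?_
  have := (summable_nat_add_iff 1).2 (hp.hasSum_one t ht i).summable
  simpa [rowWithFlux] using this

/-- The state `0` is absorbing: the modified row vanishes for `i = 0`. -/
theorem zero_row (hb : IsBranchingRates b) (hp : IsTransitionFunction p)
    (hf : SatisfiesForwardEquation b p) {t : ℝ} (ht : 0 ≤ t) (j : ℕ) :
    p t 0 j = if 0 = j then 1 else 0 := by
  obtain ⟨z, -, hz⟩ := tsum_rowWithFlux hb hp hf 0 ht (u := 1 / 2) (by norm_num) (by norm_num)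
  rw [if_pos rfl] at hz
  have hs := summable_mul_pow (hp.summable_rowWithFlux (b := b) 0 ht) (u := 1 / 2) (by norm_num)
  have hnn : ∀ j, 0 ≤ rowWithFlux b p 0 j t * (1 / 2) ^ j := fun j =>
    mul_nonneg (rowWithFlux_nonneg hb hp 0 j ht) (by positivity)
  have h0 : ∀ j, 1 ≤ j → p t 0 j = 0 := fun j hj => by
    have := congr_fun ((hasSum_zero_iff_of_nonneg hnn).1 (hz ▸ hs.hasSum)) j
    simpa [rowWithFlux, show j ≠ 0 by omega] using this
  rcases j with _ | j
  · have h1 := hp.hasSum_one t ht 0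
    have h2 := hasSum_single (f := fun j => p t 0 j) 0 fun j hj => h0 j (by omega)
    simpa using h2.unique h1
  · simpa using h0 (j + 1) (by omega)

/-- The accumulated flux into `0` is at most `p t 1 0`: the modified row has total mass at most
`1`, whereas the row itself has mass exactly `1`. -/
theorem flux_le (hb : IsBranchingRates b) (hp : IsTransitionFunction p)
    (hf : SatisfiesForwardEquation b p) {t : ℝ} (ht : 0 ≤ t) :
    b 0 * ∫ r in (0 : ℝ)..t, p r 1 1 ≤ p t 1 0 := by
  have hsum := hp.summable_rowWithFlux (b := b) 1 ht
  have hle : ∀ n, ∑ j ∈ Finset.range n, rowWithFlux b p 1 j t ≤ 1 := by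
    intro n
    have h1 : ∀ u ∈ Ico (0 : ℝ) 1, ∑ j ∈ Finset.range n, rowWithFlux b p 1 j t * u ^ j ≤ 1 := by
      intro u hu
      obtain ⟨z, hz, hz'⟩ := tsum_rowWithFlux hb hp hf 1 ht hu.1 hu.2
      rw [if_neg one_ne_zero, pow_one] at hz'
      refine le_trans ?_ (hz'.trans_le hz.2)
      exact (summable_mul_pow hsum ⟨hu.1, hu.2.le⟩).sum_le_tsum _ fun j _ =>
        mul_nonneg (rowWithFlux_nonneg hb hp 1 j ht) (pow_nonneg hu.1 j)
    have hc : Continuous fun u : ℝ => ∑ j ∈ Finset.range n, rowWithFlux b p 1 j t * u ^ j := by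
      fun_prop
    have h2 : Tendsto (fun u : ℝ => ∑ j ∈ Finset.range n, rowWithFlux b p 1 j t * u ^ j)
        (𝓝[<] 1) (𝓝 (∑ j ∈ Finset.range n, rowWithFlux b p 1 j t * 1 ^ j)) :=
      (hc.tendsto 1).mono_left nhdsWithin_le_nhds
    simp only [one_pow, mul_one] at h2
    refine le_of_tendsto h2 ?_
    filter_upwards [Ioo_mem_nhdsLT (zero_lt_one (α := ℝ))] with u hu
    exact h1 u ⟨hu.1.le, hu.2⟩
  have h1 : ∑' j, rowWithFlux b p 1 j t ≤ 1 := Real.tsum_le_of_sum_range_le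
    (fun j => rowWithFlux_nonneg hb hp 1 j ht) hle
  have h2 := (hp.hasSum_one t ht 1).tsum_eq
  rw [(hp.hasSum_one t ht 1).summable.tsum_eq_zero_add] at h2
  rw [hsum.tsum_eq_zero_add] at h1
  simp only [rowWithFlux, if_true, Nat.add_eq_zero_iff, one_ne_zero, and_false, if_false] at h1
  linarith

/-- Honesty of `p` bounds the right derivative of `p h i 0` at `h = 0` by `q i 0`, as the other
derivatives are known and the row of `q` sums to `0`. -/
theorem eventually_le_of_honest (hb : IsBranchingRates b) (hp : IsTransitionFunction p)
    (hf : SatisfiesForwardEquation b p) {i : ℕ} (hi : 1 ≤ i) {ε : ℝ} (hε : 0 < ε) :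
    ∀ᶠ h in 𝓝[>] 0, p h i 0 ≤ (branchingQ b i 0 + ε) * h := by
  have h1 := ((hb.hasSum_branchingQ hi).tendsto_sum_nat.comp
    (tendsto_add_atTop_nat 1)).eventually_const_lt (neg_lt_zero.2 hε)
  obtain ⟨J, hJ, hiJ⟩ := (h1.and (eventually_ge_atTop i)).exists
  simp only [Function.comp, Finset.sum_range_succ'] at hJ
  have hd : HasDerivWithinAt (fun r => 1 - ∑ j ∈ Finset.range J, p r i (j + 1))
      (-∑ j ∈ Finset.range J, branchingQ b i (j + 1)) (Ici 0) 0 :=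
    (HasDerivWithinAt.fun_sum fun j _ => hp.hasDerivWithinAt_zero hf i (by omega)).const_sub 1
  have h2 := hd.limsup_slope_le (r := branchingQ b i 0 + ε) (by linarith)
  rw [Ici_sdiff_left] at h2
  filter_upwards [h2, self_mem_nhdsWithin] with h hh hpos
  have hpos : 0 < h := hpos
  have h0 : ∑ j ∈ Finset.range J, p 0 i (j + 1) = 1 := by
    rw [Finset.sum_eq_single (i - 1)]
    · rw [hp.zero, if_pos (by omega)]
    · intro j _ hj; rw [hp.zero, if_neg (by omega)]
    · intro h; rw [Finset.mem_range] at h; omega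
  rw [slope_def_field, h0, sub_self, sub_zero, sub_zero, div_lt_iff₀ hpos] at hh
  refine le_trans ?_ hh.le
  have h3 := (hp.hasSum_one h hpos.le i).summable.sum_le_tsum (Finset.range (J + 1))
    fun j _ => hp.nonneg h hpos.le i j
  rw [(hp.hasSum_one h hpos.le i).tsum_eq, Finset.sum_range_succ'] at h3
  linarith

end IsTransitionFunction

end BranchingCrossing

namespace BranchingCrossing

/-! ### The Markov property -/

variable {Ω : Type*} [MeasurableSpace Ω] {P : Measure Ω}

/-- A Markov chain started at `i₀`, given by its transition function and its finite-dimensional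
distributions. -/
structure IsChain (P : Measure Ω) (i₀ : ℕ) (X : ℝ → Ω → ℕ) (p : ℝ → ℕ → ℕ → ℝ) : Prop where
  transition : IsTransitionFunction p
  measurable : ∀ t, 0 ≤ t → Measurable (X t)
  fdd : ∀ (n : ℕ) (t : ℕ → ℝ) (j : ℕ → ℕ), t 0 = 0 → Monotone t →
      P.real {ω | ∀ m ≤ n, X (t m) ω = j m} =
        (if j 0 = i₀ then 1 else 0) *
          ∏ m ∈ Finset.range n, p (t (m + 1) - t m) (j m) (j (m + 1))

/-- The weighted row `E[v ^ Y(t); X(t) = j]`. -/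
noncomputable def weightedRow {N : Finset ℕ} (P : Measure Ω) (X : ℝ → Ω → ℕ) (v : N → ℝ)
    (j : ℕ) (t : ℝ) : ℝ :=
  ∫ ω in {ω | X t ω = j}, pathWeight v (fun s => X s ω) t ∂P

namespace IsChain

variable {i₀ : ℕ} {X : ℝ → Ω → ℕ} {p : ℝ → ℕ → ℕ → ℝ}

theorem measurableSet_eq (hX : IsChain P i₀ X p) {t : ℝ} (ht : 0 ≤ t) (j : ℕ) :
    MeasurableSet {ω | X t ω = j} :=
  hX.measurable t ht (measurableSet_singleton j)

theorem measurableSet_path (hX : IsChain P i₀ X p) (n : ℕ) {r : ℕ → ℝ} (hr : ∀ m, 0 ≤ r m)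
    (j : ℕ → ℕ) : MeasurableSet {ω | ∀ m ≤ n, X (r m) ω = j m} := by
  simp only [ofPred_forall]
  exact MeasurableSet.iInter fun m => MeasurableSet.iInter fun _ => hX.measurableSet_eq (hr m) _

theorem ae_start [IsProbabilityMeasure P] (hX : IsChain P i₀ X p) : ∀ᵐ ω ∂P, X 0 ω = i₀ := by
  have h := hX.fdd 0 (fun _ => 0) (fun _ => i₀) rfl monotone_const
  simp only [Nat.le_zero, forall_eq, if_true, Finset.range_zero, Finset.prod_empty, mul_one] at h
  rw [Measure.real, ENNReal.toReal_eq_one_iff] at h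
  exact (prob_compl_eq_zero_iff (hX.measurableSet_eq le_rfl _)).2 h

/-- The law of a trajectory observed from the time `r 0` on. -/
theorem real_path [IsProbabilityMeasure P] (hX : IsChain P i₀ X p) (n : ℕ) {r : ℕ → ℝ}
    (hr0 : 0 ≤ r 0) (hr : Monotone r) (j : ℕ → ℕ) :
    P.real {ω | ∀ m ≤ n, X (r m) ω = j m} =
      p (r 0) i₀ (j 0) * ∏ m ∈ Finset.range n, p (r (m + 1) - r m) (j m) (j (m + 1)) := by
  have h := hX.fdd (n + 1) (fun m => m.casesOn 0 r) (fun m => m.casesOn i₀ j) rfl ?_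
  · rw [Finset.prod_range_succ'] at h
    replace h : _ = (if i₀ = i₀ then (1 : ℝ) else 0) *
      ((∏ m ∈ Finset.range n, p (r (m + 1) - r m) (j m) (j (m + 1))) * p (r 0 - 0) i₀ (j 0)) := h
    rw [if_pos rfl, one_mul, sub_zero] at h
    rw [mul_comm, ← h]
    refine measureReal_congr ?_
    filter_upwards [hX.ae_start] with ω hω
    refine propext ⟨fun H m hm => ?_, fun H m hm => H (m + 1) (by omega)⟩
    rcases m with _ | m
    · exact hω
    · exact H m (by omega)
  · refine monotone_nat_of_le_succ fun m => ?_
    rcases m with _ | m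
    · exact hr0
    · exact hr (Nat.le_succ m)

theorem real_eq [IsProbabilityMeasure P] (hX : IsChain P i₀ X p) {t : ℝ} (ht : 0 ≤ t) (j : ℕ) :
    P.real {ω | X t ω = j} = p t i₀ j := by
  have := hX.real_path 0 (r := fun _ => t) ht monotone_const fun _ => j
  simpa using this

theorem real_eq_eq [IsProbabilityMeasure P] (hX : IsChain P i₀ X p) {t h : ℝ} (ht : 0 ≤ t)
    (hh : 0 ≤ h) (i j : ℕ) :
    P.real {ω | X t ω = i ∧ X (t + h) ω = j} = p t i₀ i * p h i j := by
  have := hX.real_path 1 (r := fun m => if m = 0 then t else t + h) ht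
    (monotone_nat_of_le_succ fun m => by rcases m with _ | m <;> simp [hh])
    fun m => if m = 0 then i else j
  simp only [if_true, Finset.range_one, Finset.prod_singleton, zero_add, one_ne_zero, if_false,
    add_sub_cancel_left] at this
  rw [← this]
  congr 1
  ext ω
  simp only [mem_ofPred_eq]
  constructor
  · rintro ⟨h1, h2⟩ m hm
    interval_cases m <;> simpa
  · intro H
    exact ⟨by simpa using H 0 (by omega), by simpa using H 1 le_rfl⟩

/-- Markov property: given the past up to `s n` and `X (s n) = i`, the next state is `j` with
probability `p (s (n + 1) - s n) i j`. -/
theorem map_restrict_eq_smul [IsProbabilityMeasure P] (hX : IsChain P i₀ X p) (n : ℕ)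
    {s : ℕ → ℝ} (hs0 : s 0 = 0) (hs : Monotone s) (i j : ℕ) :
    (P.restrict {ω | X (s n) ω = i ∧ X (s (n + 1)) ω = j}).map
        (fun ω (m : Fin (n + 1)) => X (s m) ω) =
      ENNReal.ofReal (p (s (n + 1) - s n) i j) •
        (P.restrict {ω | X (s n) ω = i}).map (fun ω (m : Fin (n + 1)) => X (s m) ω) := by
  have hsn : ∀ m, 0 ≤ s m := fun m => hs0 ▸ hs (Nat.zero_le m)
  have hξ : Measurable fun ω (m : Fin (n + 1)) => X (s m) ω :=
    measurable_pi_lambda _ fun m => hX.measurable _ (hsn m)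
  refine Measure.ext_of_singleton fun x => ?_
  rw [Measure.smul_apply, Measure.map_apply hξ (measurableSet_singleton x),
    Measure.map_apply hξ (measurableSet_singleton x),
    Measure.restrict_apply (hξ (measurableSet_singleton x)),
    Measure.restrict_apply (hξ (measurableSet_singleton x)), smul_eq_mul]
  have hx : ∀ ω, ((fun m : Fin (n + 1) => X (s m) ω) = x) ↔
      ∀ m, (hm : m ≤ n) → X (s m) ω = x ⟨m, by omega⟩ := fun ω =>
    ⟨fun h m hm => congr_fun h ⟨m, by omega⟩, fun h => funext fun m => h m (by omega)⟩
  by_cases hxi : x (Fin.last n) = i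
  · let y : ℕ → ℕ := fun m => if h : m ≤ n then x ⟨m, by omega⟩ else j
    have hy : y n = i := by simp only [y, le_refl, dif_pos]; exact hxi
    have hy' : y (n + 1) = j := by simp [y]
    have h1 := hX.fdd n s y hs0 hs
    have h2 := hX.fdd (n + 1) s y hs0 hs
    rw [Finset.prod_range_succ, ← mul_assoc, ← h1, hy, hy'] at h2
    have e1 : {ω | ∀ m ≤ n, X (s m) ω = y m} =
        (fun ω (m : Fin (n + 1)) => X (s m) ω) ⁻¹' {x} ∩ {ω | X (s n) ω = i} := by
      ext ω
      simp only [mem_ofPred_eq, mem_inter_iff, mem_preimage, mem_singleton_iff, hx]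
      constructor
      · intro H
        exact ⟨fun m hm => by rw [H m hm]; simp [y, hm], by rw [H n le_rfl, hy]⟩
      · rintro ⟨H, -⟩ m hm
        rw [H m hm]; simp [y, hm]
    have e2 : {ω | ∀ m ≤ n + 1, X (s m) ω = y m} =
        (fun ω (m : Fin (n + 1)) => X (s m) ω) ⁻¹' {x} ∩
          {ω | X (s n) ω = i ∧ X (s (n + 1)) ω = j} := by
      ext ω
      have := Set.ext_iff.1 e1 ω
      simp only [mem_ofPred_eq, mem_inter_iff] at this ⊢
      rw [← and_assoc, ← this]
      constructor
      · intro H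
        exact ⟨fun m hm => H m (by omega), by rw [H (n + 1) le_rfl, hy']⟩
      · rintro ⟨H, H'⟩ m hm
        rcases hm.lt_or_eq with hm | rfl
        · exact H m (by omega)
        · rw [H', hy']
    rw [← e1, ← e2, ← ofReal_measureReal, ← ofReal_measureReal, h2, mul_comm,
      ENNReal.ofReal_mul (hX.transition.nonneg _ (sub_nonneg.2 (hs (Nat.le_succ n))) _ _)]
  · have h0 : (fun ω (m : Fin (n + 1)) => X (s m) ω) ⁻¹' {x} ∩ {ω | X (s n) ω = i} = ∅ := by
      refine eq_empty_of_forall_notMem fun ω hω => hxi ?_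
      have h1 : (fun m : Fin (n + 1) => X (s m) ω) = x := hω.1
      rw [← h1]
      exact hω.2
    have h0' : (fun ω (m : Fin (n + 1)) => X (s m) ω) ⁻¹' {x} ∩
        {ω | X (s n) ω = i ∧ X (s (n + 1)) ω = j} = ∅ :=
      subset_empty_iff.1 (h0 ▸ inter_subset_inter_right _ fun ω hω => hω.1)
    rw [h0, h0']
    simp

/-- The Markov property for functions of the past. -/
theorem setIntegral_markov [IsProbabilityMeasure P] (hX : IsChain P i₀ X p) (n : ℕ)
    {s : ℕ → ℝ} (hs0 : s 0 = 0) (hs : Monotone s) (i j : ℕ) (F : (Fin (n + 1) → ℕ) → ℝ) :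
    ∫ ω in {ω | X (s n) ω = i ∧ X (s (n + 1)) ω = j}, F (fun m => X (s m) ω) ∂P =
      p (s (n + 1) - s n) i j * ∫ ω in {ω | X (s n) ω = i}, F (fun m => X (s m) ω) ∂P := by
  have hsn : ∀ m, 0 ≤ s m := fun m => hs0 ▸ hs (Nat.zero_le m)
  have hξ : Measurable fun ω (m : Fin (n + 1)) => X (s m) ω :=
    measurable_pi_lambda _ fun m => hX.measurable _ (hsn m)
  have hF : ∀ μ : Measure (Fin (n + 1) → ℕ), AEStronglyMeasurable F μ := fun μ =>
    (measurable_of_countable F).aestronglyMeasurable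
  have h := congr_arg (fun μ => ∫ x, F x ∂μ) (hX.map_restrict_eq_smul n hs0 hs i j)
  simp only [integral_smul_measure] at h
  rw [integral_map hξ.aemeasurable (hF _), integral_map hξ.aemeasurable (hF _),
    ENNReal.toReal_ofReal (hX.transition.nonneg _ (sub_nonneg.2 (hs (Nat.le_succ n))) _ _)] at h
  exact h

variable {N : Finset ℕ} {v : N → ℝ}

theorem measurable_discreteWeight (hX : IsChain P i₀ X p) (v : N → ℝ) {t h : ℝ} (ht : 0 ≤ t)
    (hh : 0 ≤ h) (n : ℕ) : Measurable fun ω => ∏ m ∈ Finset.range n,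
      jumpWeight v (X (t + m * (h / n)) ω) (X (t + (m + 1 : ℕ) * (h / n)) ω) := by
  refine Finset.measurable_fun_prod _ fun m _ => ?_
  have h1 : Measurable fun q : ℕ × ℕ => jumpWeight v q.1 q.2 := measurable_of_countable _
  exact h1.comp ((hX.measurable _ (by positivity)).prodMk (hX.measurable _ (by positivity)))

theorem tendsto_discreteWeight (hreg : ∀ᵐ ω ∂P, IsRegularPath fun t => X t ω) (hN1 : 1 ∉ N)
    (v : N → ℝ) {t : ℝ} (ht : 0 ≤ t) : ∀ᵐ ω ∂P, Tendsto (fun n : ℕ => ∏ m ∈ Finset.range n,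
      jumpWeight v (X (0 + m * (t / n)) ω) (X (0 + (m + 1 : ℕ) * (t / n)) ω)) atTop
      (𝓝 (pathWeight v (fun s => X s ω) t)) := by
  filter_upwards [hreg] with ω hω
  refine tendsto_const_nhds.congr' ?_
  filter_upwards [hω.eventually_pathWeight le_rfl ht hN1 v] with n hn
  rw [zero_add, pathWeight_zero, one_mul] at hn
  exact hn

theorem aemeasurable_pathWeight (hX : IsChain P i₀ X p)
    (hreg : ∀ᵐ ω ∂P, IsRegularPath fun t => X t ω) (hN1 : 1 ∉ N) (v : N → ℝ) {t : ℝ} (ht : 0 ≤ t) :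
    AEMeasurable (fun ω => pathWeight v (fun s => X s ω) t) P :=
  aemeasurable_of_tendsto_metrizable_ae atTop
    (fun n => (hX.measurable_discreteWeight v le_rfl ht n).aemeasurable)
    (tendsto_discreteWeight hreg hN1 v ht)

theorem aemeasurable_crossingVector (hX : IsChain P i₀ X p)
    (hreg : ∀ᵐ ω ∂P, IsRegularPath fun t => X t ω) (hN1 : 1 ∉ N) {t : ℝ} (ht : 0 ≤ t) :
    AEMeasurable (crossingVector N X t) P := by
  refine aemeasurable_pi_lambda _ fun k => ?_
  refine aemeasurable_of_tendsto_metrizable_ae atTop (f := fun (n : ℕ) ω =>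
    ∑ m ∈ Finset.range n,
      if X (0 + (m + 1 : ℕ) * (t / n)) ω + 1 = X (0 + m * (t / n)) ω + k then 1 else 0)
    (fun n => Measurable.aemeasurable ?_) ?_
  · refine Finset.measurable_fun_sum _ fun m _ => ?_
    have h1 : Measurable fun q : ℕ × ℕ => if q.1 + 1 = q.2 + (k : ℕ) then 1 else 0 :=
      measurable_of_countable _
    exact h1.comp ((hX.measurable (0 + (m + 1 : ℕ) * (t / n)) (by positivity)).prodMk
      (hX.measurable (0 + m * (t / n)) (by positivity)))
  · filter_upwards [hreg] with ω hω
    refine tendsto_const_nhds.congr' ?_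
    filter_upwards [hω.eventually_crossingNumber le_rfl ht] with n hn
    have := hn k fun h => hN1 (h ▸ k.2)
    rw [zero_add, crossingNumber_zero, zero_add] at this
    exact this

theorem integrable_pathWeight [IsProbabilityMeasure P] (hX : IsChain P i₀ X p)
    (hreg : ∀ᵐ ω ∂P, IsRegularPath fun t => X t ω) (hN1 : 1 ∉ N)
    (hv : ∀ i, v i ∈ Icc (0 : ℝ) 1) {t : ℝ} (ht : 0 ≤ t) :
    Integrable (fun ω => pathWeight v (fun s => X s ω) t) P :=
  Integrable.of_bound (aemeasurable_pathWeight hX hreg hN1 v ht).aestronglyMeasurable 1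
    (Eventually.of_forall fun ω => by
      rw [Real.norm_of_nonneg (pathWeight_mem hv _ _).1]; exact (pathWeight_mem hv _ _).2)

theorem setIntegral_pathWeight_mem [IsProbabilityMeasure P]
    (hv : ∀ i, v i ∈ Icc (0 : ℝ) 1) (t : ℝ) (A : Set Ω) :
    ∫ ω in A, pathWeight v (fun s => X s ω) t ∂P ∈ Icc 0 (P.real A) := by
  refine ⟨integral_nonneg fun ω => (pathWeight_mem hv _ _).1, ?_⟩
  have := norm_setIntegral_le_of_norm_le_const (μ := P) (s := A) (C := 1)
    (f := fun ω => pathWeight v (fun s => X s ω) t) (measure_lt_top P A) fun ω _ => by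
      rw [Real.norm_of_nonneg (pathWeight_mem hv _ _).1]; exact (pathWeight_mem hv _ _).2
  rw [one_mul] at this
  exact (le_abs_self _).trans this

/-- The Markov property for the weight of the path, obtained as a limit along partitions of
`[0, t]`. -/
theorem setIntegral_pathWeight_markov [IsProbabilityMeasure P] (hX : IsChain P i₀ X p)
    (hreg : ∀ᵐ ω ∂P, IsRegularPath fun t => X t ω) (hN1 : 1 ∉ N)
    (hv : ∀ i, v i ∈ Icc (0 : ℝ) 1) {t h : ℝ} (ht : 0 ≤ t) (hh : 0 ≤ h) (i j : ℕ) :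
    ∫ ω in {ω | X t ω = i ∧ X (t + h) ω = j}, pathWeight v (fun s => X s ω) t ∂P =
      p h i j * weightedRow P X v i t := by
  let W : ℕ → Ω → ℝ := fun n ω => ∏ m ∈ Finset.range n,
      jumpWeight v (X (0 + m * (t / n)) ω) (X (0 + (m + 1 : ℕ) * (t / n)) ω)
  have hW : ∀ n ω, ‖W n ω‖ ≤ 1 := fun n ω => by
    rw [Real.norm_of_nonneg (Finset.prod_nonneg fun m _ => (jumpWeight_mem hv _ _).1)]
    exact Finset.prod_le_one (fun m _ => (jumpWeight_mem hv _ _).1)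
      fun m _ => (jumpWeight_mem hv _ _).2
  have hlim : ∀ A : Set Ω, Tendsto (fun n => ∫ ω in A, W n ω ∂P) atTop
      (𝓝 (∫ ω in A, pathWeight v (fun s => X s ω) t ∂P)) := fun A =>
    tendsto_integral_of_dominated_convergence (fun _ => 1)
      (fun n => (hX.measurable_discreteWeight v le_rfl ht n).aestronglyMeasurable)
      (integrable_const _) (fun n => Eventually.of_forall fun ω => hW n ω)
      (ae_restrict_of_ae (tendsto_discreteWeight hreg hN1 v ht))
  refine tendsto_nhds_unique (hlim _) (((hlim {ω | X t ω = i}).const_mul (p h i j)).congr' ?_)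
  filter_upwards [eventually_gt_atTop 0] with n hn
  have hn' : (0 : ℝ) < n := Nat.cast_pos.2 hn
  let s : ℕ → ℝ := fun m => if m ≤ n then 0 + m * (t / n) else t + h
  have hsn : s n = t := by
    simp only [s, le_refl, if_true, zero_add]
    exact mul_div_cancel₀ _ hn'.ne'
  have hsn1 : s (n + 1) = t + h := by simp [s]
  have hs : Monotone s := by
    refine monotone_nat_of_le_succ fun m => ?_
    rcases lt_trichotomy m n with h1 | h1 | h1
    · simp only [s, h1.le, if_true, Nat.succ_le_iff.2 h1]
      gcongr; exact Nat.le_succ m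
    · rw [h1, hsn, hsn1]; linarith
    · simp only [s, h1.not_ge, if_false, (Nat.lt_succ_of_lt h1).not_ge]; exact le_rfl
  have key := hX.setIntegral_markov n (s := s) (by simp [s]) hs i j (fun x =>
    ∏ m : Fin n, jumpWeight v (x m.castSucc) (x m.succ))
  rw [hsn, hsn1, add_sub_cancel_left] at key
  have hWs : ∀ ω, ∏ m : Fin n, jumpWeight v (X (s (m.castSucc : Fin (n + 1))) ω)
      (X (s (m.succ : Fin (n + 1))) ω) = W n ω := by
    intro ω
    simp only [W]
    rw [← Fin.prod_univ_eq_prod_range (fun m => jumpWeight v (X (0 + m * (t / n)) ω)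
      (X (0 + (m + 1 : ℕ) * (t / n)) ω)) n]
    refine Finset.prod_congr rfl fun m _ => ?_
    have h1 : (m : ℕ) ≤ n := m.2.le
    have h2 : (m : ℕ) + 1 ≤ n := m.2
    simp only [s, Fin.val_castSucc, Fin.val_succ, h1, h2, if_true]
  simp only [hWs] at key
  exact key.symm

/-- On the event `X t = i`, `X (t + h) = j` the weight collected in `(t, t + h]` is
`jumpWeight v i j` up to the probability that the path, observed on fine partitions, does anything
else than pass directly from `i` to `j`. The events `O n` are those of a direct passage, and `l`
bounds their probabilities from below in the limit. -/
theorem abs_setIntegral_sub_le [IsProbabilityMeasure P] (hX : IsChain P i₀ X p)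
    (hreg : ∀ᵐ ω ∂P, IsRegularPath fun t => X t ω) (hN1 : 1 ∉ N)
    (hv : ∀ i, v i ∈ Icc (0 : ℝ) 1) {t h : ℝ} (ht : 0 ≤ t) (hh : 0 ≤ h) (i j : ℕ)
    {O : ℕ → Set Ω} (hOm : ∀ n, MeasurableSet (O n))
    (hOA : ∀ᶠ n in atTop, O n ⊆ {ω | X t ω = i ∧ X (t + h) ω = j})
    (hOW : ∀ n, ∀ ω ∈ O n, ∏ m ∈ Finset.range n, jumpWeight v (X (t + m * (h / n)) ω)
      (X (t + (m + 1 : ℕ) * (h / n)) ω) = jumpWeight v i j)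
    {L : ℕ → ℝ} {l : ℝ} (hL : ∀ᶠ n in atTop, L n ≤ P.real (O n)) (hl : Tendsto L atTop (𝓝 l)) :
    |∫ ω in {ω | X t ω = i ∧ X (t + h) ω = j}, pathWeight v (fun s => X s ω) (t + h) ∂P -
        jumpWeight v i j * (p h i j * weightedRow P X v i t)| ≤ p t i₀ i * p h i j - l := by
  have hth : 0 ≤ t + h := add_nonneg ht hh
  set A := {ω | X t ω = i ∧ X (t + h) ω = j} with hA
  have hAm : MeasurableSet A := (hX.measurableSet_eq ht i).inter (hX.measurableSet_eq hth j)
  let D : Ω → ℝ := fun ω => pathWeight v (fun s => X s ω) (t + h) -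
    jumpWeight v i j * pathWeight v (fun s => X s ω) t
  have hi1 := integrable_pathWeight hX hreg hN1 hv hth
  have hi2 := (integrable_pathWeight hX hreg hN1 hv ht).const_mul (jumpWeight v i j)
  have hDi : Integrable D P := hi1.sub hi2
  have hD1 : ∀ ω, ‖D ω‖ ≤ 1 := fun ω => by
    have h1 := pathWeight_mem hv (fun s => X s ω) (t + h)
    have h2 := pathWeight_mem hv (fun s => X s ω) t
    have h3 := jumpWeight_mem hv i j
    have h4 : jumpWeight v i j * pathWeight v (fun s => X s ω) t ≤ 1 :=
      mul_le_one₀ h3.2 h2.1 h2.2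
    have h5 := mul_nonneg h3.1 h2.1
    rw [Real.norm_eq_abs]
    exact abs_le.2 ⟨by simp only [D]; linarith [h1.1], by simp only [D]; linarith [h1.2]⟩
  have hlim : Tendsto (fun n => ∫ ω in O n, D ω ∂P) atTop (𝓝 0) := by
    have : Tendsto (fun n => ∫ ω, (O n).indicator D ω ∂P) atTop (𝓝 (∫ _, (0 : ℝ) ∂P)) := by
      refine tendsto_integral_of_dominated_convergence (fun _ => 1)
        (fun n => (hDi.indicator (hOm n)).aestronglyMeasurable) (integrable_const _)
        (fun n => Eventually.of_forall fun ω => (norm_indicator_le_norm_self _ _).trans (hD1 ω)) ?_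
      filter_upwards [hreg] with ω hω
      refine tendsto_const_nhds.congr' ?_
      filter_upwards [hω.eventually_pathWeight ht hh hN1 v] with n hn
      by_cases hωn : ω ∈ O n
      · rw [indicator_of_mem hωn]
        simp only [D]
        rw [hn, hOW n ω hωn, mul_comm, sub_self]
      · rw [indicator_of_notMem hωn]
    simpa [integral_indicator, hOm] using this
  have hint : ∫ ω in A, D ω ∂P = ∫ ω in A, pathWeight v (fun s => X s ω) (t + h) ∂P -
      jumpWeight v i j * (p h i j * weightedRow P X v i t) := by
    simp only [D]
    rw [integral_sub hi1.integrableOn hi2.integrableOn, integral_const_mul,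
      hX.setIntegral_pathWeight_markov hreg hN1 hv ht hh i j]
  rw [← hint, ← hX.real_eq_eq ht hh i j]
  have hb : ∀ᶠ n in atTop, |∫ ω in A, D ω ∂P| ≤ P.real A - L n + |∫ ω in O n, D ω ∂P| := by
    filter_upwards [hOA, hL] with n hn hLn
    have h1 : ∫ ω in A, D ω ∂P = ∫ ω in A \ O n, D ω ∂P + ∫ ω in O n, D ω ∂P := by
      rw [← setIntegral_union disjoint_sdiff_left (hOm n) hDi.integrableOn hDi.integrableOn,
        sdiff_union_of_subset hn]
    have h2 := norm_setIntegral_le_of_norm_le_const (μ := P) (s := A \ O n) (C := 1) (f := D)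
      (measure_lt_top P _) fun ω _ => hD1 ω
    rw [one_mul, measureReal_sdiff hn (hOm n), Real.norm_eq_abs] at h2
    rw [h1]
    have := abs_add_le (∫ ω in A \ O n, D ω ∂P) (∫ ω in O n, D ω ∂P)
    linarith
  have hlim2 := (tendsto_const_nhds (x := P.real A)).sub hl |>.add hlim.abs
  rw [abs_zero, add_zero] at hlim2
  exact ge_of_tendsto hlim2 hb

end IsChain

end BranchingCrossing

namespace BranchingCrossing

/-! ### Paths with at most one jump -/

theorem hasDerivWithinAt_zero_of_abs_le {e ρ : ℝ → ℝ} {s : Set ℝ} {x : ℝ} (hx : x ∈ s)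
    (h : ∀ y ∈ s, |e y| ≤ ρ y) (hρ0 : ρ x = 0) (hρ : HasDerivWithinAt ρ 0 s x) :
    HasDerivWithinAt e 0 s x := by
  have he0 : e x = 0 := abs_nonpos_iff.1 ((h x hx).trans_eq hρ0)
  rw [hasDerivWithinAt_iff_isLittleO] at hρ ⊢
  simp only [he0, hρ0, smul_zero, sub_zero] at hρ ⊢
  refine Asymptotics.IsBigO.trans_isLittleO (Asymptotics.IsBigO.of_bound 1 ?_) hρ
  filter_upwards [self_mem_nhdsWithin] with y hy
  rw [one_mul, Real.norm_eq_abs]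
  exact (h y hy).trans (le_abs_self _)

variable {Ω : Type*} [MeasurableSpace Ω] {P : Measure Ω} {b : ℕ → ℝ} {p : ℝ → ℕ → ℕ → ℝ}

namespace IsTransitionFunction

theorem exp_le_diag (hb : IsBranchingRates b) (hp : IsTransitionFunction p)
    (hf : SatisfiesForwardEquation b p) (j : ℕ) {t : ℝ} (ht : 0 ≤ t) :
    Real.exp (-(j * -b 1 * t)) ≤ p t j j := by
  rcases j with _ | j
  · simp [zero_row hb hp hf ht]
  · exact exp_le_diag_of_one_le hb hp hf (by omega) ht

theorem mul_le_add (hp : IsTransitionFunction p) {s t : ℝ} (hs : 0 ≤ s) (ht : 0 ≤ t) (i j k : ℕ) :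
    p s i k * p t k j ≤ p (s + t) i j :=
  le_hasSum (hp.chapman_kolmogorov s t hs ht i j) k fun l _ =>
    mul_nonneg (hp.nonneg s hs i l) (hp.nonneg t ht l j)

/-- A Riemann sum of `s ↦ p s i j` is controlled by the integral, because `p` can decrease at most
at an exponential rate. -/
theorem sum_mul_le_integral (hb : IsBranchingRates b) (hp : IsTransitionFunction p)
    (hf : SatisfiesForwardEquation b p) {j : ℕ} (hj : 1 ≤ j) (i : ℕ) {h : ℝ} (hh : 0 ≤ h) (n : ℕ) :
    ∑ m ∈ Finset.range n, h * p (m * h) i j ≤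
      Real.exp (j * -b 1 * h) * ∫ s in (0 : ℝ)..(n * h), p s i j := by
  have hβ := hb.isSubRates.beta_nonneg
  have hc := continuousOn hf i hj
  have hint : ∀ a c : ℝ, 0 ≤ a → 0 ≤ c → IntervalIntegrable (fun s => p s i j) volume a c :=
    fun a c ha hc' => (hc.mono fun s hs => (le_inf ha hc').trans hs.1).intervalIntegrable
  have h1 := intervalIntegral.sum_integral_adjacent_intervals (μ := volume) (n := n)
    (f := fun s => p s i j) (a := fun m : ℕ => m * h)
    fun m _ => hint _ _ (by positivity) (by positivity)
  simp only [Nat.cast_zero, zero_mul] at h1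
  rw [← h1, Finset.mul_sum]
  refine Finset.sum_le_sum fun m _ => ?_
  have h2 : ∫ s in (m * h)..((m + 1 : ℕ) * h), p (m * h) i j * Real.exp (-(j * -b 1 * h)) ≤
      ∫ s in (m * h)..((m + 1 : ℕ) * h), p s i j := by
    refine intervalIntegral.integral_mono_on (by push_cast; nlinarith) intervalIntegrable_const
      (hint _ _ (by positivity) (by positivity)) fun s hs => ?_
    have hs0 : 0 ≤ s - m * h := sub_nonneg.2 hs.1
    have hsh : s - m * h ≤ h := by have := hs.2; push_cast at this; linarith
    calc p (m * h) i j * Real.exp (-(j * -b 1 * h))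
        ≤ p (m * h) i j * p (s - m * h) j j := by
          refine mul_le_mul_of_nonneg_left ?_ (hp.nonneg _ (by positivity) i j)
          refine le_trans ?_ (exp_le_diag_of_one_le hb hp hf hj hs0)
          gcongr
      _ ≤ p (m * h + (s - m * h)) i j := hp.mul_le_add (by positivity) hs0 i j j
      _ = p s i j := by rw [add_sub_cancel]
  rw [intervalIntegral.integral_const, smul_eq_mul, Real.exp_neg,
    show ((m + 1 : ℕ) : ℝ) * h - m * h = h by push_cast; ring] at h2
  have h3 := mul_le_mul_of_nonneg_left h2 (Real.exp_pos (j * -b 1 * h)).le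
  refine le_trans (le_of_eq ?_) h3
  field_simp

theorem tendsto_nat_mul (hp : IsTransitionFunction p) {i j : ℕ} (hij : i ≠ j) {q : ℝ}
    (hd : HasDerivWithinAt (fun r => p r i j) q (Ici 0) 0) {h : ℝ} (hh : 0 < h) :
    Tendsto (fun n : ℕ => (n : ℝ) * p (h / n) i j) atTop (𝓝 (q * h)) := by
  rw [hasDerivWithinAt_iff_tendsto_slope, Ici_sdiff_left] at hd
  have h1 : Tendsto (fun n : ℕ => h / (n : ℝ)) atTop (𝓝[>] 0) := by
    refine tendsto_nhdsWithin_iff.2 ⟨tendsto_const_div_atTop_nhds_zero_nat h, ?_⟩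
    filter_upwards [eventually_gt_atTop 0] with n hn
    have : (0 : ℝ) < n := Nat.cast_pos.2 hn
    exact div_pos hh this
  refine ((hd.comp h1).mul_const h).congr' ?_
  filter_upwards [eventually_gt_atTop 0] with n hn
  have : (0 : ℝ) < n := Nat.cast_pos.2 hn
  simp only [Function.comp, slope_def_field, hp.zero, if_neg hij, sub_zero]
  field_simp

end IsTransitionFunction

namespace IsChain

open IsTransitionFunction

variable {i₀ : ℕ} {X : ℝ → Ω → ℕ} {N : Finset ℕ} {v : N → ℝ}

/-- A path that is at `j` at the times `t` and `t + h` collects the weight `1` in between, up to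
the probability of having left `j` and returned. -/
theorem abs_setIntegral_diag_le [IsProbabilityMeasure P] (hX : IsChain P i₀ X p)
    (hb : IsBranchingRates b) (hf : SatisfiesForwardEquation b p)
    (hreg : ∀ᵐ ω ∂P, IsRegularPath fun t => X t ω) (hN1 : 1 ∉ N)
    (hv : ∀ i, v i ∈ Icc (0 : ℝ) 1) {t h : ℝ} (ht : 0 ≤ t) (hh : 0 ≤ h) (j : ℕ) :
    |∫ ω in {ω | X t ω = j ∧ X (t + h) ω = j}, pathWeight v (fun s => X s ω) (t + h) ∂P -
        p h j j * weightedRow P X v j t| ≤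
      p t i₀ j * (p h j j - Real.exp (-(j * -b 1 * h))) := by
  have hp := hX.transition
  have key := hX.abs_setIntegral_sub_le hreg hN1 hv ht hh j j
    (O := fun n => {ω | ∀ m ≤ n, X (t + m * (h / n)) ω = j})
    (fun n => hX.measurableSet_path n (fun m => by positivity) fun _ => j) ?_ ?_
    (L := fun _ => p t i₀ j * Real.exp (-(j * -b 1 * h))) ?_ tendsto_const_nhds
  · rw [jumpWeight_self hN1, one_mul] at key
    rwa [mul_sub]
  · filter_upwards [eventually_gt_atTop 0] with n hn ω hω
    have hn' : (n : ℝ) ≠ 0 := Nat.cast_ne_zero.2 hn.ne'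
    exact ⟨by simpa using hω 0 hn.le, by simpa [mul_div_cancel₀ _ hn'] using hω n le_rfl⟩
  · intro n ω hω
    rw [jumpWeight_self hN1]
    refine Finset.prod_eq_one fun m hm => ?_
    have hm := Finset.mem_range.1 hm
    rw [hω m hm.le, hω (m + 1) hm, jumpWeight_self hN1]
  · filter_upwards [eventually_gt_atTop 0] with n hn
    have hn' : (n : ℝ) ≠ 0 := Nat.cast_ne_zero.2 hn.ne'
    have hr : Monotone fun m : ℕ => t + m * (h / n) := fun m m' hmm => by
      have : (m : ℝ) ≤ m' := Nat.cast_le.2 hmm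
      simp only; gcongr
    rw [hX.real_path n (r := fun m => t + m * (h / n)) (by simpa) hr fun _ => j]
    have hstep : ∀ m : ℕ, t + (m + 1 : ℕ) * (h / n) - (t + m * (h / n)) = h / n := fun m => by
      push_cast; ring
    simp only [hstep, Finset.prod_const, Finset.card_range, Nat.cast_zero, zero_mul, add_zero]
    refine mul_le_mul_of_nonneg_left ?_ (hp.nonneg t ht _ _)
    calc Real.exp (-(j * -b 1 * h)) = Real.exp (-(j * -b 1 * (h / n))) ^ n := by
          rw [← Real.exp_nat_mul]; congr 1; field_simp
      _ ≤ _ := by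
          gcongr
          exact exp_le_diag hb hp hf j (by positivity)

/-- A path that is at `i` at time `t` and at `j ≠ i` at time `t + h` collects the weight of a
single jump in between, up to the probability of several jumps. -/
theorem abs_setIntegral_offDiag_le [IsProbabilityMeasure P] (hX : IsChain P i₀ X p)
    (hb : IsBranchingRates b) (hf : SatisfiesForwardEquation b p)
    (hreg : ∀ᵐ ω ∂P, IsRegularPath fun t => X t ω) (hN1 : 1 ∉ N)
    (hv : ∀ i, v i ∈ Icc (0 : ℝ) 1) {t h : ℝ} (ht : 0 ≤ t) (hh : 0 ≤ h) {i j : ℕ} (hij : i ≠ j)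
    {q : ℝ} (hd : HasDerivWithinAt (fun r => p r i j) q (Ici 0) 0) :
    |∫ ω in {ω | X t ω = i ∧ X (t + h) ω = j}, pathWeight v (fun s => X s ω) (t + h) ∂P -
        jumpWeight v i j * (p h i j * weightedRow P X v i t)| ≤
      p t i₀ i * (p h i j - q * h * Real.exp (-((i + j : ℕ) * -b 1 * h))) := by
  have hp := hX.transition
  rcases hh.eq_or_lt with rfl | hpos
  · have : {ω | X t ω = i ∧ X (t + 0) ω = j} = ∅ :=
      eq_empty_of_forall_notMem fun ω hω => hij (by rw [← hω.1, ← hω.2, add_zero])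
    rw [this]
    simp [hp.zero, hij]
  set E := Real.exp (-((i + j : ℕ) * -b 1 * h)) with hE
  -- `τ m` is the discrete trajectory that jumps from `i` to `j` after step `m`
  let τ : ℕ → ℕ → ℕ := fun m l => if l ≤ m then i else j
  have hτm : ∀ n, MeasurableSet (⋃ m ∈ Finset.range n,
      {ω | ∀ l ≤ n, X (t + l * (h / n)) ω = τ m l}) := fun n =>
    Finset.measurableSet_biUnion _ fun m _ => hX.measurableSet_path n (fun m => by positivity) _
  have key := hX.abs_setIntegral_sub_le hreg hN1 hv ht hh i j
    (O := fun n => ⋃ m ∈ Finset.range n, {ω | ∀ l ≤ n, X (t + l * (h / n)) ω = τ m l})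
    hτm ?_ ?_ (L := fun n : ℕ => p t i₀ i * (n * p (h / n) i j * E))
    (l := p t i₀ i * (q * h * E)) ?_
    (((tendsto_nat_mul hp hij hd hpos).mul_const E).const_mul _)
  · rwa [mul_sub]
  · filter_upwards [eventually_gt_atTop 0] with n hn ω hω
    simp only [mem_iUnion, Finset.mem_range, mem_ofPred_eq] at hω
    obtain ⟨m, hm, hω⟩ := hω
    have hn' : (n : ℝ) ≠ 0 := Nat.cast_ne_zero.2 hn.ne'
    exact ⟨by simpa [τ] using hω 0 hn.le,
      by simpa [mul_div_cancel₀ _ hn', τ, hm.not_ge] using hω n le_rfl⟩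
  · intro n ω hω
    simp only [mem_iUnion, Finset.mem_range, mem_ofPred_eq] at hω
    obtain ⟨m, hm, hω⟩ := hω
    rw [Finset.prod_eq_single m]
    · rw [hω m hm.le, hω (m + 1) hm]; simp [τ]
    · intro l hl hlm
      have hl := Finset.mem_range.1 hl
      rw [hω l hl.le, hω (l + 1) hl]
      have : τ m (l + 1) = τ m l := by
        simp only [τ]
        rcases lt_or_gt_of_ne hlm with h | h
        · rw [if_pos (Nat.succ_le_iff.2 h), if_pos h.le]
        · rw [if_neg (by omega), if_neg (by omega)]
      rw [this, jumpWeight_self hN1]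
    · intro h; exact absurd (Finset.mem_range.2 hm) h
  · filter_upwards [eventually_gt_atTop 0] with n hn
    have hn' : (n : ℝ) ≠ 0 := Nat.cast_ne_zero.2 hn.ne'
    have hr : Monotone fun m : ℕ => t + m * (h / n) := fun m m' hmm => by
      have : (m : ℝ) ≤ m' := Nat.cast_le.2 hmm
      simp only; gcongr
    have hstep : ∀ m : ℕ, t + (m + 1 : ℕ) * (h / n) - (t + m * (h / n)) = h / n := fun m => by
      push_cast; ring
    have hhn : 0 ≤ h / n := by positivity
    rw [measureReal_biUnion_finset]
    · have hterm : ∀ m ∈ Finset.range n, p t i₀ i * (p (h / n) i j * E) ≤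
          P.real {ω | ∀ l ≤ n, X (t + l * (h / n)) ω = τ m l} := by
        intro m hm
        rw [hX.real_path n (r := fun m => t + m * (h / n)) (by simpa) hr (τ m)]
        simp only [hstep, Nat.cast_zero, zero_mul, add_zero]
        rw [show τ m 0 = i by simp [τ]]
        refine mul_le_mul_of_nonneg_left ?_ (hp.nonneg t ht _ _)
        rw [← Finset.mul_prod_erase _ _ hm, show τ m m = i by simp [τ],
          show τ m (m + 1) = j by simp [τ]]
        refine mul_le_mul_of_nonneg_left ?_ (hp.nonneg _ hhn _ _)
        have hβ := hb.isSubRates.beta_nonneg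
        set a := Real.exp (-((i + j : ℕ) * -b 1 * (h / n))) with ha
        have ha1 : a ≤ 1 := Real.exp_le_one_iff.2 (neg_nonpos.2 (by positivity))
        calc E = a ^ n := by
              rw [ha, ← Real.exp_nat_mul, hE]; congr 1; field_simp
          _ ≤ a ^ ((Finset.range n).erase m).card := by
              refine pow_le_pow_of_le_one (Real.exp_pos _).le ha1 ?_
              exact (Finset.card_erase_le).trans_eq (Finset.card_range n)
          _ = ∏ l ∈ (Finset.range n).erase m, a := (Finset.prod_const _).symm
          _ ≤ _ := by
              refine Finset.prod_le_prod (fun _ _ => (Real.exp_pos _).le) fun l hl => ?_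
              have hlm : l ≠ m := (Finset.mem_erase.1 hl).1
              have : τ m (l + 1) = τ m l := by
                simp only [τ]
                rcases lt_or_gt_of_ne hlm with h | h
                · rw [if_pos (Nat.succ_le_iff.2 h), if_pos h.le]
                · rw [if_neg (by omega), if_neg (by omega)]
              rw [this]
              refine le_trans ?_ (exp_le_diag hb hp hf (τ m l) hhn)
              refine Real.exp_le_exp.2 (neg_le_neg ?_)
              have : (τ m l : ℝ) ≤ (i + j : ℕ) := Nat.cast_le.2 (by
                simp only [τ]; split_ifs <;> omega)
              gcongr
      calc p t i₀ i * (n * p (h / n) i j * E)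
          = ∑ m ∈ Finset.range n, p t i₀ i * (p (h / n) i j * E) := by
            rw [Finset.sum_const, Finset.card_range, nsmul_eq_mul]; ring
        _ ≤ _ := Finset.sum_le_sum hterm
    · intro m hm m' hm' hne
      have hm := Finset.mem_range.1 (Finset.mem_coe.1 hm)
      have hm' := Finset.mem_range.1 (Finset.mem_coe.1 hm')
      refine Set.disjoint_left.2 fun ω h1 h2 => hij ?_
      rcases lt_or_gt_of_ne hne with h | h
      · have e1 := h1 (m + 1) hm
        have e2 := h2 (m + 1) hm
        rw [e1] at e2
        simpa [τ, Nat.succ_le_iff.2 h] using e2.symm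
      · have e1 := h1 (m' + 1) hm'
        have e2 := h2 (m' + 1) hm'
        rw [e1] at e2
        simpa [τ, Nat.succ_le_iff.2 h] using e2
    · intro m _
      exact hX.measurableSet_path n (fun m => by positivity) _

/-! ### The forward equation at the state `0` -/

/-- Regularity of the paths yields the converse of `flux_le`: a path that is bounded on `[0, t]`
can reach `0` only by a jump from a finite set of states, so no mass arrives at `0` from
infinity. -/
theorem le_flux [IsProbabilityMeasure P] (hX : IsChain P 1 X p)
    (hb : IsBranchingRates b) (hf : SatisfiesForwardEquation b p)
    (hreg : ∀ᵐ ω ∂P, IsRegularPath fun t => X t ω) {t : ℝ} (ht : 0 ≤ t) :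
    p t 1 0 ≤ b 0 * ∫ r in (0 : ℝ)..t, p r 1 1 := by
  have hp := hX.transition
  rcases ht.eq_or_lt with rfl | hpos
  · simp [hp.zero]
  set I := ∫ r in (0 : ℝ)..t, p r 1 1 with hI
  have hb0 : 0 ≤ b 0 := hb.nonneg 0 (by norm_num)
  have hQ : ∀ i, branchingQ b i 0 = if i = 1 then b 0 else 0 := fun i => by
    unfold branchingQ
    rcases eq_or_ne i 1 with rfl | hi
    · simp
    · rw [if_neg (by omega), if_neg hi]
  let E : ℕ → Set Ω := fun M => {ω | X 0 ω = 1 ∧ X t ω = 0 ∧ ∀ r ∈ Icc 0 t, X r ω ≤ M}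
  have hEmono : Monotone E := fun M M' hM ω hω => ⟨hω.1, hω.2.1, fun r hr => (hω.2.2 r hr).trans hM⟩
  have hunion : P (⋃ M, E M) = P {ω | X t ω = 0} := by
    refine measure_congr ?_
    filter_upwards [hreg, hX.ae_start] with ω h1 h2
    refine propext ⟨fun h => ?_, fun h => ?_⟩
    · obtain ⟨M, hM⟩ := mem_iUnion.1 h
      exact hM.2.1
    · obtain ⟨M, hM⟩ := h1.exists_le t
      exact mem_iUnion.2 ⟨M, h2, h, hM⟩
  have hlim : Tendsto (fun M => P.real (E M)) atTop (𝓝 (p t 1 0)) := by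
    rw [← hX.real_eq ht 0, Measure.real, ← hunion]
    exact (ENNReal.tendsto_toReal (measure_ne_top _ _)).comp (tendsto_measure_iUnion_atTop hEmono)
  refine le_of_tendsto hlim (Eventually.of_forall fun M => ?_)
  -- A path bounded by `M` enters `0` from some `i ≤ M` in one of the `n` steps of a partition. By
  -- `eventually_le_of_honest` only `i = 1` contributes to first order, which leaves a Riemann sum.
  have hbound : ∀ ε > 0, P.real (E M) ≤ b 0 * I + M * ε * t := by
    intro ε hε
    have hev : ∀ᶠ n : ℕ in atTop, ∀ i ∈ Finset.Icc 1 M,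
        p (t / n) i 0 ≤ (branchingQ b i 0 + ε) * (t / n) := by
      have h1 : Tendsto (fun n : ℕ => t / (n : ℝ)) atTop (𝓝[>] 0) := by
        refine tendsto_nhdsWithin_iff.2 ⟨tendsto_const_div_atTop_nhds_zero_nat t, ?_⟩
        filter_upwards [eventually_gt_atTop 0] with n hn
        have : (0 : ℝ) < n := Nat.cast_pos.2 hn
        exact div_pos hpos this
      refine h1.eventually (p := fun h => ∀ i ∈ Finset.Icc 1 M,
        p h i 0 ≤ (branchingQ b i 0 + ε) * h) ((Filter.eventually_all_finset _).2 fun i hi => ?_)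
      exact eventually_le_of_honest hb hp hf (Finset.mem_Icc.1 hi).1 hε
    have hexp : Tendsto (fun n : ℕ => b 0 * (Real.exp ((1 : ℕ) * -b 1 * (t / n)) * I) + M * ε * t)
        atTop (𝓝 (b 0 * (Real.exp ((1 : ℕ) * -b 1 * 0) * I) + M * ε * t)) :=
      ((((Real.continuous_exp.tendsto _).comp ((tendsto_const_div_atTop_nhds_zero_nat t).const_mul
        _)).mul_const _).const_mul _).add_const _
    rw [mul_zero, Real.exp_zero, one_mul] at hexp
    refine ge_of_tendsto hexp ?_
    filter_upwards [hev, eventually_gt_atTop 0] with n hn hn0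
    have hn' : (0 : ℝ) < n := Nat.cast_pos.2 hn0
    set h := t / n with hh
    have hh0 : 0 < h := div_pos hpos hn'
    have hnh : n * h = t := mul_div_cancel₀ _ hn'.ne'
    have hsub : E M ⊆ ⋃ m ∈ Finset.range n, ⋃ i ∈ Finset.Icc 1 M,
        {ω | X (m * h) ω = i ∧ X (m * h + h) ω = 0} := by
      rintro ω ⟨h0, h1, h2⟩
      by_contra hcon
      simp only [mem_iUnion, Finset.mem_range, Finset.mem_Icc, mem_ofPred_eq, not_exists] at hcon
      have hall : ∀ m ≤ n, X (m * h) ω ≠ 0 := by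
        intro m
        induction m with
        | zero => intro _; simp [h0]
        | succ m ih =>
          intro hm hz
          have hne := ih (by omega)
          have hmh : m * h ≤ t := by
            rw [← hnh]; gcongr; omega
          refine hcon m (by omega) _ ⟨Nat.one_le_iff_ne_zero.2 hne,
            h2 (m * h) ⟨by positivity, hmh⟩⟩ ⟨rfl, ?_⟩
          rw [← hz]; congr 1; push_cast; ring
      exact hall n le_rfl (by rw [hnh]; exact h1)
    calc P.real (E M) ≤ ∑ m ∈ Finset.range n, ∑ i ∈ Finset.Icc 1 M,
          P.real {ω | X (m * h) ω = i ∧ X (m * h + h) ω = 0} := by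
          refine (measureReal_mono hsub (measure_ne_top _ _)).trans ?_
          refine (measureReal_biUnion_finset_le _ _).trans ?_
          exact Finset.sum_le_sum fun m _ => measureReal_biUnion_finset_le _ _
      _ ≤ ∑ m ∈ Finset.range n, (b 0 * (h * p (m * h) 1 1) + M * ε * h) := by
          refine Finset.sum_le_sum fun m _ => ?_
          have hmh : (0 : ℝ) ≤ m * h := by positivity
          calc ∑ i ∈ Finset.Icc 1 M, P.real {ω | X (m * h) ω = i ∧ X (m * h + h) ω = 0}
              ≤ ∑ i ∈ Finset.Icc 1 M, ((if i = 1 then b 0 * (h * p (m * h) 1 1) else 0)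
                  + ε * h) := by
                refine Finset.sum_le_sum fun i hi => ?_
                rw [hX.real_eq_eq hmh hh0.le]
                have h1 := hn i hi
                have h2 := hp.nonneg (m * h) hmh 1 i
                have h3 := hp.le_one hmh 1 i
                rw [hQ] at h1
                refine (mul_le_mul_of_nonneg_left h1 h2).trans ?_
                have h4 : p (m * h) 1 i * (ε * h) ≤ ε * h :=
                  mul_le_of_le_one_left (by positivity) h3
                split_ifs with hi1
                · subst hi1; nlinarith
                · nlinarith
            _ ≤ b 0 * (h * p (m * h) 1 1) + M * ε * h := by
                rw [Finset.sum_add_distrib, Finset.sum_ite_eq', Finset.sum_const,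
                  Nat.card_Icc, Nat.add_sub_cancel, nsmul_eq_mul, ← mul_assoc (M : ℝ)]
                refine add_le_add (c := M * ε * h) ?_ le_rfl
                split_ifs
                · exact le_rfl
                · have := hp.nonneg (m * h) hmh 1 1
                  positivity
      _ = b 0 * ∑ m ∈ Finset.range n, h * p (m * h) 1 1 + M * ε * t := by
          rw [Finset.sum_add_distrib, ← Finset.mul_sum, Finset.sum_const, Finset.card_range,
            nsmul_eq_mul, ← hnh]
          ring
      _ ≤ b 0 * (Real.exp ((1 : ℕ) * -b 1 * h) * I) + M * ε * t := by
          have := sum_mul_le_integral hb hp hf le_rfl 1 hh0.le n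
          rw [hnh] at this
          gcongr
  refine le_of_forall_pos_le_add fun ε hε => ?_
  refine (hbound (ε / (M * t + 1)) (by positivity)).trans ?_
  have : M * (ε / (M * t + 1)) * t ≤ ε := by
    rw [mul_div_assoc', div_mul_eq_mul_div, div_le_iff₀ (by positivity)]
    nlinarith
  linarith

/-- The forward equation for the row of the initial state `1`, now also at `j = 0`. -/
theorem hasDerivWithinAt_row [IsProbabilityMeasure P] (hX : IsChain P 1 X p)
    (hb : IsBranchingRates b) (hf : SatisfiesForwardEquation b p)
    (hreg : ∀ᵐ ω ∂P, IsRegularPath fun t => X t ω) (j : ℕ) {t : ℝ} (ht : 0 ≤ t) :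
    HasDerivWithinAt (fun r => p r 1 j) (forwardRHS b (p t 1) j) (Ici 0) t := by
  rcases j with _ | j
  · have h : ∀ s ∈ Ici (0 : ℝ), p s 1 0 = b 0 * ∫ r in (0 : ℝ)..s, p r 1 1 := fun s hs =>
      le_antisymm (hX.le_flux hb hf hreg hs) (flux_le hb hX.transition hf hs)
    exact (hasDerivWithinAt_flux hf 1 ht).congr h (h t ht)
  · exact hasDerivWithinAt hf 1 (by omega) ht

theorem hasDerivWithinAt_entry_zero [IsProbabilityMeasure P] (hX : IsChain P 1 X p)
    (hb : IsBranchingRates b) (hf : SatisfiesForwardEquation b p)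
    (hreg : ∀ᵐ ω ∂P, IsRegularPath fun t => X t ω) {i j : ℕ} (hij : i ≤ j + 1) :
    HasDerivWithinAt (fun r => p r i j) (branchingQ b i j) (Ici 0) 0 := by
  have hp := hX.transition
  rcases j with _ | j
  · interval_cases i
    · have : branchingQ b 0 0 = 0 := by simp [branchingQ]
      rw [this]
      refine (hasDerivWithinAt_const (0 : ℝ) (Ici 0) (1 : ℝ)).congr (fun s hs => ?_) ?_
      · rw [zero_row hb hp hf hs]; rfl
      · rw [hp.zero]; rfl
    · convert! hX.hasDerivWithinAt_row hb hf hreg 0 le_rfl using 1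
      rw [← forwardRHS_pi_single]
      congr 1; ext k; rw [hp.zero]
  · exact hp.hasDerivWithinAt_zero hf i (by omega)

/-! ### The forward equation for the weighted row -/

theorem weightedRow_mem [IsProbabilityMeasure P] (hX : IsChain P i₀ X p)
    (hv : ∀ i, v i ∈ Icc (0 : ℝ) 1) (j : ℕ) {t : ℝ} (ht : 0 ≤ t) :
    weightedRow P X v j t ∈ Icc 0 (p t i₀ j) := by
  rw [← hX.real_eq ht]; exact setIntegral_pathWeight_mem hv t _

/-- The part of the weighted row at time `t + h` not coming from the states in `S` is at most the
corresponding probability. -/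
theorem sub_sum_setIntegral_mem [IsProbabilityMeasure P] (hX : IsChain P i₀ X p)
    (hreg : ∀ᵐ ω ∂P, IsRegularPath fun t => X t ω) (hN1 : 1 ∉ N)
    (hv : ∀ i, v i ∈ Icc (0 : ℝ) 1) {t h : ℝ} (ht : 0 ≤ t) (hh : 0 ≤ h) (j : ℕ) (S : Finset ℕ) :
    weightedRow P X v j (t + h) - ∑ i ∈ S,
      ∫ ω in {ω | X t ω = i ∧ X (t + h) ω = j}, pathWeight v (fun s => X s ω) (t + h) ∂P ∈
      Icc 0 (p (t + h) i₀ j - ∑ i ∈ S, p t i₀ i * p h i j) := by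
  have hth : 0 ≤ t + h := add_nonneg ht hh
  have hAm : ∀ i, MeasurableSet {ω | X t ω = i ∧ X (t + h) ω = j} := fun i =>
    (hX.measurableSet_eq ht i).inter (hX.measurableSet_eq hth j)
  have hint := integrable_pathWeight hX hreg hN1 hv hth
  have hdisj : Pairwise (Function.onFun Disjoint fun i => {ω | X t ω = i ∧ X (t + h) ω = j}) :=
    fun i i' hne => Set.disjoint_left.2 fun ω h1 h2 => hne (h1.1.symm.trans h2.1)
  set U := ⋃ i ∈ S, {ω | X t ω = i ∧ X (t + h) ω = j} with hU
  have hUm : MeasurableSet U := Finset.measurableSet_biUnion _ fun i _ => hAm i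
  have hUsub : U ⊆ {ω | X (t + h) ω = j} := iUnion₂_subset fun i _ ω hω => hω.2
  have h1 : ∑ i ∈ S, ∫ ω in {ω | X t ω = i ∧ X (t + h) ω = j},
      pathWeight v (fun s => X s ω) (t + h) ∂P =
      ∫ ω in U, pathWeight v (fun s => X s ω) (t + h) ∂P :=
    (integral_biUnion_finset S (fun i _ => hAm i) (hdisj.set_pairwise _)
      fun i _ => hint.integrableOn).symm
  have h2 : ∑ i ∈ S, p t i₀ i * p h i j = P.real U := by
    rw [hU, measureReal_biUnion_finset (hdisj.set_pairwise _) fun i _ => hAm i]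
    exact Finset.sum_congr rfl fun i _ => (hX.real_eq_eq ht hh i j).symm
  rw [h1, h2, ← hX.real_eq hth, ← measureReal_sdiff hUsub hUm, weightedRow,
    ← setIntegral_sdiff hUm hint.integrableOn hUsub]
  exact setIntegral_pathWeight_mem hv _ _

/-- The weighted row satisfies the forward equation for the weighted rates. -/
theorem hasDerivWithinAt_weightedRow [IsProbabilityMeasure P] (hX : IsChain P 1 X p)
    (hb : IsBranchingRates b) (hf : SatisfiesForwardEquation b p)
    (hreg : ∀ᵐ ω ∂P, IsRegularPath fun t => X t ω) (hN1 : 1 ∉ N)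
    (hv : ∀ i, v i ∈ Icc (0 : ℝ) 1) (j : ℕ) {t : ℝ} (ht : 0 ≤ t) :
    HasDerivWithinAt (weightedRow P X v j)
      (forwardRHS (weightedRate b v) (fun i => weightedRow P X v i t) j) (Ici t) t := by
  have hp := hX.transition
  -- `A i h` is the part of the weighted row at time `t + h` that passes through `i` at time `t`
  let A : ℕ → ℝ → ℝ := fun i h =>
    ∫ ω in {ω | X t ω = i ∧ X (t + h) ω = j}, pathWeight v (fun s => X s ω) (t + h) ∂P
  let φ : ℕ → ℝ := fun i => weightedRow P X v i t
  let S := Finset.range (j + 2)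
  have hq : ∀ i ∈ S, HasDerivWithinAt (fun r => p r i j) (branchingQ b i j) (Ici 0) 0 :=
    fun i hi => hX.hasDerivWithinAt_entry_zero hb hf hreg (by
      have := Finset.mem_range.1 hi; omega)
  have hexp : ∀ a : ℝ, HasDerivWithinAt (fun h : ℝ => Real.exp (-(a * h))) (-a) (Ici 0) 0 :=
    fun a => by
      have : HasDerivAt (fun h : ℝ => Real.exp (-(a * h))) _ 0 :=
        ((hasDerivAt_id (0 : ℝ)).const_mul a).neg.exp
      simpa using this.hasDerivWithinAt
  have hA : ∀ i ∈ S, HasDerivWithinAt (fun h => A i h - jumpWeight v i j * (p h i j * φ i)) 0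
      (Ici 0) 0 := by
    intro i hi
    rcases eq_or_ne i j with rfl | hij
    · refine hasDerivWithinAt_zero_of_abs_le (self_mem_Ici) (fun h hh => ?_) ?_
        (ρ := fun h => p t 1 i * (p h i i - Real.exp (-(i * -b 1 * h)))) ?_
      · rw [jumpWeight_self hN1, one_mul]
        exact hX.abs_setIntegral_diag_le hb hf hreg hN1 hv ht hh i
      · simp [hp.zero]
      · convert! ((hq i hi).sub (hexp (i * -b 1))).const_mul (p t 1 i) using 1
        unfold branchingQ
        split_ifs with h
        · rw [show i + 1 - i = 1 by omega]; ring
        · have : i = 0 := by omega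
          simp [this]
    · refine hasDerivWithinAt_zero_of_abs_le (self_mem_Ici) (fun h hh =>
        hX.abs_setIntegral_offDiag_le hb hf hreg hN1 hv ht hh hij (hq i hi)) ?_ ?_
      · simp [hp.zero, hij]
      · have h1 : HasDerivWithinAt (fun h : ℝ => branchingQ b i j * h) (branchingQ b i j)
            (Ici 0) 0 := by
          simpa using ((hasDerivAt_id (0 : ℝ)).const_mul (branchingQ b i j)).hasDerivWithinAt
        convert! ((hq i hi).sub (h1.mul (hexp ((i + j : ℕ) * -b 1)))).const_mul (p t 1 i) using 1
        simp
  have hR : HasDerivWithinAt (fun h => weightedRow P X v j (t + h) - ∑ i ∈ S, A i h) 0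
      (Ici 0) 0 := by
    refine hasDerivWithinAt_zero_of_abs_le self_mem_Ici (fun h hh => ?_) ?_
      (ρ := fun h => p (t + h) 1 j - ∑ i ∈ S, p t 1 i * p h i j) ?_
    · have := hX.sub_sum_setIntegral_mem hreg hN1 hv ht hh j S
      rw [abs_of_nonneg this.1]
      exact this.2
    · simp only [hp.zero, add_zero]
      rw [Finset.sum_eq_single j]
      · simp
      · intro i _ hi; simp [hi]
      · intro h; exact absurd (Finset.mem_range.2 (by omega)) h
    · have h1 : HasDerivWithinAt (fun h => p (t + h) 1 j) (forwardRHS b (p t 1) j) (Ici 0) 0 := by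
        have h0 := hX.hasDerivWithinAt_row hb hf hreg j ht
        have h2 : HasDerivWithinAt (fun h : ℝ => t + h) 1 (Ici 0) 0 :=
          (hasDerivWithinAt_id (0 : ℝ) (Ici 0)).const_add t
        have h3 := HasDerivWithinAt.comp (0 : ℝ) (h := fun h : ℝ => t + h)
          (h₂ := fun r => p r 1 j) (s' := Ici 0) (by simpa using h0) h2
          (fun r hr => add_nonneg ht hr)
        simpa [Function.comp_def] using h3
      convert! h1.sub (HasDerivWithinAt.fun_sum fun i hi => (hq i hi).const_mul (p t 1 i)) using 1
      rw [← tsum_mul_branchingQ, tsum_eq_sum (s := S), sub_self]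
      intro i hi
      rw [branchingQ, if_neg, mul_zero]
      rw [Finset.mem_range] at hi; omega
  have hmain := (hR.add (HasDerivWithinAt.fun_sum hA)).add (HasDerivWithinAt.fun_sum fun i hi =>
    ((hq i hi).mul_const (φ i)).const_mul (jumpWeight v i j))
  have hval : ∑ i ∈ S, jumpWeight v i j * (branchingQ b i j * φ i) =
      forwardRHS (weightedRate b v) φ j := by
    simp only [S]
    rw [Finset.sum_range_succ', forwardRHS]
    have h0 : branchingQ b 0 j = 0 := by simp [branchingQ]
    rw [h0, zero_mul, mul_zero, add_zero]
    refine Finset.sum_congr rfl fun i hi => ?_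
    have := Finset.mem_range.1 hi
    rw [branchingQ, if_pos (by omega), show j - i = j + 1 - (i + 1) by omega,
      ← jumpWeight_mul b v (i := i + 1) (j := j) (by omega)]
    push_cast; ring
  have hfun : (fun h => weightedRow P X v j (t + h)) =
      ((fun h => weightedRow P X v j (t + h) - ∑ i ∈ S, A i h) + (fun h => ∑ i ∈ S,
        (A i h - jumpWeight v i j * (p h i j * φ i)))) +
        fun h => ∑ i ∈ S, jumpWeight v i j * (p h i j * φ i) := by
    ext h
    simp only [Pi.add_apply, Finset.sum_sub_distrib]
    ring
  rw [← hfun, hval, Finset.sum_const_zero, add_zero, zero_add] at hmain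
  have h2 : HasDerivWithinAt (fun s : ℝ => s - t) 1 (Ici t) t :=
    (hasDerivWithinAt_id t (Ici t)).sub_const t
  have h3 := HasDerivWithinAt.comp t (h := fun s : ℝ => s - t)
    (h₂ := fun h => weightedRow P X v j (t + h)) (s' := Ici 0) (by simpa using hmain) h2
    (fun r (hr : t ≤ r) => mem_Ici.2 (sub_nonneg.2 hr))
  simpa [Function.comp_def] using h3

/-- A modulus of continuity for the weighted row. The forward equation gives only a right
derivative, so continuity from the left has to be shown separately. -/
theorem abs_weightedRow_sub_le [IsProbabilityMeasure P] (hX : IsChain P 1 X p)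
    (hb : IsBranchingRates b) (hf : SatisfiesForwardEquation b p)
    (hreg : ∀ᵐ ω ∂P, IsRegularPath fun t => X t ω) (hN1 : 1 ∉ N)
    (hv : ∀ i, v i ∈ Icc (0 : ℝ) 1) (j : ℕ) {s t : ℝ} (hs : 0 ≤ s) (ht : 0 ≤ t) :
    |weightedRow P X v j s - weightedRow P X v j t| ≤
      3 * (1 - Real.exp (-(j * -b 1 * |s - t|))) + |p s 1 j - p t 1 j| := by
  have hp := hX.transition
  wlog hst : t ≤ s generalizing s t
  · rw [abs_sub_comm, abs_sub_comm s, abs_sub_comm (p s 1 j)]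
    exact this ht hs (le_of_not_ge hst)
  obtain ⟨h, rfl⟩ : ∃ h, s = t + h := ⟨s - t, by ring⟩
  have hh : 0 ≤ h := by linarith
  rw [add_sub_cancel_left, abs_of_nonneg hh]
  have h1 := abs_le.1 (hX.abs_setIntegral_diag_le hb hf hreg hN1 hv ht hh j)
  have h2 := hX.sub_sum_setIntegral_mem hreg hN1 hv ht hh j {j}
  simp only [Finset.sum_singleton] at h2
  have h3 := exp_le_diag hb hp hf j hh
  have h4 := hp.le_one hh j j
  have h5 := hX.weightedRow_mem hv j ht
  have h6 := hp.le_one ht 1 j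
  have h7 := hp.nonneg t ht 1 j
  have h8 : weightedRow P X v j t * (1 - p h j j) ≤ 1 - p h j j :=
    mul_le_of_le_one_left (by linarith) (h5.2.trans h6)
  have h9 : 0 ≤ weightedRow P X v j t * (1 - p h j j) := mul_nonneg h5.1 (by linarith)
  have h10 : p t 1 j * (1 - p h j j) ≤ 1 - p h j j := mul_le_of_le_one_left (by linarith) h6
  have h11 : p t 1 j * (p h j j - Real.exp (-(j * -b 1 * h))) ≤
      p h j j - Real.exp (-(j * -b 1 * h)) := mul_le_of_le_one_left (by linarith) h6
  have h12 := le_abs_self (p (t + h) 1 j - p t 1 j)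
  have h13 := abs_nonneg (p (t + h) 1 j - p t 1 j)
  rw [abs_le]
  constructor <;> nlinarith [h1.1, h1.2, h2.1, h2.2]

theorem continuousOn_weightedRow [IsProbabilityMeasure P] (hX : IsChain P 1 X p)
    (hb : IsBranchingRates b) (hf : SatisfiesForwardEquation b p)
    (hreg : ∀ᵐ ω ∂P, IsRegularPath fun t => X t ω) (hN1 : 1 ∉ N)
    (hv : ∀ i, v i ∈ Icc (0 : ℝ) 1) (j : ℕ) : ContinuousOn (weightedRow P X v j) (Ici 0) := by
  intro t ht
  have hc := (hX.hasDerivWithinAt_row hb hf hreg j ht).continuousWithinAt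
  refine tendsto_iff_dist_tendsto_zero.2 (squeeze_zero' (Eventually.of_forall fun _ => dist_nonneg)
    (g := fun s => 3 * (1 - Real.exp (-(j * -b 1 * |s - t|))) + |p s 1 j - p t 1 j|) ?_ ?_)
  · filter_upwards [self_mem_nhdsWithin] with s hs
    rw [Real.dist_eq]
    exact hX.abs_weightedRow_sub_le hb hf hreg hN1 hv j hs ht
  · have h1 : Tendsto (fun s : ℝ => 3 * (1 - Real.exp (-(j * -b 1 * |s - t|)))) (𝓝[Ici 0] t)
        (𝓝 (3 * (1 - Real.exp (-(j * -b 1 * |t - t|))))) :=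
      ((by fun_prop : Continuous fun s : ℝ =>
        3 * (1 - Real.exp (-(j * -b 1 * |s - t|)))).tendsto t).mono_left nhdsWithin_le_nhds
    have h2 := h1.add ((hc.tendsto.sub_const (p t 1 j)).abs)
    simpa using h2

end IsChain

end BranchingCrossing

namespace BranchingCrossing

/-! ### The joint generating function solves the differential equation -/

theorem exists_seq_tendsto_one : ∃ u : ℕ → ℝ, (∀ n, 0 ≤ u n ∧ u n < 1) ∧
    Tendsto u atTop (𝓝[Icc 0 1] 1) := by
  have h0 : ∀ n : ℕ, 0 ≤ 1 - 1 / ((n : ℝ) + 1) ∧ 1 - 1 / ((n : ℝ) + 1) < 1 := fun n => by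
    have h1 : (0 : ℝ) < 1 / ((n : ℝ) + 1) := by positivity
    have h2 : 1 / ((n : ℝ) + 1) ≤ 1 := by
      rw [div_le_one (by positivity)]; linarith [(Nat.cast_nonneg n : (0 : ℝ) ≤ n)]
    exact ⟨by linarith, by linarith⟩
  refine ⟨fun n => 1 - 1 / ((n : ℝ) + 1), h0, tendsto_nhdsWithin_iff.2 ⟨?_,
    Eventually.of_forall fun n => ⟨(h0 n).1, (h0 n).2.le⟩⟩⟩
  simpa using (tendsto_one_div_add_atTop_nhds_zero_nat (𝕜 := ℝ)).const_sub 1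

variable {b : ℕ → ℝ} {N : Finset ℕ} {v : N → ℝ}

/-- The right-hand side of the differential equation is the vector field of the weighted rates. -/
theorem BN_add_BbarN (hb : IsBranchingRates b) (N : Finset ℕ) (v : N → ℝ) {u : ℝ}
    (hu : u ∈ Icc (0 : ℝ) 1) : BN b N u v + BbarN b N u = field (weightedRate b v) u := by
  have h1 : ∀ j, weightedRate b v j * u ^ j =
      (if h : j ∈ N then b j * v ⟨j, h⟩ * u ^ j else 0) + (if j ∈ N then 0 else b j * u ^ j) := by
    intro j; unfold weightedRate; split_ifs <;> simp
  have h2 : HasSum (fun j => if h : j ∈ N then b j * v ⟨j, h⟩ * u ^ j else 0) (BN b N u v) := by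
    have := hasSum_sum_of_ne_finset_zero (s := N) (L := SummationFilter.unconditional ℕ)
      (f := fun j => if h : j ∈ N then b j * v ⟨j, h⟩ * u ^ j else 0) fun j hj => dif_neg hj
    convert! this using 1
    rw [BN, ← Finset.sum_coe_sort N]
    exact Finset.sum_congr rfl fun j _ => by rw [dif_pos j.2]
  have h3 : Summable fun j => if j ∈ N then 0 else b j * u ^ j := by
    refine Summable.of_norm_bounded (summable_mul_pow hb.hasSum_zero.summable hu).norm fun j => ?_
    split_ifs
    · rw [norm_zero]; exact norm_nonneg _
    · exact le_rfl
  rw [field, tsum_congr h1, h2.summable.tsum_add h3, h2.tsum_eq, BbarN]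

theorem eq_one_of_field_one (hb : IsBranchingRates b) (hN1 : 1 ∉ N) (hNb : ∀ k ∈ N, 0 < b k)
    (hv : ∀ i, v i ∈ Icc (0 : ℝ) 1) (h : field (weightedRate b v) 1 = 0) : v = 1 := by
  have hs := (hb.isSubRates_weighted hN1 hv).summable
  simp only [field, one_pow, mul_one] at h
  have h1 : HasSum (fun j => b j - weightedRate b v j) 0 := by
    have := hb.hasSum_zero.sub (h ▸ hs.hasSum)
    rwa [sub_zero] at this
  have h2 : ∀ j, 0 ≤ b j - weightedRate b v j := fun j => by
    unfold weightedRate; split_ifs with hj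
    · exact sub_nonneg.2 (mul_le_of_le_one_right (hNb j hj).le (hv _).2)
    · exact (sub_self _).ge
  ext ⟨j, hj⟩
  have h3 := congr_fun ((hasSum_zero_iff_of_nonneg h2).1 h1) j
  simp only [weightedRate, hj, dif_pos, Pi.zero_apply] at h3
  have h4 := (hNb j hj).ne'
  have h5 : b j * (1 - v ⟨j, hj⟩) = 0 := by linarith
  have := (mul_eq_zero.1 h5).resolve_left h4
  simp only [Pi.one_apply]; linarith

variable {Ω : Type*} [MeasurableSpace Ω] {P : Measure Ω} {p : ℝ → ℕ → ℕ → ℝ} {X : ℝ → Ω → ℕ}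

/-- The joint generating function `E[u ^ X(t) v ^ Y(t)]`, as a power series in `u`. -/
noncomputable def jointPgf (P : Measure Ω) (X : ℝ → Ω → ℕ) (v : N → ℝ) (u t : ℝ) : ℝ :=
  field (fun j => weightedRow P X v j t) u

/-- A Markov chain started at `1` that satisfies the forward equations of the branching rates `b`
and whose paths are almost surely regular, with its transition function as a parameter. -/
structure IsRegularChain (P : Measure Ω) (b : ℕ → ℝ) (X : ℝ → Ω → ℕ)
    (p : ℝ → ℕ → ℕ → ℝ) : Prop extends IsChain P 1 X p where
  rates : IsBranchingRates b
  forward : SatisfiesForwardEquation b p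
  regular : ∀ᵐ ω ∂P, IsRegularPath fun t => X t ω

namespace IsRegularChain

variable [IsProbabilityMeasure P]

theorem weightedRow_initial (hX : IsRegularChain P b X p) (v : N → ℝ) (j : ℕ) :
    weightedRow P X v j 0 = if j = 1 then 1 else 0 := by
  simp only [weightedRow, pathWeight_zero]
  rw [setIntegral_const, smul_eq_mul, mul_one, hX.toIsChain.real_eq le_rfl, hX.transition.zero]
  simp only [eq_comm]

theorem summable_weightedRow (hX : IsRegularChain P b X p) (hv : ∀ i, v i ∈ Icc (0 : ℝ) 1)
    {t : ℝ} (ht : 0 ≤ t) : Summable fun j => weightedRow P X v j t :=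
  Summable.of_nonneg_of_le (fun j => (hX.weightedRow_mem hv j ht).1)
    (fun j => (hX.weightedRow_mem hv j ht).2) (hX.transition.hasSum_one t ht 1).summable

theorem jointPgf_mem (hX : IsRegularChain P b X p) (hv : ∀ i, v i ∈ Icc (0 : ℝ) 1)
    {t u : ℝ} (ht : 0 ≤ t) (hu : u ∈ Icc (0 : ℝ) 1) : jointPgf P X v u t ∈ Icc (0 : ℝ) 1 := by
  refine ⟨tsum_nonneg fun j => mul_nonneg (hX.weightedRow_mem hv j ht).1 (pow_nonneg hu.1 j), ?_⟩
  rw [← (hX.transition.hasSum_one t ht 1).tsum_eq]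
  refine (summable_mul_pow (hX.summable_weightedRow hv ht) hu).tsum_le_tsum (fun j => ?_)
    (hX.transition.hasSum_one t ht 1).summable
  exact (mul_le_of_le_one_right (hX.weightedRow_mem hv j ht).1 (pow_le_one₀ hu.1 hu.2)).trans
    (hX.weightedRow_mem hv j ht).2

theorem jointPgf_initial (hX : IsRegularChain P b X p) (v : N → ℝ) (u : ℝ) :
    jointPgf P X v u 0 = u := by
  simp [jointPgf, field, hX.weightedRow_initial]

theorem jointPgf_one (hX : IsRegularChain P b X p) (hN1 : 1 ∉ N)
    (hv : ∀ i, v i ∈ Icc (0 : ℝ) 1) {t : ℝ} (ht : 0 ≤ t) :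
    jointPgf P X v 1 t = ∫ ω, pathWeight v (fun s => X s ω) t ∂P := by
  have hU : ⋃ j, {ω | X t ω = j} = univ := eq_univ_of_forall fun ω => mem_iUnion.2 ⟨X t ω, rfl⟩
  have h := hasSum_integral_iUnion (μ := P) (s := fun j : ℕ => {ω | X t ω = j})
    (f := fun ω => pathWeight v (fun s => X s ω) t)
    (fun j => hX.measurableSet_eq ht j)
    (fun i j hij => Set.disjoint_left.2 fun ω h1 h2 => hij (h1.symm.trans h2))
    (IsChain.integrable_pathWeight hX.toIsChain hX.regular hN1 hv ht).integrableOn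
  rw [hU, setIntegral_univ] at h
  simp only [jointPgf, field, one_pow, mul_one]
  exact h.tsum_eq

/-- By the method of characteristics, every solution that starts below `1` is the joint generating
function; in particular it is unique. -/
theorem solution_eq_jointPgf (hX : IsRegularChain P b X p) (hN1 : 1 ∉ N)
    (hv : ∀ i, v i ∈ Icc (0 : ℝ) 1) {t : ℝ} (ht : 0 ≤ t) {y : ℝ → ℝ}
    (hy : ∀ s ∈ Icc 0 t, y s ∈ Icc (0 : ℝ) 1) (hy0 : y 0 < 1)
    (hyd : ∀ s ∈ Icc 0 t, HasDerivWithinAt y (field (weightedRate b v) (y s)) (Icc 0 t) s) :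
    y t = jointPgf P X v (y 0) t := by
  have hc := hX.rates.isSubRates_weighted hN1 hv
  have hβ := hc.beta_nonneg
  have hle := hc.solution_le hy hyd
  set ρ := 1 - (1 - y 0) * Real.exp (-(-b 1 * t)) with hρ
  have hρ1 : ρ < 1 := by
    have := mul_pos (sub_pos.2 hy0) (Real.exp_pos (-(-b 1 * t))); linarith
  have hyρ : ∀ s ∈ Icc 0 t, y s ∈ Icc 0 ρ := fun s hs => by
    refine ⟨(hy s hs).1, (hle s hs).trans ?_⟩
    have h2 : Real.exp (-(-b 1 * t)) ≤ Real.exp (-(-b 1 * s)) :=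
      Real.exp_le_exp.2 (neg_le_neg (mul_le_mul_of_nonneg_left hs.2 hβ))
    have := sub_pos.2 hy0
    rw [hρ]
    gcongr
  have key := tsum_transport hc.summable (a := weightedRow P X v) (C := 1) ht
    (fun j s hs => ?_)
    (fun j => (hX.continuousOn_weightedRow hX.rates hX.forward hX.regular hN1 hv j).mono
      Icc_subset_Ici_self)
    (fun j s hs => hX.hasDerivWithinAt_weightedRow hX.rates hX.forward hX.regular hN1 hv j hs.1)
    hρ1 hyρ hyd
  · rw [jointPgf, field, key, tsum_eq_single 1]
    · simp [hX.weightedRow_initial]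
    · intro j hj; simp [hX.weightedRow_initial, hj]
  · have := hX.weightedRow_mem hv j hs.1
    rw [abs_of_nonneg this.1]
    exact this.2.trans (hX.transition.le_one hs.1 1 j)

theorem hasDerivWithinAt_jointPgf_of_lt_one (hX : IsRegularChain P b X p) (hN1 : 1 ∉ N)
    (hv : ∀ i, v i ∈ Icc (0 : ℝ) 1) {u t : ℝ} (hu : 0 ≤ u) (hu1 : u < 1) (ht : 0 ≤ t) :
    HasDerivWithinAt (jointPgf P X v u) (field (weightedRate b v) (jointPgf P X v u t))
      (Ici 0) t := by
  have hc := hX.rates.isSubRates_weighted hN1 hv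
  obtain ⟨y, hy0, hy, hyd⟩ := hc.exists_solution hu hu1 (add_nonneg ht zero_le_one)
  have hρ : 1 - (1 - u) * Real.exp (-(-b 1 * (t + 1))) ≤ 1 := by
    have := mul_pos (sub_pos.2 hu1) (Real.exp_pos (-(-b 1 * (t + 1)))); linarith
  have heq : ∀ s ∈ Icc 0 (t + 1), jointPgf P X v u s = y s := fun s hs => by
    have hsub : Icc 0 s ⊆ Icc 0 (t + 1) := Icc_subset_Icc_right hs.2
    rw [hX.solution_eq_jointPgf hN1 hv hs.1
      (fun r hr => ⟨(hy r (hsub hr)).1, (hy r (hsub hr)).2.trans hρ⟩) (by rw [hy0]; exact hu1)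
      (fun r hr => (hyd r (hsub hr)).mono hsub), hy0]
  have htm : t ∈ Icc 0 (t + 1) := ⟨ht, by linarith⟩
  have h1 : HasDerivWithinAt (jointPgf P X v u) (field (weightedRate b v) (jointPgf P X v u t))
      (Icc 0 (t + 1)) t := by
    rw [heq t htm]
    exact (hyd t htm).congr heq (heq t htm)
  refine h1.mono_of_mem_nhdsWithin ?_
  rw [← Ici_inter_Iic]
  exact inter_mem self_mem_nhdsWithin (mem_nhdsWithin_of_mem_nhds (Iic_mem_nhds (by linarith)))

theorem continuousOn_jointPgf (hX : IsRegularChain P b X p)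
    (hv : ∀ i, v i ∈ Icc (0 : ℝ) 1) {t : ℝ} (ht : 0 ≤ t) :
    ContinuousOn (fun u => jointPgf P X v u t) (Icc 0 1) :=
  continuousOn_field (hX.summable_weightedRow hv ht)

theorem abs_jointPgf_sub_le (hX : IsRegularChain P b X p) (hN1 : 1 ∉ N)
    (hv : ∀ i, v i ∈ Icc (0 : ℝ) 1) {u s t : ℝ} (hu : u ∈ Icc (0 : ℝ) 1) (hs : 0 ≤ s)
    (ht : 0 ≤ t) : |jointPgf P X v u t - jointPgf P X v u s| ≤ -b 1 * |t - s| := by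
  have hc := hX.rates.isSubRates_weighted hN1 hv
  have key : ∀ u, 0 ≤ u → u < 1 →
      |jointPgf P X v u t - jointPgf P X v u s| ≤ -b 1 * |t - s| := fun u hu hu1 => by
    have := Convex.norm_image_sub_le_of_norm_hasDerivWithin_le (f := jointPgf P X v u)
      (s := Ici 0) (C := -b 1) (x := s) (y := t)
      (fun r hr => hX.hasDerivWithinAt_jointPgf_of_lt_one hN1 hv hu hu1 hr)
      (fun r hr => hc.abs_field_le (hX.jointPgf_mem hv hr ⟨hu, hu1.le⟩)) (convex_Ici 0) hs ht
    simpa using this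
  rcases hu.2.lt_or_eq with hu1 | rfl
  · exact key u hu.1 hu1
  · obtain ⟨w, hw, hlim⟩ := exists_seq_tendsto_one
    have h1 := ((hX.continuousOn_jointPgf hv ht 1 hu).tendsto.comp hlim).sub
      ((hX.continuousOn_jointPgf hv hs 1 hu).tendsto.comp hlim)
    exact le_of_tendsto h1.abs (Eventually.of_forall fun n => key _ (hw n).1 (hw n).2)

theorem continuousOn_jointPgf_time (hX : IsRegularChain P b X p) (hN1 : 1 ∉ N)
    (hv : ∀ i, v i ∈ Icc (0 : ℝ) 1) {u : ℝ} (hu : u ∈ Icc (0 : ℝ) 1) :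
    ContinuousOn (jointPgf P X v u) (Ici 0) := by
  refine LipschitzOnWith.continuousOn (K := (-b 1).toNNReal)
    (LipschitzOnWith.of_dist_le_mul fun s hs t ht => ?_)
  rw [Real.dist_eq, Real.dist_eq, Real.coe_toNNReal _ hX.rates.pos.le]
  exact hX.abs_jointPgf_sub_le hN1 hv hu ht hs

theorem continuousOn_field_jointPgf (hX : IsRegularChain P b X p) (hN1 : 1 ∉ N)
    (hv : ∀ i, v i ∈ Icc (0 : ℝ) 1) {u : ℝ} (hu : u ∈ Icc (0 : ℝ) 1) :
    ContinuousOn (fun s => field (weightedRate b v) (jointPgf P X v u s)) (Ici 0) :=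
  (continuousOn_field (hX.rates.isSubRates_weighted hN1 hv).summable).comp
    (hX.continuousOn_jointPgf_time hN1 hv hu) fun _ hs => hX.jointPgf_mem hv hs hu

/-- The integral form of the differential equation passes to the limit `u → 1`. -/
theorem jointPgf_eq_integral (hX : IsRegularChain P b X p) (hN1 : 1 ∉ N)
    (hv : ∀ i, v i ∈ Icc (0 : ℝ) 1) {u t : ℝ} (hu : u ∈ Icc (0 : ℝ) 1) (ht : 0 ≤ t) :
    jointPgf P X v u t =
      u + ∫ s in (0 : ℝ)..t, field (weightedRate b v) (jointPgf P X v u s) := by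
  have hc := hX.rates.isSubRates_weighted hN1 hv
  have key : ∀ u, 0 ≤ u → u < 1 → jointPgf P X v u t =
      u + ∫ s in (0 : ℝ)..t, field (weightedRate b v) (jointPgf P X v u s) := fun u hu hu1 => by
    rw [integral_eq_sub_of_hasDerivWithinAt_Ici
      (hX.continuousOn_field_jointPgf hN1 hv ⟨hu, hu1.le⟩)
      (fun s hs => hX.hasDerivWithinAt_jointPgf_of_lt_one hN1 hv hu hu1 hs) ht,
      hX.jointPgf_initial]
    ring
  rcases hu.2.lt_or_eq with hu1 | rfl
  · exact key u hu.1 hu1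
  obtain ⟨w, hw, hlim⟩ := exists_seq_tendsto_one
  have h1 := (hX.continuousOn_jointPgf hv ht 1 hu).tendsto.comp hlim
  have h2 : Tendsto (fun n => ∫ s in (0 : ℝ)..t, field (weightedRate b v) (jointPgf P X v (w n) s))
      atTop (𝓝 (∫ s in (0 : ℝ)..t, field (weightedRate b v) (jointPgf P X v 1 s))) := by
    refine intervalIntegral.tendsto_integral_filter_of_dominated_convergence (fun _ => -b 1)
      (Eventually.of_forall fun n => ?_) (Eventually.of_forall fun n => ?_)
      intervalIntegrable_const ?_
    · refine ((hX.continuousOn_field_jointPgf hN1 hv ⟨(hw n).1, (hw n).2.le⟩).mono ?_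
        ).aestronglyMeasurable measurableSet_uIoc
      rw [uIoc_of_le ht]; exact fun s hs => hs.1.le
    · refine Eventually.of_forall fun s hs => ?_
      rw [uIoc_of_le ht] at hs
      exact hc.abs_field_le (hX.jointPgf_mem hv hs.1.le ⟨(hw n).1, (hw n).2.le⟩)
    · refine Eventually.of_forall fun s hs => ?_
      rw [uIoc_of_le ht] at hs
      have h3 := (hX.continuousOn_jointPgf hv hs.1.le 1 hu).tendsto.comp hlim
      refine (continuousOn_field hc.summable _ (hX.jointPgf_mem hv hs.1.le hu)).tendsto.comp
        (tendsto_nhdsWithin_iff.2 ⟨h3, Eventually.of_forall fun n => ?_⟩)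
      exact hX.jointPgf_mem hv hs.1.le ⟨(hw n).1, (hw n).2.le⟩
  refine tendsto_nhds_unique h1 (((hlim.mono_right nhdsWithin_le_nhds).add h2).congr fun n => ?_)
  exact (key _ (hw n).1 (hw n).2).symm

theorem hasDerivWithinAt_jointPgf (hX : IsRegularChain P b X p) (hN1 : 1 ∉ N)
    (hv : ∀ i, v i ∈ Icc (0 : ℝ) 1) {u t : ℝ} (hu : u ∈ Icc (0 : ℝ) 1) (ht : 0 ≤ t) :
    HasDerivWithinAt (jointPgf P X v u) (field (weightedRate b v) (jointPgf P X v u t))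
      (Ici 0) t :=
  ((hasDerivWithinAt_integral_Ici (hX.continuousOn_field_jointPgf hN1 hv hu) ht).const_add
    u).congr (fun _ hs => hX.jointPgf_eq_integral hN1 hv hu hs)
    (hX.jointPgf_eq_integral hN1 hv hu ht)

theorem isSolution_jointPgf (hX : IsRegularChain P b X p) (hN1 : 1 ∉ N)
    (hv : ∀ i, v i ∈ Icc (0 : ℝ) 1) {u : ℝ} (hu : u ∈ Icc (0 : ℝ) 1) :
    IsSolution b N u v (jointPgf P X v u) := by
  refine ⟨fun t ht => hX.jointPgf_mem hv ht hu, hX.jointPgf_initial v u, fun t ht => ?_⟩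
  rw [BN_add_BbarN hX.rates N v (hX.jointPgf_mem hv ht hu)]
  exact hX.hasDerivWithinAt_jointPgf hN1 hv hu ht

/-! ### Uniqueness of the solution -/

theorem solution_restart (hX : IsRegularChain P b X p) (hN1 : 1 ∉ N)
    (hv : ∀ i, v i ∈ Icc (0 : ℝ) 1) {u : ℝ} {y : ℝ → ℝ} (hy : IsSolution b N u v y) {s t : ℝ}
    (hs : 0 ≤ s) (ht : 0 ≤ t) (h : y s < 1) : y (s + t) = jointPgf P X v (y s) t := by
  have hmaps : MapsTo (fun r => s + r) (Icc 0 t) (Ici 0) := fun r hr => add_nonneg hs hr.1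
  have := hX.solution_eq_jointPgf hN1 hv ht (y := fun r => y (s + r))
    (fun r hr => hy.mem_Icc _ (hmaps hr)) (by simpa using h) fun r hr => ?_
  · simpa using this
  · have h1 := hy.hasDeriv (s + r) (hmaps hr)
    rw [BN_add_BbarN hX.rates N v (hy.mem_Icc _ (hmaps hr))] at h1
    have h2 : HasDerivWithinAt (fun r : ℝ => s + r) 1 (Icc 0 t) r :=
      (hasDerivWithinAt_id r _).const_add s
    have h3 := HasDerivWithinAt.comp r (h := fun r : ℝ => s + r) (h₂ := y) h1 h2 hmaps
    simpa [Function.comp_def] using h3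

/-- A solution that leaves `1` at the time `τ` equals `G(t, 1, v)` afterwards: it is restarted at
times `r ↓ τ` at which it is below `1`, where `solution_restart` applies. -/
theorem solution_from_one (hX : IsRegularChain P b X p) (hN1 : 1 ∉ N)
    (hv : ∀ i, v i ∈ Icc (0 : ℝ) 1) {u : ℝ} {y : ℝ → ℝ} (hy : IsSolution b N u v y) {τ : ℝ}
    (hτ : 0 ≤ τ) (h1 : y τ = 1) (hfr : ∃ᶠ r in 𝓝[>] τ, y r < 1) {t : ℝ} (ht : 0 ≤ t) :
    y (τ + t) = jointPgf P X v 1 t := by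
  have hyc : ContinuousOn y (Ici 0) := fun s hs => (hy.hasDeriv s hs).continuousWithinAt
  have hsub : 𝓝[>] τ ≤ 𝓝[Ici 0] τ := nhdsWithin_mono _ fun r hr => hτ.trans (le_of_lt hr)
  have hl : Tendsto (fun r => y (r + t)) (𝓝[>] τ) (𝓝 (y (τ + t))) := by
    refine (hyc (τ + t) (add_nonneg hτ ht)).tendsto.comp (tendsto_nhdsWithin_iff.2 ⟨?_, ?_⟩)
    · exact ((continuous_add_const t).tendsto τ).mono_left nhdsWithin_le_nhds
    · filter_upwards [self_mem_nhdsWithin] with r hr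
      exact add_nonneg (hτ.trans (le_of_lt hr)) ht
  have hr : Tendsto (fun r => jointPgf P X v (y r) t) (𝓝[>] τ) (𝓝 (jointPgf P X v 1 t)) := by
    refine (hX.continuousOn_jointPgf hv ht 1 ⟨zero_le_one, le_rfl⟩).tendsto.comp
      (tendsto_nhdsWithin_iff.2 ⟨?_, ?_⟩)
    · rw [← h1]; exact (hyc τ hτ).tendsto.mono_left hsub
    · filter_upwards [self_mem_nhdsWithin] with r hr
      exact hy.mem_Icc r (hτ.trans (le_of_lt hr))
  refine tendsto_nhds_unique_of_frequently_eq hl hr ?_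
  refine (hfr.and_eventually self_mem_nhdsWithin).mono fun r hr => ?_
  exact hX.solution_restart hN1 hv hy (hτ.trans (le_of_lt hr.2)) ht hr.1

theorem jointPgf_one_one (hX : IsRegularChain P b X p) (hN1 : 1 ∉ N) {t : ℝ} (ht : 0 ≤ t) :
    jointPgf P X (1 : N → ℝ) 1 t = 1 := by
  rw [hX.jointPgf_one (v := 1) hN1 (fun _ => ⟨zero_le_one, le_rfl⟩) ht]
  simp [pathWeight]

/-- Uniqueness of the solution. The field need not be Lipschitz at `1`. A solution starting at `1`
leaves `1` at once unless all weights are `1`; in that case a solution that leaves `1` later would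
have to agree with `jointPgf P X 1 1 = 1`. -/
theorem eq_jointPgf_of_isSolution (hX : IsRegularChain P b X p) (hN1 : 1 ∉ N)
    (hNb : ∀ k ∈ N, 0 < b k) (hv : ∀ i, v i ∈ Icc (0 : ℝ) 1) {u : ℝ} (hu : u ∈ Icc (0 : ℝ) 1)
    {y : ℝ → ℝ} (hy : IsSolution b N u v y) {t : ℝ} (ht : 0 ≤ t) : y t = jointPgf P X v u t := by
  rcases hu.2.lt_or_eq with hu1 | rfl
  · have := hX.solution_restart hN1 hv hy le_rfl ht (by rw [hy.initial]; exact hu1)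
    rwa [zero_add, hy.initial] at this
  by_cases hfr : ∃ᶠ r in 𝓝[>] (0 : ℝ), y r < 1
  · have := hX.solution_from_one hN1 hv hy le_rfl hy.initial hfr ht
    rwa [zero_add] at this
  -- `y` stays at `1` for a while, so the field vanishes at `1` and all weights are `1`
  rw [not_frequently] at hfr
  have hv1 : v = 1 := by
    refine eq_one_of_field_one hX.rates hN1 hNb hv ?_
    have h1 := (hy.hasDeriv 0 le_rfl).mono Ioi_subset_Ici_self
    rw [BN_add_BbarN hX.rates N v (hy.mem_Icc 0 le_rfl), hy.initial] at h1
    have h2 : HasDerivWithinAt y 0 (Ioi 0) 0 := by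
      refine (hasDerivWithinAt_const (0 : ℝ) (Ioi 0) (1 : ℝ)).congr_of_eventuallyEq ?_ hy.initial
      filter_upwards [hfr, self_mem_nhdsWithin] with r hr hr0
      exact le_antisymm (hy.mem_Icc r (le_of_lt hr0)).2 (not_lt.1 hr)
    exact (uniqueDiffWithinAt_Ioi (0 : ℝ)).eq_deriv _ h1 h2
  subst hv1
  rw [hX.jointPgf_one_one hN1 ht]
  by_contra hne
  have hyc : ContinuousOn y (Icc 0 t) := fun s hs =>
    ((hy.hasDeriv s hs.1).mono Icc_subset_Ici_self).continuousWithinAt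
  have hK : IsCompact (Icc 0 t ∩ y ⁻¹' {1}) :=
    isCompact_Icc.of_isClosed_subset
      (hyc.preimage_isClosed_of_isClosed isClosed_Icc isClosed_singleton) inter_subset_left
  -- `τ` is the last time in `[0, t]` at which `y` equals `1`
  obtain ⟨τ, ⟨hτ, hτ1⟩, hmax⟩ := hK.exists_isGreatest ⟨0, ⟨le_rfl, ht⟩, hy.initial⟩
  have hτt : τ < t := hτ.2.lt_of_ne fun h => hne (h ▸ hτ1)
  have hfr2 : ∃ᶠ r in 𝓝[>] τ, y r < 1 := by
    refine Eventually.frequently ?_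
    filter_upwards [Ioo_mem_nhdsGT hτt] with r hr
    refine (hy.mem_Icc r (hτ.1.trans hr.1.le)).2.lt_of_ne fun h => ?_
    exact hr.1.not_ge (hmax ⟨⟨hτ.1.trans hr.1.le, hr.2.le⟩, h⟩)
  have := hX.solution_from_one hN1 hv hy hτ.1 hτ1 hfr2 (sub_nonneg.2 hτt.le)
  rw [hX.jointPgf_one_one hN1 (sub_nonneg.2 hτt.le), add_sub_cancel] at this
  exact hne this

theorem exp_le_weightedRow_one (hX : IsRegularChain P b X p) (hN1 : 1 ∉ N)
    (hv : ∀ i, v i ∈ Icc (0 : ℝ) 1) {t : ℝ} (ht : 0 ≤ t) :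
    Real.exp (-((1 : ℕ) * -b 1 * t)) ≤ weightedRow P X v 1 t := by
  have h1 := (abs_le.1 (hX.abs_setIntegral_diag_le hX.rates hX.forward hX.regular hN1 hv le_rfl
    ht 1)).1
  have h2 := (hX.sub_sum_setIntegral_mem hX.regular hN1 hv le_rfl ht 1 {1}).1
  rw [Finset.sum_singleton] at h2
  rw [hX.weightedRow_initial, if_pos rfl, hX.transition.zero, if_pos rfl] at h1
  rw [zero_add] at h1 h2
  linarith

/-- If `z = G(t, 1, v) < 1` were a zero of the field, then `z` would be a stationary solution, so
`G(t, z, v) = z = G(t, 1, v)`; but `G(t, ·, v)` is strictly increasing. -/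
theorem field_jointPgf_one_ne_zero (hX : IsRegularChain P b X p) (hN1 : 1 ∉ N)
    (hNb : ∀ k ∈ N, 0 < b k) (hv : ∀ i, v i ∈ Icc (0 : ℝ) 1) (hv1 : v ≠ 1) {t : ℝ} (ht : 0 ≤ t) :
    field (weightedRate b v) (jointPgf P X v 1 t) ≠ 0 := by
  intro h
  have hmem := hX.jointPgf_mem hv ht (u := 1) ⟨zero_le_one, le_rfl⟩
  rcases hmem.2.lt_or_eq with hlt | heq
  · set z := jointPgf P X v 1 t with hz
    have h1 := hX.solution_eq_jointPgf hN1 hv ht (y := fun _ => z) (fun _ _ => hmem) hlt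
      fun s _ => by rw [h]; exact hasDerivWithinAt_const _ _ _
    have h2 : jointPgf P X v z t < jointPgf P X v 1 t := by
      have hs := hX.summable_weightedRow hv ht
      refine (summable_mul_pow hs hmem).tsum_lt_tsum (i := 1) (fun j => ?_) ?_
        (summable_mul_pow hs ⟨zero_le_one, le_rfl⟩)
      · have := (hX.weightedRow_mem hv j ht).1
        rw [one_pow]
        gcongr
        exact pow_le_one₀ hmem.1 hmem.2
      · have := (Real.exp_pos _).trans_le (hX.exp_le_weightedRow_one hN1 hv ht)
        simp only [pow_one, mul_one]
        exact mul_lt_of_lt_one_right this hlt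
    rw [← hz] at h2
    exact h2.ne h1.symm
  · rw [heq] at h
    exact hv1 (eq_one_of_field_one hX.rates hN1 hNb hv h)

end IsRegularChain

end BranchingCrossing

namespace BranchingCrossing

/-! ### Power series in several variables -/

/-- The `n`-th power of a convergent series of nonnegative terms, expanded over `n`-tuples. -/
theorem hasSum_prod_pow {α : Type*} {a : α → ℝ} {S : ℝ} (ha : ∀ k, 0 ≤ a k) (hS : HasSum a S)
    (n : ℕ) : HasSum (fun κ : Fin n → α => ∏ m, a (κ m)) (S ^ n) := by
  induction n with
  | zero => simp
  | succ n ih =>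
    have ha' : 0 ≤ a := ha
    have hnn : 0 ≤ fun κ : Fin n → α => ∏ m, a (κ m) := fun κ =>
      Finset.prod_nonneg fun m _ => ha _
    generalize hG : (fun κ : Fin n → α => ∏ m, a (κ m)) = G at ih hnn
    have h1 := hS.mul ih (hS.summable.mul_of_nonneg ih.summable ha' hnn)
    rw [← (Fin.consEquiv fun _ : Fin (n + 1) => α).hasSum_iff, pow_succ']
    have h2 : (fun κ : Fin (n + 1) → α => ∏ m, a (κ m)) ∘ Fin.consEquiv (fun _ => α) =
        fun x => a x.1 * G x.2 := by
      funext x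
      simp [← hG, Fin.consEquiv, Fin.prod_univ_succ]
    rwa [h2]

variable {ι : Type*} [Fintype ι]

/-- The monomial `v ^ k = ∏ᵢ vᵢ ^ kᵢ`. -/
def vpow (v : ι → ℝ) (k : ι → ℕ) : ℝ := ∏ i, v i ^ k i

theorem vpow_add (v : ι → ℝ) (k l : ι → ℕ) : vpow v (k + l) = vpow v k * vpow v l := by
  simp only [vpow, Pi.add_apply, pow_add, Finset.prod_mul_distrib]

theorem vpow_sum (v : ι → ℝ) {n : ℕ} (κ : Fin n → ι → ℕ) :
    vpow v (∑ m, κ m) = ∏ m, vpow v (κ m) := by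
  simp only [vpow, Finset.sum_apply, ← Finset.prod_pow_eq_pow_sum]
  exact Finset.prod_comm

theorem vpow_mem {v : ι → ℝ} (hv : ∀ i, v i ∈ Icc (0 : ℝ) 1) (k : ι → ℕ) :
    vpow v k ∈ Icc (0 : ℝ) 1 :=
  ⟨Finset.prod_nonneg fun i _ => pow_nonneg (hv i).1 _,
    Finset.prod_le_one (fun i _ => pow_nonneg (hv i).1 _) fun i _ => pow_le_one₀ (hv i).1 (hv i).2⟩

theorem vpow_one (k : ι → ℕ) : vpow (1 : ι → ℝ) k = 1 := by simp [vpow]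

theorem vpow_single [DecidableEq ι] (v : ι → ℝ) (i : ι) : vpow v (Pi.single i 1) = v i := by
  rw [vpow, Finset.prod_eq_single i]
  · simp
  · intro j _ hj; simp [hj]
  · simp

theorem vpow_zero (k : ι → ℕ) : vpow (0 : ι → ℝ) k = if k = 0 then 1 else 0 := by
  split_ifs with h
  · simp [h, vpow]
  · obtain ⟨i, hi⟩ := Function.ne_iff.1 h
    exact Finset.prod_eq_zero (Finset.mem_univ i) (by simp at hi; simp [hi])

/-- The coefficients of a power series that converges on the unit cube are determined by its
values there. By induction on the degree `d`, the homogeneous part of degree `d` vanishes on the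
cube: it is the limit of `s ^ (-d)` times the series at `s * w` as `s ↓ 0`. -/
theorem eq_zero_of_hasSum_vpow [DecidableEq ι] {a : (ι → ℕ) → ℝ}
    (h : ∀ v : ι → ℝ, (∀ i, v i ∈ Icc (0 : ℝ) 1) → HasSum (fun k => a k * vpow v k) 0)
    (k : ι → ℕ) : a k = 0 := by
  have habs : Summable fun k => |a k| := by
    have := (h 1 fun _ => ⟨zero_le_one, le_rfl⟩).summable
    simp only [vpow_one, mul_one] at this
    exact this.abs
  have key : ∀ d : ℕ, ∀ k : ι → ℕ, ∑ i, k i = d → a k = 0 := by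
    intro d
    induction d using Nat.strong_induction_on with
    | _ d ih =>
    have hpoly : ∀ w : ι → ℝ, (∀ i, w i ∈ Icc (0 : ℝ) 1) →
        ∑ k ∈ Finset.piAntidiag Finset.univ d, a k * vpow w k = 0 := by
      intro w hw
      let T : ℝ → (ι → ℕ) → ℝ := fun s k => a k * vpow w k * s ^ (∑ i, k i - d)
      have hT0 : ∀ s ∈ Ioo (0 : ℝ) 1, ∑' k, T s k = 0 := by
        intro s hs
        have h1 := h (fun i => s * w i) fun i => ⟨mul_nonneg hs.1.le (hw i).1,
          mul_le_one₀ hs.2.le (hw i).1 (hw i).2⟩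
        have h2 : ∀ k, a k * vpow (fun i => s * w i) k = s ^ d * T s k := by
          intro k
          have h3 : vpow (fun i => s * w i) k = s ^ (∑ i, k i) * vpow w k := by
            simp only [vpow, mul_pow, Finset.prod_mul_distrib, Finset.prod_pow_eq_pow_sum]
          rcases lt_or_ge (∑ i, k i) d with hlt | hge
          · simp [T, ih _ hlt k rfl]
          · rw [h3]
            conv_lhs => rw [← Nat.add_sub_cancel' hge, pow_add]
            simp only [T]; ring
        rw [funext h2] at h1
        have h4 := h1.tsum_eq
        rw [tsum_mul_left] at h4
        exact (mul_eq_zero.1 h4).resolve_left (pow_pos hs.1 d).ne'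
      have hlim : Tendsto (fun s => ∑' k, T s k) (𝓝[>] 0)
          (𝓝 (∑' k, if ∑ i, k i = d then a k * vpow w k else 0)) := by
        refine tendsto_tsum_of_dominated_convergence habs (fun k => ?_) ?_
        · rcases lt_trichotomy (∑ i, k i) d with hlt | heq | hgt
          · simp [T, ih _ hlt k rfl]
          · simp [T, heq]
          · rw [if_neg hgt.ne']
            have h1 : Tendsto (fun s : ℝ => s ^ (∑ i, k i - d)) (𝓝[>] 0) (𝓝 0) := by
              have := ((continuous_pow (M := ℝ) (∑ i, k i - d)).tendsto 0).mono_left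
                (nhdsWithin_le_nhds (s := Ioi 0))
              rwa [zero_pow (by omega)] at this
            simpa using h1.const_mul (a k * vpow w k)
        · filter_upwards [Ioo_mem_nhdsGT (zero_lt_one (α := ℝ))] with s hs k
          have h1 := vpow_mem hw k
          simp only [T, norm_mul, norm_pow]
          rw [Real.norm_of_nonneg h1.1, Real.norm_of_nonneg hs.1.le, mul_assoc, Real.norm_eq_abs]
          exact mul_le_of_le_one_right (abs_nonneg _) (mul_le_one₀ h1.2 (pow_nonneg hs.1.le _)
            (pow_le_one₀ hs.1.le hs.2.le))
      have hz : (∑' k : ι → ℕ, if ∑ i, k i = d then a k * vpow w k else 0) = 0 := by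
        refine tendsto_nhds_unique hlim (tendsto_const_nhds.congr' ?_)
        filter_upwards [Ioo_mem_nhdsGT (zero_lt_one (α := ℝ))] with s hs
        exact (hT0 s hs).symm
      rw [tsum_eq_sum (s := Finset.piAntidiag Finset.univ d)] at hz
      · rw [← hz]
        refine Finset.sum_congr rfl fun k hk => ?_
        rw [if_pos (Finset.mem_piAntidiag.1 hk).1]
      · intro k hk
        rw [if_neg]
        intro hkd
        exact hk (Finset.mem_piAntidiag.2 ⟨hkd, fun _ _ => Finset.mem_univ _⟩)
    intro k hk
    let q : MvPolynomial ι ℝ := ∑ k ∈ Finset.piAntidiag Finset.univ d,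
      MvPolynomial.monomial (Finsupp.equivFunOnFinite.symm k) (a k)
    have hq : q = 0 := by
      refine MvPolynomial.funext_set (fun _ => Icc (0 : ℝ) 1)
        (fun _ => Icc_infinite zero_lt_one) fun w hw => ?_
      rw [map_zero, map_sum, ← hpoly w fun i => hw i (mem_univ i)]
      refine Finset.sum_congr rfl fun k _ => ?_
      rw [MvPolynomial.eval_monomial, Finsupp.prod_fintype _ _ fun i => pow_zero _]
      rfl
    have hc := congr_arg (MvPolynomial.coeff (Finsupp.equivFunOnFinite.symm k)) hq
    rw [MvPolynomial.coeff_zero, MvPolynomial.coeff_sum, Finset.sum_eq_single k] at hc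
    · simpa using hc
    · intro l _ hl
      rw [MvPolynomial.coeff_monomial, if_neg]
      exact fun he => hl (Finsupp.equivFunOnFinite.symm.injective he)
    · intro hk'
      exact absurd (Finset.mem_piAntidiag.2 ⟨hk, fun _ _ => Finset.mem_univ _⟩) hk'
  exact key _ k rfl

variable [DecidableEq ι] {g : (ι → ℕ) → ℝ}

theorem hasSum_convPow (hg : ∀ k, 0 ≤ g k) {v : ι → ℝ} (hv : ∀ i, v i ∈ Icc (0 : ℝ) 1) {Γ : ℝ}
    (hΓ : HasSum (fun k => g k * vpow v k) Γ) (n : ℕ) :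
    HasSum (fun l => convPow g n l * vpow v l) (Γ ^ n) := by
  have h1 := hasSum_prod_pow (fun k => mul_nonneg (hg k) (vpow_mem hv k).1) hΓ n
  rw [← (Equiv.sigmaFiberEquiv fun κ : Fin n → ι → ℕ => ∑ m, κ m).hasSum_iff] at h1
  refine h1.sigma fun l => ?_
  have h2 : HasSum (({κ : Fin n → ι → ℕ | ∑ m, κ m = l}).indicator
      fun κ => ∏ m, (g (κ m) * vpow v (κ m))) (convPow g n l * vpow v l) := by
    have h3 : convPow g n l * vpow v l = ∑ κ ∈ decompositions n l,
        ({κ : Fin n → ι → ℕ | ∑ m, κ m = l}).indicator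
          (fun κ => ∏ m, (g (κ m) * vpow v (κ m))) κ := by
      rw [convPow, Finset.sum_mul]
      refine Finset.sum_congr rfl fun κ hκ => ?_
      rw [mem_decompositions] at hκ
      rw [indicator_of_mem (by exact hκ), Finset.prod_mul_distrib, ← vpow_sum, hκ]
    rw [h3]
    refine hasSum_sum_of_ne_finset_zero fun κ hκ => indicator_of_notMem ?_ _
    rwa [mem_decompositions] at hκ
  exact (hasSum_subtype_iff_indicator).2 h2

theorem convPow_nonneg (hg : ∀ k, 0 ≤ g k) (n : ℕ) (l : ι → ℕ) : 0 ≤ convPow g n l :=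
  Finset.sum_nonneg fun _ _ => Finset.prod_nonneg fun _ _ => hg _

theorem convPow_le_one (hg : ∀ k, 0 ≤ g k) (h1 : HasSum g 1) (n : ℕ) (l : ι → ℕ) :
    convPow g n l ≤ 1 := by
  have h := hasSum_convPow hg (v := 1) (fun _ => ⟨zero_le_one, le_rfl⟩)
    (Γ := 1) (by simpa [vpow_one] using h1) n
  simp only [vpow_one, mul_one, one_pow] at h
  exact le_hasSum h l fun k _ => convPow_nonneg hg n k

theorem convPowNe_nonneg (hg : ∀ k, 0 ≤ g k) (n : ℕ) (l : ι → ℕ) : 0 ≤ convPowNe g n l :=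
  Finset.sum_nonneg fun _ _ => Finset.prod_nonneg fun _ _ => hg _

theorem convPowNe_le_convPow (hg : ∀ k, 0 ≤ g k) (n : ℕ) (l : ι → ℕ) :
    convPowNe g n l ≤ convPow g n l :=
  Finset.sum_le_sum_of_subset_of_nonneg (Finset.filter_subset _ _)
    fun _ _ _ => Finset.prod_nonneg fun _ _ => hg _

theorem convPowNe_one (g : (ι → ℕ) → ℝ) (l : ι → ℕ) : convPowNe g 1 l = 0 := by
  refine Finset.sum_eq_zero fun κ hκ => ?_
  rw [Finset.mem_filter, mem_decompositions] at hκ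
  exact absurd (by simpa using hκ.1) (hκ.2 0)

/-- The terms of the `n`-th convolution at `k ≠ 0` in which some index equals `k`: the other
indices are then `0`, and there are `n` positions for `k`. -/
theorem convPow_eq_add (g : (ι → ℕ) → ℝ) (n : ℕ) {k : ι → ℕ} (hk : k ≠ 0) :
    convPow g n k = n * g 0 ^ (n - 1) * g k + convPowNe g n k := by
  have hsplit := Finset.sum_filter_add_sum_filter_not (decompositions n k)
    (fun κ => ∀ m, κ m ≠ k) fun κ => ∏ m, g (κ m)
  rw [convPow, ← hsplit, add_comm, convPowNe]
  congr 1
  have himg : (decompositions n k).filter (fun κ => ¬ ∀ m, κ m ≠ k) =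
      Finset.univ.image fun m : Fin n => (Pi.single m k : Fin n → ι → ℕ) := by
    ext κ
    simp only [Finset.mem_filter, mem_decompositions, Finset.mem_image, Finset.mem_univ, true_and]
    constructor
    · rintro ⟨hsum, hne⟩
      push Not at hne
      obtain ⟨m, hm⟩ := hne
      refine ⟨m, ?_⟩
      rw [← Finset.add_sum_erase _ _ (Finset.mem_univ m), hm] at hsum
      have h0 : ∑ l ∈ Finset.univ.erase m, κ l = 0 := by
        rwa [add_eq_left] at hsum
      rw [Finset.sum_eq_zero_iff] at h0
      funext l
      rcases eq_or_ne l m with rfl | hl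
      · rw [Pi.single_eq_same, hm]
      · rw [Pi.single_eq_of_ne hl, h0 l (Finset.mem_erase.2 ⟨hl, Finset.mem_univ l⟩)]
    · rintro ⟨m, rfl⟩
      refine ⟨by simp, fun h => h m (by simp)⟩
  have hinj : Function.Injective fun m : Fin n => (Pi.single m k : Fin n → ι → ℕ) := by
    intro m m' h
    by_contra hne
    have := congr_fun h m
    simp only [Pi.single_eq_same, Pi.single_eq_of_ne hne] at this
    exact hk this
  rw [himg, Finset.sum_image fun m _ m' _ h => hinj h]
  have hterm : ∀ m : Fin n, ∏ l, g ((Pi.single m k : Fin n → ι → ℕ) l) = g 0 ^ (n - 1) * g k := by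
    intro m
    rw [← Finset.mul_prod_erase _ _ (Finset.mem_univ m), Pi.single_eq_same, mul_comm]
    congr 1
    rw [Finset.prod_congr rfl (g := fun _ => g 0) fun l hl => by
      rw [Pi.single_eq_of_ne (Finset.mem_erase.1 hl).1], Finset.prod_const,
      Finset.card_erase_of_mem (Finset.mem_univ m), Finset.card_univ, Fintype.card_fin]
  simp only [hterm, Finset.sum_const, Finset.card_univ, Fintype.card_fin, nsmul_eq_mul]
  ring

/-- The function `F_k` involves only indices strictly below `k`. -/
theorem recursion_congr {N : Finset ℕ} (b : ℕ → ℝ) {f f' : (N → ℕ) → ℝ} {k : N → ℕ}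
    (h : ∀ l, l < k → f l = f' l) : recF b N f k = recF b N f' k := by
  have hle : ∀ {n : ℕ} {l : N → ℕ} {κ : Fin n → N → ℕ}, κ ∈ decompositions n l → ∀ m, κ m ≤ l :=
    fun hκ m => by
      rw [mem_decompositions] at hκ
      rw [← hκ]
      exact Finset.single_le_sum (f := fun m => _) (fun i _ => zero_le) (Finset.mem_univ m)
  unfold recF
  congr 1
  · refine Finset.sum_congr rfl fun i _ => ?_
    split_ifs with hi
    · congr 1
      refine Finset.sum_congr rfl fun κ hκ => Finset.prod_congr rfl fun m _ => h _ ?_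
      refine (hle hκ m).trans_lt ?_
      refine Pi.lt_def.2 ⟨fun j => Nat.sub_le _ _, i, ?_⟩
      simp only [Pi.sub_apply, Pi.single_eq_same]; omega
    · rfl
  · refine tsum_congr fun i => ?_
    split_ifs
    · rfl
    · congr 1
      refine Finset.sum_congr rfl fun κ hκ => Finset.prod_congr rfl fun m _ => h _ ?_
      rw [Finset.mem_filter] at hκ
      exact (hle hκ.1 m).lt_of_ne (hκ.2 m)

/-! ### The coefficients of the vector field -/

/-- The coefficient of `v ^ k` in `B_N(Γ, v) + \bar B_N(Γ)` where `Γ = ∑ₖ f k * v ^ k`. -/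
noncomputable def flowCoeff (b : ℕ → ℝ) (N : Finset ℕ) (f : (N → ℕ) → ℝ) (k : N → ℕ) : ℝ :=
  (∑ i : N, b i * if 1 ≤ k i then convPow f i (k - Pi.single i 1) else 0) +
    ∑' i : ℕ, if i ∈ N then 0 else b i * convPow f i k

theorem hasSum_flowCoeff {N : Finset ℕ} {d : ℕ → ℝ} (hd : Summable d) {f : (N → ℕ) → ℝ}
    (hf : ∀ k, 0 ≤ f k) {v : N → ℝ} (hv : ∀ i, v i ∈ Icc (0 : ℝ) 1) {Γ : ℝ}
    (hΓ : HasSum (fun k => f k * vpow v k) Γ) (hΓ1 : Γ ∈ Icc (0 : ℝ) 1) :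
    HasSum (fun k => flowCoeff d N f k * vpow v k) (BN d N Γ v + BbarN d N Γ) := by
  have hconv := hasSum_convPow hf hv hΓ
  have h1 : HasSum (fun k => (∑ i : N, d i * if 1 ≤ k i then convPow f i (k - Pi.single i 1)
      else 0) * vpow v k) (BN d N Γ v) := by
    simp only [Finset.sum_mul]
    refine hasSum_sum fun i _ => ?_
    have hinj : Function.Injective fun l : N → ℕ => l + Pi.single i 1 := add_left_injective _
    refine (hinj.hasSum_iff ?_).1 ?_
    · intro k hk
      rw [if_neg, mul_zero, zero_mul]
      intro hki
      refine hk ⟨k - Pi.single i 1, ?_⟩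
      funext j
      rcases eq_or_ne j i with rfl | hj
      · simp only [Pi.add_apply, Pi.sub_apply, Pi.single_eq_same]; omega
      · simp [hj]
    · convert! (hconv i).mul_left (d i * v i) using 2 with l
      simp only [Function.comp]
      rw [if_pos (by simp), add_tsub_cancel_right, vpow_add, vpow_single]
      ring
  have h2 : HasSum (fun k => (∑' i : ℕ, if i ∈ N then 0 else d i * convPow f i k) * vpow v k)
      (BbarN d N Γ) := by
    let e : ℕ → ℝ := fun i => if i ∈ N then 0 else d i
    have he : Summable fun i => |e i| := by
      refine Summable.of_norm_bounded hd.norm fun i => ?_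
      simp only [e]
      split_ifs
      · rw [abs_zero, norm_zero]; exact norm_nonneg _
      · rw [norm_abs_eq_norm]
    -- the double series `F` is absolutely summable and is summed in both orders
    let F : ℕ × (N → ℕ) → ℝ := fun q => e q.1 * (convPow f q.1 q.2 * vpow v q.2)
    have hcv : ∀ i k, 0 ≤ convPow f i k * vpow v k := fun i k =>
      mul_nonneg (convPow_nonneg hf i k) (vpow_mem hv k).1
    have hF : Summable F := by
      refine Summable.of_norm ((summable_prod_of_nonneg fun _ => norm_nonneg _).2 ⟨fun i => ?_, ?_⟩)
      · simp only [F, norm_mul (e _)]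
        refine Summable.mul_left _ ?_
        exact (hconv i).summable.norm
      · refine Summable.of_nonneg_of_le (fun i => tsum_nonneg fun k => norm_nonneg _)
          (fun i => ?_) he
        simp only [F, norm_mul (e _), Real.norm_of_nonneg (hcv _ _)]
        rw [tsum_mul_left, (hconv i).tsum_eq, Real.norm_eq_abs]
        exact mul_le_of_le_one_right (abs_nonneg _) (pow_le_one₀ hΓ1.1 hΓ1.2)
    have hA := hF.hasSum.prod_fiberwise fun i => (hconv i).mul_left (e i)
    have hB := (Equiv.prodComm (N → ℕ) ℕ).hasSum_iff.2 hF.hasSum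
    have hC := hB.prod_fiberwise fun k => (hB.summable.prod_factor k).hasSum
    have hT : BbarN d N Γ = ∑' q, F q := by
      rw [← hA.tsum_eq, BbarN]
      refine tsum_congr fun i => ?_
      simp only [e]; split_ifs <;> simp
    rw [hT]
    convert! hC using 2 with k
    rw [← tsum_mul_right]
    refine tsum_congr fun i => ?_
    simp only [Function.comp, Equiv.prodComm_apply, Prod.swap, F, e]
    split_ifs <;> simp [mul_assoc]
  have := h1.add h2
  simp only [← add_mul] at this
  exact this

theorem abs_flowCoeff_le {N : Finset ℕ} {d : ℕ → ℝ} (hd : Summable d) {f : (N → ℕ) → ℝ}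
    (hf : ∀ k, 0 ≤ f k) (hf1 : HasSum f 1) (k : N → ℕ) :
    |flowCoeff d N f k| ≤ flowCoeff (fun i => |d i|) N f k := by
  refine (abs_add_le _ _).trans (add_le_add ?_ ?_)
  · refine (Finset.abs_sum_le_sum_abs _ _).trans (Finset.sum_le_sum fun i _ => ?_)
    rw [abs_mul]
    split_ifs
    · rw [abs_of_nonneg (convPow_nonneg hf _ _)]
    · simp
  · refine tsum_of_norm_bounded (f := fun i => if i ∈ N then 0 else d i * convPow f i k)
      (Summable.hasSum ?_) fun i => ?_
    · refine Summable.of_norm_bounded hd.norm fun i => ?_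
      split_ifs
      · rw [norm_zero]; exact norm_nonneg _
      · rw [norm_mul, norm_abs_eq_norm, Real.norm_of_nonneg (convPow_nonneg hf _ _)]
        exact mul_le_of_le_one_right (norm_nonneg _) (convPow_le_one hf hf1 _ _)
    · split_ifs
      · rw [norm_zero]
      · rw [norm_mul, Real.norm_eq_abs, Real.norm_of_nonneg (convPow_nonneg hf _ _)]

theorem continuousOn_flowCoeff {N : Finset ℕ} {d : ℕ → ℝ} (hd : Summable d)
    {f : (N → ℕ) → ℝ → ℝ} {s : Set ℝ} (hf : ∀ k, ∀ t ∈ s, 0 ≤ f k t)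
    (hf1 : ∀ t ∈ s, HasSum (fun k => f k t) 1) (hc : ∀ k, ContinuousOn (f k) s) (k : N → ℕ) :
    ContinuousOn (fun t => flowCoeff d N (fun l => f l t) k) s := by
  have hconv : ∀ n l, ContinuousOn (fun t => convPow (fun l => f l t) n l) s := fun n l =>
    continuousOn_finsetSum _ fun κ _ => continuousOn_finsetProd _ fun m _ => hc _
  refine ContinuousOn.add (continuousOn_finsetSum _ fun i _ => continuousOn_const.mul ?_) ?_
  · split_ifs
    · exact hconv _ _
    · exact continuousOn_const
  · refine continuousOn_tsum (u := fun i => ‖d i‖) (fun i => ?_) hd.norm fun i t ht => ?_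
    · split_ifs
      · exact continuousOn_const
      · exact continuousOn_const.mul (hconv _ _)
    · split_ifs
      · rw [norm_zero]; exact norm_nonneg _
      · rw [norm_mul, Real.norm_of_nonneg (convPow_nonneg (fun k => hf k t ht) _ _)]
        exact mul_le_of_le_one_right (norm_nonneg _)
          (convPow_le_one (fun k => hf k t ht) (hf1 t ht) _ _)

end BranchingCrossing

namespace BranchingCrossing

/-! ### Expectations of countably valued variables and derivatives of power series -/

theorem hasSum_real_mul_of_countable {Ω α : Type*} [MeasurableSpace Ω] {P : Measure Ω}
    [IsFiniteMeasure P] [Countable α] [MeasurableSpace α] [MeasurableSingletonClass α]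
    {Y : Ω → α} (hY : AEMeasurable Y P) {F : α → ℝ} {C : ℝ} (hF : ∀ k, |F k| ≤ C) :
    HasSum (fun k => P.real {ω | Y ω = k} * F k) (∫ ω, F (Y ω) ∂P) := by
  have hFm : AEStronglyMeasurable F (P.map Y) := (measurable_of_countable F).aestronglyMeasurable
  have hFi : Integrable F (P.map Y) := Integrable.of_bound hFm C (Eventually.of_forall hF)
  have h := hasSum_integral_iUnion (μ := P.map Y) (s := fun k : α => {k}) (f := F)
    (fun k => measurableSet_singleton k) (fun i j hij => by simpa using hij) hFi.integrableOn
  have hU : ⋃ k : α, {k} = univ := eq_univ_of_forall fun k => mem_iUnion.2 ⟨k, rfl⟩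
  rw [hU, setIntegral_univ, integral_map hY hFm] at h
  convert! h using 2 with k
  rw [integral_singleton, smul_eq_mul, map_measureReal_apply_of_aemeasurable hY
    (measurableSet_singleton k)]
  rfl

theorem nat_mul_pow_le {ρ : ℝ} (hρ0 : 0 ≤ ρ) (hρ : ρ < 1) (n : ℕ) :
    n * ρ ^ (n - 1) ≤ (1 - ρ)⁻¹ := by
  calc (n : ℝ) * ρ ^ (n - 1) = ∑ _m ∈ Finset.range n, ρ ^ (n - 1) := by simp
    _ ≤ ∑ m ∈ Finset.range n, ρ ^ m := Finset.sum_le_sum fun m hm =>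
        pow_le_pow_of_le_one hρ0 hρ.le (by have := Finset.mem_range.1 hm; omega)
    _ ≤ ∑' m, ρ ^ m := (summable_geometric_of_lt_one hρ0 hρ).sum_le_tsum _
        fun m _ => pow_nonneg hρ0 m
    _ = (1 - ρ)⁻¹ := tsum_geometric_of_lt_one hρ0 hρ

theorem summable_mul_deriv {c : ℕ → ℝ} (hc : Summable c) {z : ℝ} (hz : 0 ≤ z) (hz1 : z < 1) :
    Summable fun j => c j * (j * z ^ (j - 1)) := by
  refine Summable.of_norm_bounded (hc.norm.mul_right (1 - z)⁻¹) fun j => ?_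
  rw [norm_mul, Real.norm_of_nonneg (by positivity : 0 ≤ (j : ℝ) * z ^ (j - 1))]
  exact mul_le_mul_of_nonneg_left (nat_mul_pow_le hz hz1 j) (norm_nonneg _)

theorem hasDerivAt_field {c : ℕ → ℝ} (hc : Summable c) {z : ℝ} (hz : z ∈ Ioo (0 : ℝ) 1) :
    HasDerivAt (field c) (∑' j, c j * (j * z ^ (j - 1))) z := by
  obtain ⟨ρ, hzρ, hρ⟩ := exists_between hz.2
  have hρ0 : 0 ≤ ρ := hz.1.le.trans hzρ.le
  refine hasDerivAt_tsum_of_isPreconnected (u := fun j => ‖c j‖ * (1 - ρ)⁻¹)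
    (t := Ioo 0 ρ) (hc.norm.mul_right _) isOpen_Ioo isPreconnected_Ioo
    (fun j y _ => (hasDerivAt_pow j y).const_mul (c j)) (fun j y hy => ?_) (y₀ := z)
    ⟨hz.1, hzρ⟩ (summable_mul_pow hc ⟨hz.1.le, hz.2.le⟩) ⟨hz.1, hzρ⟩
  have hy0 := hy.1.le
  rw [norm_mul, Real.norm_of_nonneg (by positivity : 0 ≤ (j : ℝ) * y ^ (j - 1))]
  refine mul_le_mul_of_nonneg_left (le_trans ?_ (nat_mul_pow_le hρ0 hρ j)) (norm_nonneg _)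
  have := hy.2.le
  gcongr

/-! ### The recursion -/

theorem BbarN_eq_field (b : ℕ → ℝ) (N : Finset ℕ) (u : ℝ) :
    BbarN b N u = field (weightedRate b (0 : N → ℝ)) u := by
  refine tsum_congr fun j => ?_
  unfold weightedRate
  split_ifs <;> simp

theorem summable_convPowNe {N : Finset ℕ} {b : ℕ → ℝ} (hb : Summable b) {f : (N → ℕ) → ℝ}
    (hf : ∀ k, 0 ≤ f k) (hf1 : HasSum f 1) (k : N → ℕ) :
    Summable fun i : ℕ => if i ∈ N then 0 else b i * convPowNe f i k := by
  refine Summable.of_norm_bounded hb.norm fun i => ?_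
  split_ifs
  · rw [norm_zero]; exact norm_nonneg _
  · rw [norm_mul, Real.norm_of_nonneg (convPowNe_nonneg hf i k)]
    exact mul_le_of_le_one_right (norm_nonneg _)
      ((convPowNe_le_convPow hf i k).trans (convPow_le_one hf hf1 i k))

/-- The terms of the flow coefficient that contain `f k` itself are linear in it, with factor
`\bar B_N'(f 0)`; the remaining terms form `F_k`. -/
theorem flowCoeff_eq_add_recF {N : Finset ℕ} {b : ℕ → ℝ} (hb : Summable b) {f : (N → ℕ) → ℝ}
    (hf : ∀ k, 0 ≤ f k) (hf1 : HasSum f 1) (h0 : f 0 < 1) {k : N → ℕ} (hk : k ≠ 0) :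
    flowCoeff b N f k =
      (∑' j, weightedRate b (0 : N → ℝ) j * (j * f 0 ^ (j - 1))) * f k + recF b N f k := by
  have hw : Summable (weightedRate b (0 : N → ℝ)) := by
    refine Summable.of_norm_bounded hb.norm fun j => ?_
    unfold weightedRate; split_ifs
    · simp
    · exact le_rfl
  have h1 : ∀ i, (if i ∈ N then 0 else b i * convPow f i k) =
      weightedRate b (0 : N → ℝ) i * (i * f 0 ^ (i - 1)) * f k +
        if i ∈ N then 0 else b i * convPowNe f i k := fun i => by
    unfold weightedRate; split_ifs
    · simp
    · rw [convPow_eq_add f i hk]; ring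
  rw [flowCoeff, recF, tsum_congr h1,
    ((summable_mul_deriv hw (hf 0) h0).mul_right (f k)).tsum_add
      (summable_convPowNe hb hf hf1 k), tsum_mul_right]
  ring

theorem recF_nonneg {N : Finset ℕ} {b : ℕ → ℝ} (hb : IsBranchingRates b) (hN1 : 1 ∉ N)
    {f : (N → ℕ) → ℝ} (hf : ∀ k, 0 ≤ f k) (k : N → ℕ) : 0 ≤ recF b N f k := by
  refine add_nonneg (Finset.sum_nonneg fun i _ => ?_) (tsum_nonneg fun i => ?_)
  · refine mul_nonneg (hb.nonneg i fun h => hN1 (h ▸ i.2)) ?_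
    split_ifs
    · exact convPow_nonneg hf _ _
    · exact le_rfl
  · split_ifs
    · exact le_rfl
    · rcases eq_or_ne i 1 with rfl | hi
      · rw [convPowNe_one, mul_zero]
      · exact mul_nonneg (hb.nonneg i hi) (convPowNe_nonneg hf _ _)

theorem recursion_unique {N : Finset ℕ} {b : ℕ → ℝ} {g₀ : ℝ → ℝ} {g g' : (N → ℕ) → ℝ → ℝ}
    (hg : SatisfiesRecursion b N g₀ g) (hg' : SatisfiesRecursion b N g₀ g') (k : N → ℕ) :
    ∀ t, 0 ≤ t → g' k t = g k t := by
  induction k using WellFoundedLT.induction with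
  | _ k ih =>
  intro t ht
  have h0 : ∀ s, 0 ≤ s → g' 0 s = g 0 s := fun s hs => by rw [hg.1 s hs, hg'.1 s hs]
  rcases eq_or_ne k 0 with rfl | hk
  · exact h0 t ht
  · rw [hg.2 k hk t ht, hg'.2 k hk t ht, h0 t ht]
    congr 1
    refine intervalIntegral.integral_congr fun s hs => ?_
    rw [uIcc_of_le ht] at hs
    rw [h0 s hs.1, recursion_congr b fun l hl => ih l hl s hs.1]

/-! ### The law of the crossing numbers -/

variable {b : ℕ → ℝ} {N : Finset ℕ} {v : N → ℝ}
variable {Ω : Type*} [MeasurableSpace Ω] {P : Measure Ω} {p : ℝ → ℕ → ℕ → ℝ} {X : ℝ → Ω → ℕ}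

/-- The probability `P(Y(t) = k)`. -/
noncomputable def crossingLaw (P : Measure Ω) (N : Finset ℕ) (X : ℝ → Ω → ℕ) (k : N → ℕ)
    (t : ℝ) : ℝ :=
  P.real {ω | crossingVector N X t ω = k}

theorem crossingLaw_nonneg (k : N → ℕ) (t : ℝ) : 0 ≤ crossingLaw P N X k t := measureReal_nonneg

namespace IsRegularChain

theorem aemeasurable_crossingVector (hX : IsRegularChain P b X p) (hN1 : 1 ∉ N) {t : ℝ}
    (ht : 0 ≤ t) : AEMeasurable (crossingVector N X t) P :=
  IsChain.aemeasurable_crossingVector hX.toIsChain hX.regular hN1 ht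

variable [IsProbabilityMeasure P]

theorem hasSum_crossingLaw_mul (hX : IsRegularChain P b X p) (hN1 : 1 ∉ N)
    (hv : ∀ i, v i ∈ Icc (0 : ℝ) 1) {t : ℝ} (ht : 0 ≤ t) :
    HasSum (fun k => crossingLaw P N X k t * vpow v k) (jointPgf P X v 1 t) := by
  rw [hX.jointPgf_one hN1 hv ht]
  exact hasSum_real_mul_of_countable (hX.aemeasurable_crossingVector hN1 ht) (F := vpow v)
    (C := 1) fun k => by rw [abs_of_nonneg (vpow_mem hv k).1]; exact (vpow_mem hv k).2

theorem hasSum_crossingLaw (hX : IsRegularChain P b X p) (hN1 : 1 ∉ N) {t : ℝ} (ht : 0 ≤ t) :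
    HasSum (fun k => crossingLaw P N X k t) 1 := by
  have := hX.hasSum_crossingLaw_mul hN1 (v := 1) (fun _ => ⟨zero_le_one, le_rfl⟩) ht
  rw [hX.jointPgf_one_one hN1 ht] at this
  simpa only [vpow_one, mul_one] using this

theorem crossingLaw_zero (hX : IsRegularChain P b X p) (hN1 : 1 ∉ N) {t : ℝ} (ht : 0 ≤ t) :
    crossingLaw P N X 0 t = jointPgf P X (0 : N → ℝ) 1 t := by
  have h := hX.hasSum_crossingLaw_mul hN1 (v := 0) (fun _ => ⟨le_rfl, zero_le_one⟩) ht
  have h2 := hasSum_single (f := fun k => crossingLaw P N X k t * vpow (0 : N → ℝ) k) 0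
    fun k hk => by rw [vpow_zero, if_neg hk, mul_zero]
  rw [vpow_zero, if_pos rfl, mul_one] at h2
  exact h2.unique h

theorem crossingLaw_initial (k : N → ℕ) :
    crossingLaw P N X k 0 = if k = 0 then 1 else 0 := by
  have h0 : ∀ ω, crossingVector N X 0 ω = 0 := fun ω => funext fun i => crossingNumber_zero _ _
  unfold crossingLaw
  split_ifs with hk
  · simp [h0, hk]
  · have : {ω | crossingVector N X 0 ω = k} = ∅ :=
      eq_empty_of_forall_notMem fun ω hω => hk (hω.symm.trans (h0 ω))
    rw [this, measureReal_empty]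

/-- If `Y s ≠ Y t` then, as `Y` is nondecreasing, `(1/2) ^ |Y|` drops between `s` and `t` by an
amount that is bounded below on the event that `Y s = k` or `Y t = k`. So the modulus of
continuity of `G(·, 1, (1/2, …, 1/2))` controls that of `P(Y = k)`. -/
theorem abs_crossingLaw_sub_le (hX : IsRegularChain P b X p) (hN1 : 1 ∉ N) (k : N → ℕ) {s t : ℝ}
    (hs : 0 ≤ s) (hst : s ≤ t) :
    (1 / 2) ^ (∑ i, k i + 1) * |crossingLaw P N X k s - crossingLaw P N X k t| ≤
      jointPgf P X (fun _ : N => 1 / 2) 1 s - jointPgf P X (fun _ : N => 1 / 2) 1 t := by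
  classical
  have ht := hs.trans hst
  have hv : ∀ i : N, (fun _ : N => (1 / 2 : ℝ)) i ∈ Icc (0 : ℝ) 1 := fun _ => by norm_num
  set w : N → ℝ := fun _ => 1 / 2 with hw
  have hpw : ∀ ω r, pathWeight w (fun s => X s ω) r =
      (1 / 2) ^ (∑ i, crossingVector N X r ω i) := fun ω r => by
    rw [← Finset.prod_pow_eq_pow_sum]; rfl
  let f : ℝ → Ω → ℝ := fun r ω => if crossingVector N X r ω = k then 1 else 0
  have hFm : Measurable fun l : N → ℕ => if l = k then (1 : ℝ) else 0 := measurable_of_countable _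
  have hf : ∀ r, 0 ≤ r → Integrable (f r) P ∧ ∫ ω, f r ω ∂P = crossingLaw P N X k r := by
    intro r hr
    have hYm := hX.aemeasurable_crossingVector hN1 hr
    refine ⟨Integrable.of_bound (hFm.comp_aemeasurable hYm).aestronglyMeasurable 1
      (Eventually.of_forall fun ω => ?_), ?_⟩
    · simp only [f]; split_ifs <;> simp
    · have h := hasSum_real_mul_of_countable hYm (F := fun l => if l = k then (1 : ℝ) else 0)
        (C := 1) fun l => by split_ifs <;> simp
      have h2 := hasSum_single (f := fun l => P.real {ω | crossingVector N X r ω = l} *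
        if l = k then (1 : ℝ) else 0) k fun l hl => by rw [if_neg hl, mul_zero]
      rw [if_pos rfl, mul_one] at h2
      exact h.unique h2
  have hpi : ∀ r, 0 ≤ r → Integrable (fun ω => pathWeight w (fun s => X s ω) r) P := fun r hr =>
    IsChain.integrable_pathWeight hX.toIsChain hX.regular hN1 hv hr
  rw [hX.jointPgf_one hN1 hv hs, hX.jointPgf_one hN1 hv ht, ← integral_sub (hpi s hs) (hpi t ht),
    ← (hf s hs).2, ← (hf t ht).2, ← integral_sub (hf s hs).1 (hf t ht).1]
  have h1 : |∫ ω, (f s ω - f t ω) ∂P| ≤ ∫ ω, |f s ω - f t ω| ∂P := abs_integral_le_integral_abs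
  refine (mul_le_mul_of_nonneg_left h1 (by positivity)).trans ?_
  rw [← integral_const_mul]
  refine integral_mono_ae (((hf s hs).1.sub (hf t ht).1).abs.const_mul _)
    ((hpi s hs).sub (hpi t ht)) ?_
  filter_upwards [hX.regular] with ω hω
  have hmono : ∀ i, crossingVector N X s ω i ≤ crossingVector N X t ω i := fun i =>
    hω.crossingNumber_mono (fun h => hN1 (h ▸ i.2)) hst
  simp only [hpw, f]
  set A := crossingVector N X s ω
  set B := crossingVector N X t ω
  -- unequal vectors `A ≤ B` have total degrees that differ by at least one
  have hpow : ∀ m n : ℕ, m < n → m ≤ ∑ i, k i →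
      (1 / 2 : ℝ) ^ (∑ i, k i + 1) ≤ (1 / 2) ^ m - (1 / 2) ^ n := by
    intro m n hmn hmk
    have e1 : (1 / 2 : ℝ) ^ n ≤ (1 / 2) ^ (m + 1) :=
      pow_le_pow_of_le_one (by norm_num) (by norm_num) hmn
    have e2 : (1 / 2 : ℝ) ^ (∑ i, k i + 1) ≤ (1 / 2) ^ (m + 1) :=
      pow_le_pow_of_le_one (by norm_num) (by norm_num) (by omega)
    rw [pow_succ _ m] at e1 e2
    linarith
  by_cases hAB : A = B
  · rw [hAB]; simp
  have hlt : ∑ i, A i < ∑ i, B i := by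
    obtain ⟨i, hi⟩ := Function.ne_iff.1 hAB
    exact Finset.sum_lt_sum (fun i _ => hmono i) ⟨i, Finset.mem_univ i, (hmono i).lt_of_ne hi⟩
  by_cases hA : A = k
  · have hB : B ≠ k := fun h => hAB (hA.trans h.symm)
    rw [if_pos hA, if_neg hB]
    simp only [sub_zero, abs_one, mul_one]
    exact hpow _ _ hlt (by rw [hA])
  by_cases hB : B = k
  · rw [if_neg hA, if_pos hB]
    simp only [zero_sub, abs_neg, abs_one, mul_one]
    exact hpow _ _ hlt (by rw [← hB]; exact hlt.le)
  · rw [if_neg hA, if_neg hB, sub_zero, abs_zero, mul_zero]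
    exact sub_nonneg.2 (pow_le_pow_of_le_one (by norm_num) (by norm_num) hlt.le)

theorem continuousOn_crossingLaw (hX : IsRegularChain P b X p) (hN1 : 1 ∉ N) (k : N → ℕ) :
    ContinuousOn (crossingLaw P N X k) (Ici 0) := by
  have hv : ∀ i : N, (fun _ : N => (1 / 2 : ℝ)) i ∈ Icc (0 : ℝ) 1 := fun _ => by norm_num
  have hb := hX.rates.pos.le
  let K : ℝ := 2 ^ (∑ i, k i + 1) * -b 1
  have hK : 0 ≤ K := by positivity
  have key : ∀ s t, 0 ≤ s → s ≤ t →
      |crossingLaw P N X k s - crossingLaw P N X k t| ≤ K * |s - t| := by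
    intro s t hs hst
    have h1 := hX.abs_crossingLaw_sub_le hN1 k hs hst
    have h2 := (le_abs_self _).trans (hX.abs_jointPgf_sub_le hN1 hv (u := 1)
      ⟨zero_le_one, le_rfl⟩ (hs.trans hst) hs)
    have h3 := h1.trans h2
    rw [one_div, inv_pow, inv_mul_le_iff₀ (by positivity), ← mul_assoc] at h3
    exact h3
  refine LipschitzOnWith.continuousOn (K := K.toNNReal)
    (LipschitzOnWith.of_dist_le_mul fun s hs t ht => ?_)
  rw [Real.coe_toNNReal _ hK, Real.dist_eq, Real.dist_eq]
  rcases le_total s t with h | h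
  · exact key s t hs h
  · rw [abs_sub_comm, abs_sub_comm s]; exact key t s ht h

/-- Comparison of the coefficients of `v ^ k` in the integral equation for `G(t, 1, v)`. -/
theorem crossingLaw_eq_integral (hX : IsRegularChain P b X p) (hN1 : 1 ∉ N) (k : N → ℕ) {t : ℝ}
    (ht : 0 ≤ t) : crossingLaw P N X k t = (if k = 0 then 1 else 0) +
      ∫ s in (0 : ℝ)..t, flowCoeff b N (fun l => crossingLaw P N X l s) k := by
  have hbs : Summable b := hX.rates.hasSum_zero.summable
  have hnn : ∀ s, ∀ k, 0 ≤ crossingLaw P N X k s := fun s k => crossingLaw_nonneg k s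
  have hcont : ∀ d : ℕ → ℝ, Summable d → ∀ k, ContinuousOn (fun s =>
      flowCoeff d N (fun l => crossingLaw P N X l s) k) (Ici 0) := fun d hd k =>
    continuousOn_flowCoeff hd (fun k s _ => hnn s k) (fun s hs => hX.hasSum_crossingLaw hN1 hs)
      (fun k => hX.continuousOn_crossingLaw hN1 k) k
  suffices h : ∀ v : N → ℝ, (∀ i, v i ∈ Icc (0 : ℝ) 1) → HasSum (fun k =>
      (crossingLaw P N X k t - ((if k = 0 then 1 else 0) +
        ∫ s in (0 : ℝ)..t, flowCoeff b N (fun l => crossingLaw P N X l s) k)) * vpow v k) 0 from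
    sub_eq_zero.1 (eq_zero_of_hasSum_vpow h k)
  intro v hv
  have hone : HasSum (fun k : N → ℕ => (if k = 0 then 1 else 0) * vpow v k) 1 := by
    have := hasSum_single (f := fun k : N → ℕ => (if k = 0 then 1 else 0) * vpow v k) 0
      fun k hk => by rw [if_neg hk, zero_mul]
    simpa [vpow] using this
  have hmem : ∀ s, 0 ≤ s → jointPgf P X v 1 s ∈ Icc (0 : ℝ) 1 := fun s hs =>
    hX.jointPgf_mem hv hs ⟨zero_le_one, le_rfl⟩
  have hint : HasSum (fun k => ∫ s in (0 : ℝ)..t,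
      flowCoeff b N (fun l => crossingLaw P N X l s) k * vpow v k)
      (∫ s in (0 : ℝ)..t, field (weightedRate b v) (jointPgf P X v 1 s)) := by
    have habs : ∀ s, 0 ≤ s → HasSum (fun k => flowCoeff (fun i => |b i|) N
        (fun l => crossingLaw P N X l s) k) (BN (fun i => |b i|) N 1 1 +
          BbarN (fun i => |b i|) N 1) := fun s hs => by
      have := hasSum_flowCoeff (N := N) hbs.abs (hnn s) (v := 1)
        (fun _ => ⟨zero_le_one, le_rfl⟩) (Γ := 1)
        (by simpa only [vpow_one, mul_one] using hX.hasSum_crossingLaw hN1 hs)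
        ⟨zero_le_one, le_rfl⟩
      simpa only [vpow_one, mul_one] using this
    refine intervalIntegral.hasSum_integral_of_dominated_convergence
      (fun k s => flowCoeff (fun i => |b i|) N (fun l => crossingLaw P N X l s) k)
      (fun k => ?_) (fun k => Eventually.of_forall fun s hs => ?_)
      (Eventually.of_forall fun s hs => ?_) ?_ (Eventually.of_forall fun s hs => ?_)
    · refine ContinuousOn.aestronglyMeasurable ?_ measurableSet_uIoc
      rw [uIoc_of_le ht]
      exact ((hcont b hbs k).mul continuousOn_const).mono fun s hs => hs.1.le
    · rw [uIoc_of_le ht] at hs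
      rw [norm_mul, Real.norm_of_nonneg (vpow_mem hv k).1]
      exact (mul_le_of_le_one_right (norm_nonneg _) (vpow_mem hv k).2).trans
        (abs_flowCoeff_le hbs (hnn s) (hX.hasSum_crossingLaw hN1 hs.1.le) k)
    · rw [uIoc_of_le ht] at hs
      exact (habs s hs.1.le).summable
    · refine (intervalIntegrable_const (c := BN (fun i => |b i|) N 1 1 +
        BbarN (fun i => |b i|) N 1)).congr fun s hs => ?_
      rw [uIoc_of_le ht] at hs
      exact (habs s hs.1.le).tsum_eq.symm
    · rw [uIoc_of_le ht] at hs
      rw [← BN_add_BbarN hX.rates N v (hmem s hs.1.le)]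
      exact hasSum_flowCoeff hbs (hnn s) hv (hX.hasSum_crossingLaw_mul hN1 hv hs.1.le)
        (hmem s hs.1.le)
  have h := (hX.hasSum_crossingLaw_mul hN1 hv ht).sub (hone.add hint)
  rw [← hX.jointPgf_eq_integral hN1 hv ⟨zero_le_one, le_rfl⟩ ht, sub_self] at h
  convert! h using 2 with k
  rw [intervalIntegral.integral_mul_const]
  ring

theorem hasDerivWithinAt_crossingLaw (hX : IsRegularChain P b X p) (hN1 : 1 ∉ N) (k : N → ℕ)
    {t : ℝ} (ht : 0 ≤ t) : HasDerivWithinAt (crossingLaw P N X k)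
      (flowCoeff b N (fun l => crossingLaw P N X l t) k) (Ici 0) t := by
  have hcont := continuousOn_flowCoeff (N := N) hX.rates.hasSum_zero.summable
    (f := crossingLaw P N X) (fun k s _ => crossingLaw_nonneg k s)
    (fun s hs => hX.hasSum_crossingLaw hN1 hs) (fun k => hX.continuousOn_crossingLaw hN1 k) k
  exact ((hasDerivWithinAt_integral_Ici hcont ht).const_add (if k = 0 then 1 else 0)).congr
    (fun s hs => hX.crossingLaw_eq_integral hN1 k hs) (hX.crossingLaw_eq_integral hN1 k ht)

/-- The field is nonpositive at `G(0, 1, v) = 1` and, for `v ≠ 1`, never vanishes along `G(t, 1, v)`,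
so it remains negative. -/
theorem field_jointPgf_one_neg (hX : IsRegularChain P b X p) (hN1 : 1 ∉ N) (hNb : ∀ k ∈ N, 0 < b k)
    (hv : ∀ i, v i ∈ Icc (0 : ℝ) 1) (hv1 : v ≠ 1) {t : ℝ} (ht : 0 ≤ t) :
    field (weightedRate b v) (jointPgf P X v 1 t) < 0 := by
  have hne := fun s (hs : 0 ≤ s) => hX.field_jointPgf_one_ne_zero hN1 hNb hv hv1 hs
  by_contra hcon
  push Not at hcon
  have h0 : field (weightedRate b v) (jointPgf P X v 1 0) ≤ 0 := by
    rw [hX.jointPgf_initial]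
    simpa [field] using (hX.rates.isSubRates_weighted hN1 hv).tsum_le
  have hc := (hX.continuousOn_field_jointPgf hN1 hv (u := 1) ⟨zero_le_one, le_rfl⟩).mono
    (Icc_subset_Ici_self : Icc 0 t ⊆ Ici 0)
  obtain ⟨s, hs, hs0⟩ := intermediate_value_Icc ht hc ⟨h0, hcon⟩
  exact hne s hs.1 hs0

theorem jointPgf_one_mem_Ioo (hX : IsRegularChain P b X p) (hN1 : 1 ∉ N)
    (hNb : ∀ k ∈ N, 0 < b k) (hv : ∀ i, v i ∈ Icc (0 : ℝ) 1) (hv1 : v ≠ 1) {t : ℝ} (ht : 0 < t) :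
    jointPgf P X v 1 t ∈ Ioo (0 : ℝ) 1 := by
  have hu : (1 : ℝ) ∈ Icc (0 : ℝ) 1 := ⟨zero_le_one, le_rfl⟩
  constructor
  · refine ((Real.exp_pos _).trans_le (hX.exp_le_weightedRow_one hN1 hv ht.le)).trans_le ?_
    have hs := hX.summable_weightedRow hv ht.le
    simp only [jointPgf, field, one_pow, mul_one]
    exact hs.le_tsum 1 fun j _ => (hX.weightedRow_mem hv j ht.le).1
  · have hc := (hX.continuousOn_field_jointPgf hN1 hv hu).mono
      (Icc_subset_Ici_self : Icc 0 t ⊆ Ici 0)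
    have h1 := intervalIntegral.intervalIntegral_pos_of_pos_on (a := 0) (b := t)
      (f := fun s => -field (weightedRate b v) (jointPgf P X v 1 s))
      (ContinuousOn.intervalIntegrable (by rw [uIcc_of_le ht.le]; exact hc.neg))
      (fun s hs => neg_pos.2 (hX.field_jointPgf_one_neg hN1 hNb hv hv1 hs.1.le)) ht
    rw [intervalIntegral.integral_neg] at h1
    have h2 := hX.jointPgf_eq_integral hN1 hv hu ht.le
    linarith

/-- Variation of constants: with `ψ = \bar B_N(g₀)` the linear part of the equation
`g_k' = \bar B_N'(g₀) g_k + F_k` is also satisfied by `ψ`, so `(g_k / ψ)' = F_k / ψ`. -/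
theorem crossingLaw_recursion (hX : IsRegularChain P b X p) (hN1 : 1 ∉ N)
    (hNb : ∀ k ∈ N, 0 < b k) {k : N → ℕ} (hk : k ≠ 0) {t : ℝ} (ht : 0 ≤ t) :
    BbarN b N (crossingLaw P N X 0 t) ≠ 0 ∧
    IntervalIntegrable (fun s => recF b N (fun l => crossingLaw P N X l s) k /
      BbarN b N (crossingLaw P N X 0 s)) volume 0 t ∧
    crossingLaw P N X k t = BbarN b N (crossingLaw P N X 0 t) *
      ∫ s in (0 : ℝ)..t, recF b N (fun l => crossingLaw P N X l s) k /
        BbarN b N (crossingLaw P N X 0 s) := by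
  have hbs : Summable b := hX.rates.hasSum_zero.summable
  have hv : ∀ i, (0 : N → ℝ) i ∈ Icc (0 : ℝ) 1 := fun _ => ⟨le_rfl, zero_le_one⟩
  have hv1 : (0 : N → ℝ) ≠ 1 := by
    obtain ⟨i, -⟩ := Function.ne_iff.1 hk
    exact fun h => zero_ne_one (congr_fun h i)
  have hc := hX.rates.isSubRates_weighted hN1 hv
  set ψ : ℝ → ℝ := fun s => BbarN b N (crossingLaw P N X 0 s) with hψ
  have hψeq : ∀ s, 0 ≤ s → ψ s = field (weightedRate b (0 : N → ℝ))
      (jointPgf P X (0 : N → ℝ) 1 s) := fun s hs => by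
    rw [hψ]; simp only; rw [BbarN_eq_field, hX.crossingLaw_zero hN1 hs]
  have hψneg : ∀ s, 0 ≤ s → ψ s < 0 := fun s hs => by
    rw [hψeq s hs]; exact hX.field_jointPgf_one_neg hN1 hNb hv hv1 hs
  have hψc : ContinuousOn ψ (Ici 0) :=
    (hX.continuousOn_field_jointPgf hN1 hv ⟨zero_le_one, le_rfl⟩).congr hψeq
  let h : ℝ → ℝ := fun s => crossingLaw P N X k s / ψ s
  have hhc : ContinuousOn h (Icc 0 t) := ((hX.continuousOn_crossingLaw hN1 k).div hψc
    fun s hs => (hψneg s hs).ne).mono Icc_subset_Ici_self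
  have hhd : ∀ s ∈ Ioo 0 t, HasDerivAt h
      (recF b N (fun l => crossingLaw P N X l s) k / ψ s) s := by
    intro s hs
    have hs0 := hs.1.le
    have hnhds : Ici (0 : ℝ) ∈ 𝓝 s := Ici_mem_nhds hs.1
    have hz := hX.jointPgf_one_mem_Ioo hN1 hNb hv hv1 hs.1
    have hG := (hX.hasDerivWithinAt_jointPgf hN1 hv (u := 1) ⟨zero_le_one, le_rfl⟩
      hs0).hasDerivAt hnhds
    have hψd : HasDerivAt ψ ((∑' j, weightedRate b (0 : N → ℝ) j *
        (j * crossingLaw P N X 0 s ^ (j - 1))) * ψ s) s := by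
      rw [hψeq s hs0, hX.crossingLaw_zero hN1 hs0]
      refine ((hasDerivAt_field hc.summable hz).comp s hG).congr_of_eventuallyEq ?_
      filter_upwards [hnhds] with r hr using hψeq r hr
    have hgd := (hX.hasDerivWithinAt_crossingLaw hN1 k hs0).hasDerivAt hnhds
    convert! hgd.div hψd (hψneg s hs0).ne using 1
    rw [flowCoeff_eq_add_recF hbs (fun k => crossingLaw_nonneg k s)
      (hX.hasSum_crossingLaw hN1 hs0) (by rw [hX.crossingLaw_zero hN1 hs0]; exact hz.2) hk]
    have := (hψneg s hs0).ne
    field_simp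
    ring
  have hint : IntervalIntegrable (fun s => recF b N (fun l => crossingLaw P N X l s) k / ψ s)
      volume 0 t := by
    -- `h` is continuous and its derivative has constant sign, so the derivative is integrable
    have h1 := intervalIntegral.integrableOn_deriv_of_nonneg (g := fun s => -h s)
      (g' := fun s => -(recF b N (fun l => crossingLaw P N X l s) k / ψ s)) hhc.neg
      (fun s hs => (hhd s hs).neg) fun s hs => neg_nonneg.2 (div_nonpos_of_nonneg_of_nonpos
        (recF_nonneg hX.rates hN1 (fun k => crossingLaw_nonneg k s) k) (hψneg s hs.1.le).le)
    have h2 := ((intervalIntegrable_iff_integrableOn_Ioc_of_le ht).2 h1).neg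
    simpa [Pi.neg_def] using h2
  refine ⟨(hψneg t ht).ne, hint, ?_⟩
  rw [intervalIntegral.integral_eq_sub_of_hasDerivAt_of_le ht hhc hhd hint]
  simp only [h]
  rw [crossingLaw_initial, if_neg hk, zero_div, sub_zero, mul_div_cancel₀ _ (hψneg t ht).ne]

end IsRegularChain

end BranchingCrossing

theorem theorem3p1 {Ω : Type*} [MeasurableSpace Ω] (P : Measure Ω) [IsProbabilityMeasure P]
    (b : ℕ → ℝ) (hb : BranchingCrossing.IsBranchingRates b)
    (N : Finset ℕ) (hN1 : 1 ∉ N) (hNb : ∀ k ∈ N, 0 < b k)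
    (X : ℝ → Ω → ℕ) (hX : BranchingCrossing.IsRegularMBP P b 1 X) :
    -- `Y(t)` is a random vector
    (∀ t, 0 ≤ t → AEMeasurable (BranchingCrossing.crossingVector N X t) P) ∧
    ∃ G : ℝ → ℝ → (N → ℝ) → ℝ,
      -- `t ↦ G(t, u, v)` is the unique solution of the differential equation
      (∀ u ∈ Icc (0 : ℝ) 1, ∀ v : N → ℝ, (∀ i, v i ∈ Icc (0 : ℝ) 1) →
        BranchingCrossing.IsSolution b N u v (fun t => G t u v) ∧
        ∀ y, BranchingCrossing.IsSolution b N u v y → ∀ t, 0 ≤ t → y t = G t u v) ∧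
      -- the joint probability generating function of `Y(t)`
      (∀ t, 0 ≤ t → ∀ v : N → ℝ, (∀ i, v i ∈ Icc (0 : ℝ) 1) →
        ∫ ω, ∏ i, v i ^ BranchingCrossing.crossingVector N X t ω i ∂P = G t 1 v) ∧
      -- the probabilities `P(Y(t) = k)` satisfy the recursion, all terms of which are well defined,
      -- and the recursion determines them
      ∃ g : (N → ℕ) → ℝ → ℝ,
        (∀ k t, 0 ≤ t → P.real {ω | BranchingCrossing.crossingVector N X t ω = k} = g k t) ∧
        BranchingCrossing.SatisfiesRecursion b N (fun t => G t 1 0) g ∧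
        (∀ k, k ≠ 0 → ∀ t, 0 ≤ t →
          BranchingCrossing.BbarN b N (g 0 t) ≠ 0 ∧
          Summable (fun i : ℕ => if i ∈ N then 0 else
            b i * BranchingCrossing.convPowNe (fun l => g l t) i k) ∧
          IntervalIntegrable (fun s => BranchingCrossing.recF b N (fun l => g l s) k /
            BranchingCrossing.BbarN b N (g 0 s)) volume 0 t) ∧
        ∀ g' : (N → ℕ) → ℝ → ℝ,
          BranchingCrossing.SatisfiesRecursion b N (fun t => G t 1 0) g' →
          ∀ k t, 0 ≤ t → g' k t = g k t := by
  obtain ⟨p, hp, hf, hfdd⟩ := hX.markov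
  have hC : BranchingCrossing.IsRegularChain P b X p :=
    { transition := hp
      measurable := hX.measurable
      fdd := hfdd
      rates := hb
      forward := hf
      regular := hX.regular }
  have hrec : BranchingCrossing.SatisfiesRecursion b N
      (fun t => BranchingCrossing.jointPgf P X (0 : N → ℝ) 1 t)
      (BranchingCrossing.crossingLaw P N X) :=
    ⟨fun t ht => hC.crossingLaw_zero hN1 ht,
      fun k hk t ht => (hC.crossingLaw_recursion hN1 hNb hk ht).2.2⟩
  refine ⟨fun t ht => hC.aemeasurable_crossingVector hN1 ht,
    fun t u v => BranchingCrossing.jointPgf P X v u t,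
    fun u hu v hv => ⟨hC.isSolution_jointPgf hN1 hv hu,
      fun y hy t ht => hC.eq_jointPgf_of_isSolution hN1 hNb hv hu hy ht⟩,
    fun t ht v hv => (hC.jointPgf_one hN1 hv ht).symm,
    BranchingCrossing.crossingLaw P N X, fun _ _ _ => rfl, hrec, fun k hk t ht => ?_,
    fun g' hg' k => BranchingCrossing.recursion_unique hrec hg' k⟩
  have h := hC.crossingLaw_recursion hN1 hNb hk ht
  exact ⟨h.1, BranchingCrossing.summable_convPowNe hb.hasSum_zero.summable
    (fun l => BranchingCrossing.crossingLaw_nonneg l t) (hC.hasSum_crossingLaw hN1 ht) k, h.2.1⟩
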